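/- Let $\Sigma$ be a connected, paracompact, Hausdorff smooth $n$-manifold with a smooth Riemannian metric $h$, let $M=\mathbb{R}\times\Sigma$ carry the ultrastatic Lorentzian metric $g=-\mathrm{d}t^2+h$, and assume that $(M,g)$ is globally hyperbolic, every slice $\Sigma_t=\{t\}\times\Sigma$ being a Cauchy hypersurface (an achronal set met exactly once by every inextensible timelike curve). Let $\delta$ and $\delta_\Sigma$ denote the codifferentials of $(M,g)$ and $(\Sigma,h)$, that is, the formal adjoints of the exterior derivatives $\mathrm{d}$ and $\mathrm{d}_\Sigma$ on complex-valued forms with respect to the Hodge inner products $(\alpha,\beta)=\int \frac{1}{k!}(g^{-1})^{\otimes k}(\overline{\alpha},\beta)\,\mathrm{vol}_g$ on $k$-forms on $M$, respectively the same with $h$ on $\Sigma$. Let $A\in\Omega^1(M;\mathbb{C})$ be a smooth solution of Maxwell's equation $\delta\mathrm{d}A=0$, and write $A=A_0\,\mathrm{d}t+A_\Sigma$ with $A_0=\partial_t\lrcorner A$. Then the following are equivalent: (i) $A$ satisfies the Cauchy radiation gauge on $\Sigma_0$: $\delta A=0$ on $M$, and $A_0|_{\Sigma_0}=0$ and $(\partial_t\lrcorner\nabla_{\partial_t}A)|_{\Sigma_0}=0$,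 where $\nabla$ is the Levi-Civita connection of $g$; (ii) $A$ satisfies the temporal gauge $A_0=0$ on $M$ and the Coulomb gauge $\delta_\Sigma A_\Sigma=0$ (on $\Sigma_t$ for every $t\in\mathbb{R}$); (iii) $A$ satisfies the radiation gauge: $A_0=0$ and $\delta A=0$ on $M$. If, furthermore, $\Sigma$ is non-compact and $A$ has spacelike compact support (that is, the support of $A$ is contained in $J(K)=J^+(K)\cup J^-(K)$ for some compact $K\subset M$), then (i), (ii), (iii) are also equivalent to (iv) $A$ satisfies the Coulomb gauge $\delta_\Sigma A_\Sigma=0$ (on $\Sigma_t$ for every $t\in\mathbb{R}$). -/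

import Mathlib

open scoped Manifold ContDiff Topology

noncomputable section

namespace MaxwellGauge

section General

variable {E : Type*} [NormedAddCommGroup E] [NormedSpace ℝ E]
  {H : Type*} [TopologicalSpace H] (I : ModelWithCorners ℝ E H)
  (M : Type*) [TopologicalSpace M] [ChartedSpace H M]

/-! ## Differential forms on a manifold -/

/-- Complex-valued `k`-forms on the manifold `M` (no regularity). -/
abbrev DiffForm (k : ℕ) : Type _ :=
  ∀ x : M, (TangentSpace I x) [⋀^Fin k]→L[ℝ] ℂ

/-- Fields of bilinear forms on the tangent spaces of `M`; used for (pseudo-)Riemannian metrics. -/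
abbrev BilinField : Type _ :=
  ∀ x : M, LinearMap.BilinForm ℝ (TangentSpace I x)

variable {I M} [FiniteDimensional ℝ E]

/-- The form `θ` written in the preferred chart `φ` around `x₀`, that is `(φ⁻¹)^* θ`,
meaningful on the target of `φ`. -/
def chartForm {k : ℕ} (x₀ : M) (θ : DiffForm I M k) (y : E) : E [⋀^Fin k]→L[ℝ] ℂ :=
  (θ ((extChartAt I x₀).symm y)).compContinuousLinearMap
    (mfderiv 𝓘(ℝ, E) I (extChartAt I x₀).symm y)

/-- A form is smooth if its components in all the charts are smooth. -/
def IsSmoothForm {k : ℕ} (θ : DiffForm I M k) : Prop :=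
  ∀ x₀ : M, ContDiffOn ℝ ∞ (chartForm x₀ θ) (extChartAt I x₀).target

/-- The support of a form. -/
def formSupport {k : ℕ} (θ : DiffForm I M k) : Set M :=
  closure {x | θ x ≠ 0}

/-- The exterior derivative `dθ = φ^* d ((φ⁻¹)^* θ)`, computed at `x` in the chart `φ` around `x`. -/
def extDer {k : ℕ} (θ : DiffForm I M k) : DiffForm I M (k + 1) := fun x =>
  (extDeriv (chartForm x θ) (extChartAt I x x)).compContinuousLinearMap
    (mfderiv I 𝓘(ℝ, E) (extChartAt I x) x)

/-! ## Metric, volume and codifferential -/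

/-- The metric `g` written in the preferred chart around `x₀`. -/
def chartMetric (g : BilinField I M) (x₀ : M) (y : E) (v w : E) : ℝ :=
  g ((extChartAt I x₀).symm y)
    (mfderiv 𝓘(ℝ, E) I (extChartAt I x₀).symm y v)
    (mfderiv 𝓘(ℝ, E) I (extChartAt I x₀).symm y w)

/-- The matrix `g_ij` of the metric in the preferred chart around `x₀`, with respect to a fixed
basis of the model space. -/
def chartGram (g : BilinField I M) (x₀ : M) (y : E) :
    Matrix (Fin (Module.finrank ℝ E)) (Fin (Module.finrank ℝ E)) ℝ :=
  Matrix.of fun i j => chartMetric g x₀ y (Module.finBasis ℝ E i) (Module.finBasis ℝ E j)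

/-- The part of the volume measure of `g` which lives on the domain of the preferred chart around
`x₀`: it is `√|det g_ij| dy` in this chart, where `dy` is the Lebesgue measure belonging to the
basis in which the `g_ij` are taken. -/
def chartVolume [MeasurableSpace E] [BorelSpace E] [MeasurableSpace M]
    (g : BilinField I M) (x₀ : M) : MeasureTheory.Measure M :=
  (((Module.finBasis ℝ E).addHaar.restrict (extChartAt I x₀).target).withDensity
    fun y => ENNReal.ofReal (Real.sqrt |(chartGram g x₀ y).det|)).map (extChartAt I x₀).symm

/-- The volume measure `vol_g`: the measures `chartVolume g x₀` are the restrictions of one and the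
same measure to the chart domains, and that measure is their supremum. -/
def volumeMeasure [MeasurableSpace E] [BorelSpace E] [MeasurableSpace M]
    (g : BilinField I M) : MeasureTheory.Measure M :=
  ⨆ x₀ : M, chartVolume g x₀

/-- The matrix of the metric `g` at `x` in a basis of the tangent space at `x`. -/
def gram (g : BilinField I M) (x : M) :
    Matrix (Fin (Module.finrank ℝ E)) (Fin (Module.finrank ℝ E)) ℝ :=
  Matrix.of fun i j =>
    g x (Module.finBasis ℝ E i : TangentSpace I x) (Module.finBasis ℝ E j : TangentSpace I x)

/-- The pointwise product `(1/k!) (g⁻¹)^{⊗k}(conj α, β)` of two `k`-forms,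
`(1/k!) ∑ g^{i₁j₁} ⋯ g^{iₖjₖ} conj(α_{i₁…iₖ}) β_{j₁…jₖ}`. -/
def formInner {k : ℕ} (g : BilinField I M) (α β : DiffForm I M k) (x : M) : ℂ :=
  ((Nat.factorial k : ℂ))⁻¹ *
    ∑ i : Fin k → Fin (Module.finrank ℝ E), ∑ j : Fin k → Fin (Module.finrank ℝ E),
      ((∏ m, ((gram g x)⁻¹ (i m) (j m)) : ℝ) : ℂ) *
        (starRingEnd ℂ (α x fun m => (Module.finBasis ℝ E (i m) : TangentSpace I x)) *
          β x fun m => (Module.finBasis ℝ E (j m) : TangentSpace I x))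

/-- The Hodge inner product `(α, β) = ∫ ⟨α, β⟩ vol_g`. -/
def hodgeInner [MeasurableSpace E] [BorelSpace E] [MeasurableSpace M]
    {k : ℕ} (g : BilinField I M) (α β : DiffForm I M k) : ℂ :=
  ∫ x, formInner g α β x ∂(volumeMeasure g)

/-- `η = δ_g θ`, where `δ_g` is the formal adjoint of the exterior derivative for the Hodge inner
product of `g`: one has `(dα, θ) = (α, η)` for all smooth compactly supported `α`. -/
def IsCodifferential [MeasurableSpace E] [BorelSpace E]
    [MeasurableSpace M] {k : ℕ} (g : BilinField I M) (θ : DiffForm I M (k + 1))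
    (η : DiffForm I M k) : Prop :=
  ∀ α : DiffForm I M k, IsSmoothForm α → IsCompact (formSupport α) →
    hodgeInner g (extDer α) θ = hodgeInner g α η

/-- `P A = 0` for the Maxwell operator `P = δ d` on `1`-forms. -/
def IsMaxwellSolution [MeasurableSpace E] [BorelSpace E]
    [MeasurableSpace M] (g : BilinField I M) (A : DiffForm I M 1) : Prop :=
  IsCodifferential g (extDer A) 0

/-- The Lorenz gauge `δ A = 0`. -/
def LorenzGauge [MeasurableSpace E] [BorelSpace E]
    [MeasurableSpace M] (g : BilinField I M) (A : DiffForm I M 1) : Prop :=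
  IsCodifferential g A 0

/-! ## Levi-Civita connection -/

/-- The Christoffel symbols of the first kind of `g` in the preferred chart around `x₀`,
`g(∇_u v, w) = ½ (∂_u g(v,w) + ∂_v g(u,w) - ∂_w g(u,v))` for constant `u`, `v`, `w`. -/
def christoffel (g : BilinField I M) (x₀ : M) (y u v w : E) : ℝ :=
  (fderiv ℝ (fun z => chartMetric g x₀ z v w) y u
    + fderiv ℝ (fun z => chartMetric g x₀ z u w) y v
    - fderiv ℝ (fun z => chartMetric g x₀ z u v) y w) / 2

/-- The covariant derivative `(∇_u A)(v)` at `x` of a `1`-form for the Levi-Civita connection of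
`g`, computed in the chart around `x`: with `u`, `v` denoting also the components in this chart,
`(∇_u A)(v) = ∂_u (A(v)) - Γ^k(u,v) A_k` where `Γ^k(u,v) = g^{kl} Γ_l(u,v)`. -/
def covDeriv (g : BilinField I M) (A : DiffForm I M 1) (x : M) (u v : TangentSpace I x) : ℂ :=
  let u' : E := mfderiv I 𝓘(ℝ, E) (extChartAt I x) x u
  let v' : E := mfderiv I 𝓘(ℝ, E) (extChartAt I x) x v
  let y : E := extChartAt I x x
  fderiv ℝ (fun z => chartForm x A z fun _ => v') y u'
    - ∑ k, ∑ l, (((chartGram g x y)⁻¹ k l * christoffel g x y u' v' (Module.finBasis ℝ E l) : ℝ) : ℂ)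
        * chartForm x A y fun _ => Module.finBasis ℝ E k

/-! ## Causality -/

/-- The velocity `γ'(s)` of a curve. -/
def velocity (γ : ℝ → M) (s : ℝ) : TangentSpace I (γ s) :=
  mfderiv 𝓘(ℝ, ℝ) I γ s (1 : ℝ)

/-- Timelike at the parameter `s` for the signature `(-,+,…,+)`. -/
def TimelikeAt (g : BilinField I M) (γ : ℝ → M) (s : ℝ) : Prop :=
  g (γ s) (velocity γ s) (velocity γ s) < 0

/-- Causal (timelike or lightlike) at the parameter `s`. -/
def CausalAt (g : BilinField I M) (γ : ℝ → M) (s : ℝ) : Prop :=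
  (velocity γ s : TangentSpace I (γ s)) ≠ 0 ∧ g (γ s) (velocity γ s) (velocity γ s) ≤ 0

/-- An inextensible timelike curve (parametrised over `ℝ`): it has no endpoint in the past nor in
the future. -/
def IsInextensibleTimelike (g : BilinField I M) (γ : ℝ → M) : Prop :=
  ContMDiff 𝓘(ℝ, ℝ) I 1 γ ∧ (∀ s, TimelikeAt g γ s) ∧
    (¬ ∃ p, Filter.Tendsto γ Filter.atTop (𝓝 p)) ∧ ¬ ∃ p, Filter.Tendsto γ Filter.atBot (𝓝 p)

/-- No two points of `T` are joined by a timelike curve. -/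
def IsAchronal (g : BilinField I M) (T : Set M) : Prop :=
  ∀ γ : ℝ → M, ContMDiff 𝓘(ℝ, ℝ) I 1 γ → ∀ a b : ℝ, a < b →
    (∀ s ∈ Set.Icc a b, TimelikeAt g γ s) → ¬ (γ a ∈ T ∧ γ b ∈ T)

/-- A Cauchy hypersurface: an achronal set which is met exactly once by every inextensible
timelike curve. -/
def IsCauchyHypersurface (g : BilinField I M) (T : Set M) : Prop :=
  IsAchronal g T ∧ ∀ γ : ℝ → M, IsInextensibleTimelike g γ → ∃! s, γ s ∈ T

/-- `J(K) = J⁺(K) ∪ J⁻(K)`: the points of `K`, and those which are joined with a point of `K` by a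
causal curve (directed to the future or to the past). -/
def causalHull (g : BilinField I M) (K : Set M) : Set M :=
  K ∪ {q | ∃ γ : ℝ → M, ∃ a b : ℝ, a < b ∧ ContMDiff 𝓘(ℝ, ℝ) I 1 γ ∧
    (∀ s ∈ Set.Icc a b, CausalAt g γ s) ∧ γ a ∈ K ∧ γ b = q}

/-- Spacelike compact support: the support lies in `J(K)` for a compact `K`. -/
def IsSpacelikeCompact (g : BilinField I M) {k : ℕ} (θ : DiffForm I M k) : Prop :=
  ∃ K : Set M, IsCompact K ∧ formSupport θ ⊆ causalHull g K

end General

/-! ## Ultrastatic spacetimes `(ℝ × S, -dt² + h)` -/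

section Ultrastatic

variable {n : ℕ} {S : Type*} [TopologicalSpace S] [ChartedSpace (EuclideanSpace ℝ (Fin n)) S]

/-- Smooth Riemannian metrics on the `n`-manifold `S`. -/
abbrev SmoothMetric (n : ℕ) (S : Type*) [TopologicalSpace S]
    [ChartedSpace (EuclideanSpace ℝ (Fin n)) S] [IsManifold (𝓡 n) ∞ S] : Type _ :=
  Bundle.ContMDiffRiemannianMetric (𝓡 n) ∞ (EuclideanSpace ℝ (Fin n))
    (fun x : S => TangentSpace (𝓡 n) x)

variable [IsManifold (𝓡 n) ∞ S]

/-- The Riemannian metric `h` as a field of bilinear forms. -/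
def spatialMetric (h : SmoothMetric n S) : BilinField (𝓡 n) S := fun x =>
  (h.inner x).toBilinForm

/-- The ultrastatic metric `g = -dt² + h` on `ℝ × S`. A tangent vector at `(t, x)` is a pair
consisting of a tangent vector at `t` and a tangent vector at `x`. -/
def ultrastaticMetric (h : SmoothMetric n S) : BilinField (𝓘(ℝ, ℝ).prod (𝓡 n)) (ℝ × S) := fun p =>
  (-LinearMap.BilinForm.linMulLin (LinearMap.fst ℝ ℝ (EuclideanSpace ℝ (Fin n)))
      (LinearMap.fst ℝ ℝ (EuclideanSpace ℝ (Fin n)))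
    + LinearMap.BilinForm.comp (spatialMetric h p.2 : LinearMap.BilinForm ℝ (EuclideanSpace ℝ (Fin n)))
      (LinearMap.snd ℝ ℝ (EuclideanSpace ℝ (Fin n))) (LinearMap.snd ℝ ℝ (EuclideanSpace ℝ (Fin n))) :
    LinearMap.BilinForm ℝ (ℝ × EuclideanSpace ℝ (Fin n)))

/-- The formula `g((a, v), (b, w)) = -ab + h(v, w)`. -/
theorem ultrastaticMetric_apply (h : SmoothMetric n S) (p : ℝ × S) (a b : ℝ)
    (v w : TangentSpace (𝓡 n) p.2) :
    ultrastaticMetric h p ((a, v) : ℝ × EuclideanSpace ℝ (Fin n))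
      ((b, w) : ℝ × EuclideanSpace ℝ (Fin n)) = -(a * b) + h.inner p.2 v w :=
  rfl

/-- The time slice `Σ_t = {t} × S`. -/
def timeSlice (S : Type*) (t : ℝ) : Set (ℝ × S) := {p | p.1 = t}

/-- The ultrastatic manifold `(ℝ × S, -dt² + h)` is globally hyperbolic, with Cauchy temporal
function `t`: all the time slices are Cauchy hypersurfaces. -/
def IsGloballyHyperbolicUltrastatic (h : SmoothMetric n S) : Prop :=
  ∀ t : ℝ, IsCauchyHypersurface (ultrastaticMetric h) (timeSlice S t)

/-- The vector field `∂_t` on `ℝ × S`; it is the unit normal of the time slices for an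
ultrastatic metric. -/
def partialT (p : ℝ × S) : TangentSpace (𝓘(ℝ, ℝ).prod (𝓡 n)) p :=
  ((1, 0) : ℝ × EuclideanSpace ℝ (Fin n))

/-- `A₀ = ∂_t ⌟ A`. -/
def timeComponent (A : DiffForm (𝓘(ℝ, ℝ).prod (𝓡 n)) (ℝ × S) 1) (p : ℝ × S) : ℂ :=
  A p fun _ => partialT p

/-- The spatial part `A_Σ = A - A₀ dt`, as a `1`-form on `S` depending on the time `t`:
it maps a tangent vector `v` at `x` to `A (0, v)`. -/
def spatialPart (A : DiffForm (𝓘(ℝ, ℝ).prod (𝓡 n)) (ℝ × S) 1) (t : ℝ) : DiffForm (𝓡 n) S 1 :=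
  fun x => ContinuousAlternatingMap.compContinuousLinearMap
    (A (t, x) : (ℝ × EuclideanSpace ℝ (Fin n)) [⋀^Fin 1]→L[ℝ] ℂ)
    (ContinuousLinearMap.inr ℝ ℝ (EuclideanSpace ℝ (Fin n)))

/-- The temporal gauge `A₀ = 0`. -/
def TemporalGauge (A : DiffForm (𝓘(ℝ, ℝ).prod (𝓡 n)) (ℝ × S) 1) : Prop :=
  ∀ p, timeComponent A p = 0

/-- The Coulomb gauge `δ_Σ A_Σ = 0` (at all times). -/
def CoulombGauge [MeasurableSpace S] (h : SmoothMetric n S)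
    (A : DiffForm (𝓘(ℝ, ℝ).prod (𝓡 n)) (ℝ × S) 1) : Prop :=
  ∀ t : ℝ, IsCodifferential (spatialMetric h) (spatialPart A t) 0

/-- The Cauchy radiation gauge on `Σ₀`: `δ A = 0`, and `n ⌟ A` and `n ⌟ ∇_n A` vanish on `Σ₀`,
where `n = ∂_t`. -/
def CauchyRadiationGauge [MeasurableSpace S] (h : SmoothMetric n S)
    (A : DiffForm (𝓘(ℝ, ℝ).prod (𝓡 n)) (ℝ × S) 1) : Prop :=
  LorenzGauge (ultrastaticMetric h) A ∧
    ∀ p ∈ timeSlice S 0, timeComponent A p = 0 ∧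
      covDeriv (ultrastaticMetric h) A p (partialT p) (partialT p) = 0

/-- The radiation gauge: `A₀ = 0` and `δ A = 0`. -/
def RadiationGauge [MeasurableSpace S] (h : SmoothMetric n S)
    (A : DiffForm (𝓘(ℝ, ℝ).prod (𝓡 n)) (ℝ × S) 1) : Prop :=
  TemporalGauge A ∧ LorenzGauge (ultrastaticMetric h) A

end Ultrastatic

end MaxwellGauge

end

open scoped Bundle

/-! Two identities on a single slice carry everything. Let f be a test function on Σ. Maxwell's
equation tested with χ(t) f(x) dt sees only the electric components ∂_t A_Σ - d_Σ A₀, and since χ is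
arbitrary it gives Gauss's law ⟨df, ∂_t A_Σ⟩ = ⟨df, dA₀⟩ at every time
(`hodgeInner_timeDeriv_spatialPart`). The Lorenz gauge tested with χ(t) f(x) gives ⟨f, ∂_t A₀⟩ +
⟨df, A_Σ⟩ = 0 at every time (`hodgeInner_timeDeriv_timeZeroForm`). Both rest on the volume of the
spacetime being Lebesgue measure times the volume of the slice (`volumeMeasure_ultrastatic`).

If A₀ = 0, the Lorenz identity is the Coulomb gauge; conversely Fubini recovers the Lorenz gauge
from the Coulomb gauge on the slices. This is (ii) ⇔ (iii). In an ultrastatic metric the Christoffel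
symbols of the pair ∂_t, ∂_t vanish, so (∇_{∂_t} A)(∂_t) is ∂_t A₀; hence (iii) ⇒ (i). For (i) ⇒
(iii), differentiating the Lorenz identity in time and inserting Gauss's law yields the weak wave
equation ⟨f, ∂_t² A₀⟩ = -⟨df, dA₀⟩ (`hodgeInner_wave`). Its Cauchy data vanish, so A₀ = 0 by
uniqueness (`IsWeakWave.eq_zero`).

For (iv) ⇒ (ii), differentiate the Coulomb identity in time: Gauss's law becomes ⟨df, dA₀⟩ = 0.
Spacelike compactness allows f = A₀(t, ·), so dA₀ = 0, and A₀(t, ·) is a constant of compact support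
on a connected non-compact manifold, thus zero.

Uniqueness and compactness of supports both need closed Riemannian balls to be compact. This is
extracted from global hyperbolicity: a curve of finite length in Σ without endpoint would lift to an
inextensible timelike curve of bounded time, which misses a late Cauchy slice. So Σ is complete, and
the Hopf–Rinow argument for length spaces applies. Uniqueness itself is an energy estimate in one
chart (`eq_zero_of_weak_wave`), globalised by looking at the earliest point of the support in a
compact backward cone. The cone is not the sharp light cone; any finite speed bound suffices. -/

namespace MaxwellGauge

open MeasureTheory

/-! ### Parametric integrals and test functions of time. -/

section ParametricIntegrals

variable {X : Type*} [TopologicalSpace X] [T2Space X] [MeasurableSpace X] [OpensMeasurableSpace X]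
  {G : Type*} [NormedAddCommGroup G] [NormedSpace ℝ G]

/-- Differentiation under the integral sign over a compact set. -/
theorem hasDerivAt_setIntegral_of_isCompact {μ : Measure X} {K : Set X} (hK : IsCompact K)
    (hμ : μ K < ⊤) {F F' : ℝ → X → G} {U : Set ℝ} (hU : IsOpen U)
    (hF : ContinuousOn (Function.uncurry F) (U ×ˢ K))
    (hF' : ContinuousOn (Function.uncurry F') (U ×ˢ K))
    (hd : ∀ t ∈ U, ∀ x ∈ K, HasDerivAt (fun s => F s x) (F' t x) t) {t : ℝ} (ht : t ∈ U) :
    HasDerivAt (fun s => ∫ x in K, F s x ∂μ) (∫ x in K, F' t x ∂μ) t := by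
  obtain ⟨r, hr, hrU⟩ := Metric.isOpen_iff.1 hU t ht
  have hIcc : Metric.closedBall t (r / 2) ⊆ U :=
    (Metric.closedBall_subset_ball (by linarith)).trans hrU
  have hcomp : IsCompact (Metric.closedBall t (r / 2) ×ˢ K) := (isCompact_closedBall _ _).prod hK
  obtain ⟨C, hC⟩ := hcomp.exists_bound_of_continuousOn
    (hF'.mono (Set.prod_mono hIcc subset_rfl))
  have hmeas : ∀ f : ℝ → X → G, ContinuousOn (Function.uncurry f) (U ×ˢ K) → ∀ s ∈ U,
      AEStronglyMeasurable (f s) (μ.restrict K) := by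
    intro f hf s hs
    have : ContinuousOn (f s) K := hf.comp (f := fun x => (s, x)) (by fun_prop) fun x hx => ⟨hs, hx⟩
    exact this.aestronglyMeasurable_of_isCompact hK hK.measurableSet
  have : IsFiniteMeasure (μ.restrict K) := ⟨by simpa using hμ⟩
  refine (hasDerivAt_integral_of_dominated_loc_of_deriv_le (μ := μ.restrict K) (F := F)
    (F' := F') (bound := fun _ => C) (s := Metric.ball t (r / 2)) (Metric.ball_mem_nhds _ (by linarith))
    ?_ ?_ (hmeas F' hF' t ht) ?_ (integrable_const _) ?_).2
  · filter_upwards [hU.mem_nhds ht] with s hs using hmeas F hF s hs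
  · have : ContinuousOn (F t) K := hF.comp (f := fun x => (t, x)) (by fun_prop) fun x hx => ⟨ht, hx⟩
    exact this.integrableOn_of_subset_isCompact hK hK.measurableSet subset_rfl hμ.ne
  · filter_upwards [ae_restrict_mem hK.measurableSet] with x hx s hs
    exact hC (s, x) ⟨Metric.ball_subset_closedBall hs, hx⟩
  · filter_upwards [ae_restrict_mem hK.measurableSet] with x hx s hs
    exact hd s (hIcc (Metric.ball_subset_closedBall hs)) x hx

/-- A continuous function on the line which is orthogonal to all test functions vanishes. -/
theorem eq_zero_of_integral_smul_eq_zero [CompleteSpace G] {F : ℝ → G} (hF : Continuous F)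
    (h : ∀ χ : ℝ → ℝ, ContDiff ℝ ∞ χ → HasCompactSupport χ → ∫ t, χ t • F t = 0) (t : ℝ) :
    F t = 0 := by
  have h1 : ∀ᵐ t ∂(volume : Measure ℝ), F t = 0 :=
    ae_eq_zero_of_integral_contDiff_smul_eq_zero hF.locallyIntegrable h
  have h2 : F = fun _ => 0 := (Continuous.ae_eq_iff_eq volume hF continuous_const).1 h1
  exact congrFun h2 t

/-- Integration by parts without boundary terms. It moves the time derivative from the cut-off χ
onto the Hodge product with A₀ when the Lorenz gauge is tested. -/
theorem integral_deriv_smul_eq_neg {χ : ℝ → ℝ} (hχ : ContDiff ℝ ∞ χ)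
    (hc : HasCompactSupport χ) {a a' : ℝ → ℂ} (ha : ∀ t, HasDerivAt a (a' t) t)
    (ha' : Continuous a') :
    ∫ t, deriv χ t • a t = -∫ t, χ t • a' t := by
  have hcont : Continuous a := continuous_iff_continuousAt.2 fun t => (ha t).continuousAt
  have hχ' : Continuous (deriv χ) := hχ.continuous_deriv (by simp)
  have hχd : ∀ t, HasDerivAt (fun s => (χ s : ℂ)) ((deriv χ t : ℝ) : ℂ) t := fun t =>
    ((hχ.differentiable (by simp)) t).hasDerivAt.ofReal_comp
  have hcc : HasCompactSupport (fun s => (χ s : ℂ)) := hc.comp_left (g := Complex.ofReal) (by simp)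
  have hcc' : HasCompactSupport (fun s => ((deriv χ s : ℝ) : ℂ)) :=
    hc.deriv.comp_left (g := Complex.ofReal) (by simp)
  have := integral_mul_deriv_eq_deriv_mul_of_integrable (u := fun s => (χ s : ℂ)) (v := a)
    (u' := fun s => ((deriv χ s : ℝ) : ℂ)) (v' := a') (fun t _ => hχd t) (fun t _ => ha t)
    (((Complex.continuous_ofReal.comp hχ.continuous).mul ha').integrable_of_hasCompactSupport
      hcc.mul_right)
    (((Complex.continuous_ofReal.comp hχ').mul hcont).integrable_of_hasCompactSupport
      hcc'.mul_right)
    (((Complex.continuous_ofReal.comp hχ.continuous).mul hcont).integrable_of_hasCompactSupport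
      hcc.mul_right)
  simp only [Complex.real_smul]
  rw [this, neg_neg]

end ParametricIntegrals


/-! ### Contractions of forms with an inverse metric, and the Lorentzian block form. -/

section LinearAlgebra

variable {E : Type*} [NormedAddCommGroup E] [NormedSpace ℝ E]
  {ι ι' : Type*} [Fintype ι] [Fintype ι'] [DecidableEq ι] [DecidableEq ι']

/-- The Gram matrix of a bilinear form on a family of vectors. -/
noncomputable def gramOf (B : LinearMap.BilinForm ℝ E) (b : ι → E) : Matrix ι ι ℝ :=
  Matrix.of fun i j => B (b i) (b j)

/-- The contraction of two alternating forms with the inverse of a bilinear form, computed in the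
basis `b`. -/
noncomputable def tensorInner {k : ℕ} (B : LinearMap.BilinForm ℝ E) (b : ι → E) (α β : E [⋀^Fin k]→L[ℝ] ℂ) : ℂ :=
  ((Nat.factorial k : ℂ))⁻¹ *
    ∑ i : Fin k → ι, ∑ j : Fin k → ι, ((∏ m, ((gramOf B b)⁻¹ (i m) (j m)) : ℝ) : ℂ) *
      (starRingEnd ℂ (α fun m => b (i m)) * β fun m => b (j m))

omit [Fintype ι'] [DecidableEq ι] [DecidableEq ι'] in
theorem gramOf_eq_mul {B : LinearMap.BilinForm ℝ E} {b : ι → E} {b' : ι' → E} {P : Matrix ι' ι ℝ}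
    (hP : ∀ i, b' i = ∑ a, P i a • b a) : gramOf B b' = P * gramOf B b * P.transpose := by
  ext i j
  simp only [gramOf, Matrix.of_apply, hP, map_sum, LinearMap.sum_apply, map_smul,
    LinearMap.smul_apply, smul_eq_mul, Matrix.mul_apply, Matrix.transpose_apply, Finset.sum_mul]
  refine Finset.sum_congr rfl fun a _ => ?_
  rw [Finset.mul_sum]
  refine Finset.sum_congr rfl fun c _ => ?_
  ring

omit [Fintype ι'] [DecidableEq ι] [DecidableEq ι'] in
theorem form_apply_sum {k : ℕ} (α : E [⋀^Fin k]→L[ℝ] ℂ) {b : ι → E} {b' : ι' → E}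
    {P : Matrix ι' ι ℝ} (hP : ∀ i, b' i = ∑ a, P i a • b a) (i : Fin k → ι') :
    α (fun m => b' (i m)) = ∑ a : Fin k → ι, ((∏ m, P (i m) (a m) : ℝ) : ℂ) * α fun m => b (a m) := by
  simp only [hP]
  rw [← ContinuousAlternatingMap.coe_toAlternatingMap, ← AlternatingMap.coe_multilinearMap]
  rw [MultilinearMap.map_sum]
  refine Finset.sum_congr rfl fun a _ => ?_
  rw [MultilinearMap.map_smul_univ]
  simp

theorem sum_comm₄ {ι₁ ι₂ ι₃ ι₄ : Type*} [Fintype ι₁] [Fintype ι₂] [Fintype ι₃] [Fintype ι₄]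
    (f : ι₁ → ι₂ → ι₃ → ι₄ → ℂ) :
    ∑ i, ∑ j, ∑ a, ∑ c, f i j a c = ∑ a, ∑ c, ∑ i, ∑ j, f i j a c := by
  calc _ = ∑ i, ∑ a, ∑ j, ∑ c, f i j a c := Finset.sum_congr rfl fun i _ => Finset.sum_comm
    _ = ∑ a, ∑ i, ∑ j, ∑ c, f i j a c := Finset.sum_comm
    _ = ∑ a, ∑ i, ∑ c, ∑ j, f i j a c :=
      Finset.sum_congr rfl fun a _ => Finset.sum_congr rfl fun i _ => Finset.sum_comm
    _ = _ := Finset.sum_congr rfl fun a _ => Finset.sum_comm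

/-- The contraction does not depend on the basis. -/
theorem tensorInner_eq_of_basis {k : ℕ} (B : LinearMap.BilinForm ℝ E) (b : Module.Basis ι ℝ E)
    (b' : Module.Basis ι' ℝ E) (hB : IsUnit (gramOf B b).det) (α β : E [⋀^Fin k]→L[ℝ] ℂ) :
    tensorInner B b' α β = tensorInner B b α β := by
  set P : Matrix ι' ι ℝ := Matrix.of fun i a => b.repr (b' i) a with hPdef
  set Q : Matrix ι ι' ℝ := Matrix.of fun a i => b'.repr (b a) i with hQdef
  have hP : ∀ i, b' i = ∑ a, P i a • b a := fun i => (b.sum_repr (b' i)).symm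
  have hQ : ∀ a, b a = ∑ i, Q a i • b' i := fun a => (b'.sum_repr (b a)).symm
  have hQP : Q * P = 1 := by
    ext a c
    have h1 : b.repr (b a) c = b.repr (∑ i, Q a i • b' i) c := by rw [← hQ]
    rw [map_sum, Finsupp.finsetSum_apply] at h1
    simp only [map_smul, Finsupp.smul_apply, Module.Basis.repr_self] at h1
    rw [Matrix.mul_apply, Matrix.one_apply, ← Finsupp.single_apply (a := a) (a' := c) (b := (1 : ℝ))]
    exact h1.symm
  have hPQ : P * Q = 1 := by
    ext a c
    have h1 : b'.repr (b' a) c = b'.repr (∑ i, P a i • b i) c := by rw [← hP]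
    rw [map_sum, Finsupp.finsetSum_apply] at h1
    simp only [map_smul, Finsupp.smul_apply, Module.Basis.repr_self] at h1
    rw [Matrix.mul_apply, Matrix.one_apply, ← Finsupp.single_apply (a := a) (a' := c) (b := (1 : ℝ))]
    exact h1.symm
  set G := gramOf B b
  have hG' : gramOf B b' = P * G * P.transpose := gramOf_eq_mul hP
  have hinv : (gramOf B b')⁻¹ = Q.transpose * G⁻¹ * Q := by
    apply Matrix.inv_eq_right_inv
    have h1 : P.transpose * Q.transpose = 1 := by rw [← Matrix.transpose_mul, hQP, Matrix.transpose_one]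
    calc gramOf B b' * (Q.transpose * G⁻¹ * Q)
        = P * G * (P.transpose * Q.transpose) * G⁻¹ * Q := by rw [hG']; simp only [Matrix.mul_assoc]
      _ = P * (G * G⁻¹) * Q := by rw [h1]; simp only [Matrix.mul_assoc, Matrix.mul_one]
      _ = 1 := by rw [Matrix.mul_nonsing_inv _ hB, Matrix.mul_one, hPQ]
  have hback : P.transpose * (gramOf B b')⁻¹ * P = G⁻¹ := by
    have h1 : P.transpose * Q.transpose = 1 := by rw [← Matrix.transpose_mul, hQP, Matrix.transpose_one]
    calc P.transpose * (gramOf B b')⁻¹ * P = (P.transpose * Q.transpose) * G⁻¹ * (Q * P) := by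
          rw [hinv]; simp only [Matrix.mul_assoc]
      _ = G⁻¹ := by rw [h1, hQP, Matrix.mul_one, Matrix.one_mul]
  unfold tensorInner
  congr 1
  -- The k-fold tensor power of Pᵀ G'⁻¹ P = G⁻¹: a product over the slots of double sums is a double
  -- sum over index tuples.
  have key : ∀ a c : Fin k → ι, ∑ i : Fin k → ι', ∑ j : Fin k → ι',
      (∏ m, P (i m) (a m)) * (∏ m, (gramOf B b')⁻¹ (i m) (j m)) * (∏ m, P (j m) (c m))
      = ∏ m, G⁻¹ (a m) (c m) := by
    intro a c
    rw [← hback]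
    simp only [Matrix.mul_apply, Matrix.transpose_apply, Finset.sum_mul]
    simp only [← Finset.prod_mul_distrib]
    rw [Finset.sum_comm]
    have : ∀ m : Fin k, ∑ j, ∑ i, P i (a m) * (gramOf B b')⁻¹ i j * P j (c m)
        = ∑ p : ι' × ι', P p.2 (a m) * (gramOf B b')⁻¹ p.2 p.1 * P p.1 (c m) := fun m => by
      rw [Fintype.sum_prod_type]
    simp only [this]
    rw [Finset.prod_univ_sum, Fintype.piFinset_univ, ← Fintype.sum_prod_type']
    refine Fintype.sum_equiv (Equiv.arrowProdEquivProdArrow (Fin k) (fun _ => ι') (fun _ => ι')).symm _ _ fun p => ?_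
    simp [Equiv.arrowProdEquivProdArrow]
  simp only [form_apply_sum _ hP, map_sum, map_mul, Complex.conj_ofReal]
  have hexp : ∀ i j : Fin k → ι', (((∏ m, (gramOf B b')⁻¹ (i m) (j m) : ℝ)) : ℂ) *
      ((∑ a : Fin k → ι, ((∏ m, P (i m) (a m) : ℝ) : ℂ) * starRingEnd ℂ (α fun m => b (a m))) *
        ∑ c : Fin k → ι, ((∏ m, P (j m) (c m) : ℝ) : ℂ) * β fun m => b (c m))
      = ∑ a : Fin k → ι, ∑ c : Fin k → ι,
        (((∏ m, P (i m) (a m)) * (∏ m, (gramOf B b')⁻¹ (i m) (j m)) * (∏ m, P (j m) (c m)) : ℝ) : ℂ)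
          * (starRingEnd ℂ (α fun m => b (a m)) * β fun m => b (c m)) := by
    intro i j
    rw [Finset.sum_mul_sum, Finset.mul_sum]
    refine Finset.sum_congr rfl fun a _ => ?_
    rw [Finset.mul_sum]
    refine Finset.sum_congr rfl fun c _ => ?_
    push_cast
    ring
  simp only [hexp]
  calc _ = ∑ a : Fin k → ι, ∑ c : Fin k → ι, ∑ i : Fin k → ι', ∑ j : Fin k → ι',
        (((∏ m, P (i m) (a m)) * (∏ m, (gramOf B b')⁻¹ (i m) (j m)) * (∏ m, P (j m) (c m)) : ℝ) : ℂ)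
          * (starRingEnd ℂ (α fun m => b (a m)) * β fun m => b (c m)) := by
        exact sum_comm₄ _
    _ = _ := by
        refine Finset.sum_congr rfl fun a _ => Finset.sum_congr rfl fun c _ => ?_
        rw [← key a c]
        push_cast
        simp only [Finset.sum_mul]

theorem tensorInner_zero_form (B : LinearMap.BilinForm ℝ E) (b : ι → E)
    (α β : E [⋀^Fin 0]→L[ℝ] ℂ) :
    tensorInner B b α β = starRingEnd ℂ (α ![]) * β ![] := by
  simp [tensorInner, Subsingleton.elim (fun m : Fin 0 => b _) ![]]

theorem tensorInner_one_form (B : LinearMap.BilinForm ℝ E) (b : ι → E)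
    (α β : E [⋀^Fin 1]→L[ℝ] ℂ) :
    tensorInner B b α β = ∑ i, ∑ j, (((gramOf B b)⁻¹ i j : ℝ) : ℂ) *
      (starRingEnd ℂ (α fun _ => b i) * β fun _ => b j) := by
  simp only [tensorInner, Nat.factorial_one, Nat.cast_one, inv_one, one_mul, Fin.prod_univ_one]
  refine Fintype.sum_equiv (Equiv.funUnique (Fin 1) ι) _ _ fun i => ?_
  refine Fintype.sum_equiv (Equiv.funUnique (Fin 1) ι) _ _ fun j => ?_
  have : ∀ (f : Fin 1 → ι), (fun m => b (f m)) = fun _ => b (f default) := fun f => by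
    ext m; rw [Subsingleton.elim m default]
  rw [this i, this j]
  rfl

/-- The bilinear form `-dt² + H` on a product. -/
noncomputable def lorentzForm (H : LinearMap.BilinForm ℝ E) : LinearMap.BilinForm ℝ (ℝ × E) :=
  -LinearMap.BilinForm.linMulLin (LinearMap.fst ℝ ℝ E) (LinearMap.fst ℝ ℝ E)
    + LinearMap.BilinForm.comp H (LinearMap.snd ℝ ℝ E) (LinearMap.snd ℝ ℝ E)

theorem lorentzForm_apply (H : LinearMap.BilinForm ℝ E) (v w : ℝ × E) :
    lorentzForm H v w = -(v.1 * w.1) + H v.2 w.2 := rfl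

/-- The basis of `ℝ × E` adapted to the product. -/
noncomputable def prodBasis (b : Module.Basis ι ℝ E) : Module.Basis (Unit ⊕ ι) ℝ (ℝ × E) :=
  (Module.Basis.singleton Unit ℝ).prod b

omit [Fintype ι] [DecidableEq ι] in
theorem prodBasis_inl (b : Module.Basis ι ℝ E) (u : Unit) : prodBasis b (Sum.inl u) = (1, 0) := by
  simp [prodBasis]

omit [Fintype ι] [DecidableEq ι] in
theorem prodBasis_inr (b : Module.Basis ι ℝ E) (i : ι) : prodBasis b (Sum.inr i) = (0, b i) := by
  simp [prodBasis]

omit [Fintype ι] [DecidableEq ι] in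
theorem gramOf_lorentzForm (H : LinearMap.BilinForm ℝ E) (b : Module.Basis ι ℝ E) :
    gramOf (lorentzForm H) (prodBasis b) = Matrix.fromBlocks (-1) 0 0 (gramOf H b) := by
  ext (i | i) (j | j) <;>
  simp [gramOf, lorentzForm_apply, prodBasis_inl, prodBasis_inr]

theorem gramOf_lorentzForm_inv (H : LinearMap.BilinForm ℝ E) (b : Module.Basis ι ℝ E)
    (hH : IsUnit (gramOf H b).det) :
    (gramOf (lorentzForm H) (prodBasis b))⁻¹ = Matrix.fromBlocks (-1) 0 0 (gramOf H b)⁻¹ := by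
  apply Matrix.inv_eq_right_inv
  rw [gramOf_lorentzForm, Matrix.fromBlocks_multiply]
  simp [Matrix.mul_nonsing_inv _ hH]

theorem det_gramOf_lorentzForm (H : LinearMap.BilinForm ℝ E) (b : Module.Basis ι ℝ E) :
    (gramOf (lorentzForm H) (prodBasis b)).det = -(gramOf H b).det := by
  rw [gramOf_lorentzForm, Matrix.det_fromBlocks_zero₂₁]
  simp

/-- In a basis adapted to the product the inverse metric is block diagonal with blocks -1 and H⁻¹,
so time and space components do not interact. -/
theorem tensorInner_lorentz_one_form (H : LinearMap.BilinForm ℝ E) (b : Module.Basis ι ℝ E)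
    (hH : IsUnit (gramOf H b).det) (α β : (ℝ × E) [⋀^Fin 1]→L[ℝ] ℂ) :
    tensorInner (lorentzForm H) (prodBasis b) α β =
      -(starRingEnd ℂ (α fun _ => (1, 0)) * β fun _ => (1, 0)) +
      tensorInner H b (α.compContinuousLinearMap (ContinuousLinearMap.inr ℝ ℝ E))
        (β.compContinuousLinearMap (ContinuousLinearMap.inr ℝ ℝ E)) := by
  rw [tensorInner_one_form, tensorInner_one_form, gramOf_lorentzForm_inv H b hH]
  simp [Fintype.sum_sum_type, prodBasis_inl, prodBasis_inr]
  rfl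

/-- As the inverse metric is block diagonal and α has only mixed components, the purely spatial
(magnetic) part of β never enters. Each mixed component occurs in two orders, which cancels the
factor 1/2!, and the time-time entry -1 of the inverse metric produces the sign. -/
theorem tensorInner_lorentz_two_form (H : LinearMap.BilinForm ℝ E) (b : Module.Basis ι ℝ E)
    (hH : IsUnit (gramOf H b).det) (α β : (ℝ × E) [⋀^Fin 2]→L[ℝ] ℂ)
    (hα : ∀ v w : E, α ![(0, v), (0, w)] = 0) (ξ η : E [⋀^Fin 1]→L[ℝ] ℂ)
    (hξ : ∀ v, α ![(1, 0), (0, v)] = ξ fun _ => v) (hη : ∀ v, β ![(1, 0), (0, v)] = η fun _ => v) :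
    tensorInner (lorentzForm H) (prodBasis b) α β = -tensorInner H b ξ η := by
  have hsw : ∀ (γ : (ℝ × E) [⋀^Fin 2]→L[ℝ] ℂ) v w, γ ![v, w] = -γ ![w, v] := fun γ v w => by
    have := γ.toAlternatingMap.map_swap (v := ![w, v]) (i := 0) (j := 1) (by simp)
    have h2 : (![w, v] : Fin 2 → ℝ × E) ∘ (Equiv.swap (0 : Fin 2) 1) = ![v, w] := by
      ext i <;> fin_cases i <;> simp
    rw [h2] at this
    exact this
  have hdiag : ∀ (γ : (ℝ × E) [⋀^Fin 2]→L[ℝ] ℂ) v, γ ![v, v] = 0 := fun γ v =>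
    γ.map_eq_zero_of_eq (i := 0) (j := 1) ![v, v] (by simp) (by simp)
  have hsum : ∀ f : (Fin 2 → Unit ⊕ ι) → ℂ, ∑ i, f i = ∑ a, ∑ c, f ![a, c] := fun f => by
    rw [← Fintype.sum_prod_type']
    exact Fintype.sum_equiv (finTwoArrowEquiv _) _ _ fun i => by
      congr 1; ext m; fin_cases m <;> simp
  have hvec : ∀ a c : Unit ⊕ ι, (fun m => prodBasis b (![a, c] m)) = ![prodBasis b a, prodBasis b c] :=
    fun a c => by ext m <;> fin_cases m <;> simp
  rw [tensorInner_one_form, tensorInner, gramOf_lorentzForm_inv H b hH]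
  simp only [hsum, hvec]
  have hα' : ∀ v, α ![(0, v), (1, 0)] = -ξ fun _ => v := fun v => by rw [hsw, hξ]
  have hβ' : ∀ v, β ![(0, v), (1, 0)] = -η fun _ => v := fun v => by rw [hsw, hη]
  simp only [Fintype.sum_sum_type, prodBasis_inl, prodBasis_inr, hα, hξ, hη, hdiag, hα', hβ']
  simp [Finset.sum_neg_distrib]
  ring

end LinearAlgebra


/-! ### Forms and metrics in a chart; functions as `0`-forms. -/

section Charts

variable {E : Type*} [NormedAddCommGroup E] [NormedSpace ℝ E]
  {H : Type*} [TopologicalSpace H] {I : ModelWithCorners ℝ E H}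
  {M : Type*} [TopologicalSpace M] [ChartedSpace H M]

/-- The value of a form at a point, as an alternating form on the model space. -/
noncomputable def formVal {k : ℕ} (θ : DiffForm I M k) (x : M) : E [⋀^Fin k]→L[ℝ] ℂ := θ x

/-- The value of a metric at a point, as a bilinear form on the model space. -/
noncomputable def metricVal (g : BilinField I M) (x : M) : LinearMap.BilinForm ℝ E := g x

/-- The derivative of the inverse of the preferred chart around `z`. -/
noncomputable def chartDeriv (I : ModelWithCorners ℝ E H) (z : M) (y : E) : E →L[ℝ] E :=
  mfderiv 𝓘(ℝ, E) I (extChartAt I z).symm y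

/-- A field of bilinear forms written in the preferred chart around `z`. -/
noncomputable def chartBilin (g : BilinField I M) (z : M) (y : E) : LinearMap.BilinForm ℝ E :=
  LinearMap.BilinForm.comp (metricVal g ((extChartAt I z).symm y))
    (chartDeriv I z y : E →ₗ[ℝ] E) (chartDeriv I z y : E →ₗ[ℝ] E)

theorem chartBilin_apply (g : BilinField I M) (z : M) (y v w : E) :
    chartBilin g z y v w = chartMetric g z y v w := rfl

variable [FiniteDimensional ℝ E]

theorem chartGram_eq (g : BilinField I M) (z : M) (y : E) :
    chartGram g z y = gramOf (chartBilin g z y) (Module.finBasis ℝ E) := rfl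

theorem formInner_eq {k : ℕ} (g : BilinField I M) (α β : DiffForm I M k) (x : M) :
    formInner g α β x = tensorInner (metricVal g x) (Module.finBasis ℝ E) (formVal α x) (formVal β x) := rfl

omit [FiniteDimensional ℝ E] in
theorem chartForm_eq {k : ℕ} (z : M) (θ : DiffForm I M k) (y : E) :
    chartForm z θ y = (formVal θ ((extChartAt I z).symm y)).compContinuousLinearMap (chartDeriv I z y) := rfl

variable [I.Boundaryless] [IsManifold I ∞ M]

omit [FiniteDimensional ℝ E] in
theorem chartDeriv_invertible {z : M} {y : E} (hy : y ∈ (extChartAt I z).target) :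
    (chartDeriv I z y).IsInvertible := by
  have := isInvertible_mfderivWithin_extChartAt_symm (I := I) hy
  rw [I.range_eq_univ, mfderivWithin_univ] at this
  exact this

omit [FiniteDimensional ℝ E] in
theorem chartDeriv_self (x : M) : chartDeriv I x (extChartAt I x x) = ContinuousLinearMap.id ℝ E := by
  have := mfderivWithin_range_extChartAt_symm (I := I) (x := x)
  rw [I.range_eq_univ, mfderivWithin_univ] at this
  exact this

omit [FiniteDimensional ℝ E] [IsManifold I ∞ M] in
theorem isOpen_chartTarget (z : M) : IsOpen (extChartAt I z).target := isOpen_extChartAt_target z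

omit [FiniteDimensional ℝ E] in
-- The tangent space at x is identified with the model space through the preferred chart at x, so
-- that chart represents the value at x without any change of frame. This is how pointwise values
-- are read off from smooth chart expressions.
theorem chartForm_self {k : ℕ} (x : M) (θ : DiffForm I M k) :
    chartForm x θ (extChartAt I x x) = formVal θ x := by
  rw [chartForm_eq, chartDeriv_self]
  have h : (extChartAt I x).symm (extChartAt I x x) = x := (extChartAt I x).left_inv (mem_extChartAt_source x)
  rw [h]
  ext v
  rfl

omit [FiniteDimensional ℝ E] [I.Boundaryless] in
theorem extDer_eq_self {k : ℕ} (θ : DiffForm I M k) (x : M) :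
    formVal (extDer θ) x = extDeriv (chartForm x θ) (extChartAt I x x) := by
  have h := mfderiv_extChartAt_self (I := I) (x := x)
  unfold formVal extDer
  rw [h]
  ext v
  rfl

/-- A basis of the tangent space from the coordinate vectors of a chart. -/
noncomputable def chartBasis {z : M} {y : E} (hy : y ∈ (extChartAt I z).target) :
    Module.Basis (Fin (Module.finrank ℝ E)) ℝ E :=
  (Module.finBasis ℝ E).map (chartDeriv_invertible hy).choose.toLinearEquiv

theorem chartBasis_apply {z : M} {y : E} (hy : y ∈ (extChartAt I z).target) (i) :
    chartBasis hy i = chartDeriv I z y (Module.finBasis ℝ E i) := by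
  have := (chartDeriv_invertible hy).choose_spec
  simp only [chartBasis, Module.Basis.map_apply]
  conv_rhs => rw [← this]
  rfl

/-- The coordinate vectors of a fixed chart are just another basis of the tangent space, and the
contraction is independent of the basis. -/
theorem formInner_symm_chart {k : ℕ} (g : BilinField I M)
    (hg : ∀ x, IsUnit (gramOf (metricVal g x) (Module.finBasis ℝ E)).det) (α β : DiffForm I M k) {z : M}
    {y : E} (hy : y ∈ (extChartAt I z).target) :
    formInner g α β ((extChartAt I z).symm y) =
      tensorInner (chartBilin g z y) (Module.finBasis ℝ E) (chartForm z α y) (chartForm z β y) := by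
  rw [formInner_eq, ← tensorInner_eq_of_basis _ _ (chartBasis hy) (hg _)]
  unfold tensorInner
  have : gramOf (metricVal g ((extChartAt I z).symm y)) (chartBasis hy) =
      gramOf (chartBilin g z y) (Module.finBasis ℝ E) := by
    ext i j
    simp only [gramOf, Matrix.of_apply, chartBasis_apply]
    rfl
  rw [this]
  simp only [chartBasis_apply]
  rfl

/-! ### Functions as `0`-forms -/

/-- The differential of a function, as a linear form on the model space. -/
noncomputable def differential (I : ModelWithCorners ℝ E H) (f : M → ℂ) (x : M) : E →L[ℝ] ℂ :=
  mfderiv I 𝓘(ℝ, ℂ) f x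

/-- The `0`-form given by a function. -/
noncomputable def zeroForm (I : ModelWithCorners ℝ E H) (f : M → ℂ) : DiffForm I M 0 := fun x =>
  ContinuousAlternatingMap.constOfIsEmpty ℝ (TangentSpace I x) (Fin 0) (f x)

omit [FiniteDimensional ℝ E] [I.Boundaryless] [IsManifold I ∞ M] in
theorem zeroForm_apply_self (θ : DiffForm I M 0) : zeroForm I (fun x => θ x ![]) = θ := by
  funext x
  ext v
  rw [Subsingleton.elim v ![]]
  rfl

omit [FiniteDimensional ℝ E] [I.Boundaryless] in
theorem isSmoothForm_zeroForm_iff {f : M → ℂ} :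
    IsSmoothForm (zeroForm I f) ↔ ContMDiff I 𝓘(ℝ, ℂ) ∞ f := by
  have key : ∀ z : M, ContDiffOn ℝ ∞ (chartForm z (zeroForm I f)) (extChartAt I z).target ↔
      ContDiffOn ℝ ∞ (f ∘ (extChartAt I z).symm) (extChartAt I z).target := by
    intro z
    constructor
    · intro h
      exact (ContinuousAlternatingMap.constOfIsEmptyLIE ℝ E ℂ (Fin 0)).symm.contDiff.comp_contDiffOn h
    · intro h
      exact (ContinuousAlternatingMap.constOfIsEmptyLIE ℝ E ℂ (Fin 0)).contDiff.comp_contDiffOn h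
  unfold IsSmoothForm
  simp only [key]
  constructor
  · intro h x
    have h2 : ContMDiffOn 𝓘(ℝ, E) 𝓘(ℝ, ℂ) ∞ (f ∘ (extChartAt I x).symm) (extChartAt I x).target :=
      (h x).contMDiffOn
    have h3 := h2.comp (contMDiffOn_extChartAt (I := I) (x := x) (n := ∞))
      (fun y hy => (extChartAt I x).map_source (by simpa using hy))
    have h4 : ContMDiffAt I 𝓘(ℝ, ℂ) ∞ ((f ∘ (extChartAt I x).symm) ∘ extChartAt I x) x :=
      h3.contMDiffAt (chart_source_mem_nhds H x)
    refine h4.congr_of_eventuallyEq ?_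
    filter_upwards [chart_source_mem_nhds H x] with y hy
    simp [(chartAt H x).left_inv hy]
  · intro h z
    exact (h.comp_contMDiffOn (contMDiffOn_extChartAt_symm z)).contDiffOn

omit [FiniteDimensional ℝ E] in
-- The definition of `extDer` uses a different chart at each point. For functions the chain rule is
-- enough to pass to one fixed chart; naturality of the exterior derivative in higher degree is
-- avoided by evaluating derivatives of `1`-forms only at the centre of a chart.
theorem chartForm_extDer_zeroForm {f : M → ℂ} (hf : ContMDiff I 𝓘(ℝ, ℂ) ∞ f) {z : M} {y : E}
    (hy : y ∈ (extChartAt I z).target) :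
    chartForm z (extDer (zeroForm I f)) y =
      ContinuousAlternatingMap.ofSubsingleton ℝ E ℂ (0 : Fin 1)
        (fderiv ℝ (f ∘ (extChartAt I z).symm) y) := by
  set x := (extChartAt I z).symm y with hx
  have h1 : formVal (extDer (zeroForm I f)) x =
      ContinuousAlternatingMap.ofSubsingleton ℝ E ℂ (0 : Fin 1)
        (fderiv ℝ (f ∘ (extChartAt I x).symm) (extChartAt I x x)) := by
    rw [extDer_eq_self]
    exact extDeriv_constOfIsEmpty (f ∘ (extChartAt I x).symm) _
  have h2 : differential I f x =
      fderiv ℝ (f ∘ (extChartAt I x).symm) (extChartAt I x x) := by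
    unfold differential
    rw [(hf.mdifferentiableAt (by simp)).mfderiv, I.range_eq_univ, fderivWithin_univ]
    rfl
  have hsymm : MDifferentiableAt 𝓘(ℝ, E) I (extChartAt I z).symm y :=
    (mdifferentiableOn_extChartAt_symm (I := I) (x := z) y hy).mdifferentiableAt
      ((isOpen_chartTarget z).mem_nhds hy)
  have h3 : (fderiv ℝ (f ∘ (extChartAt I z).symm) y : E →L[ℝ] ℂ) =
      (differential I f x).comp (chartDeriv I z y) := by
    rw [← mfderiv_eq_fderiv]
    exact mfderiv_comp y (hf.mdifferentiableAt (by simp)) hsymm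
  rw [h3, chartForm_eq, h1, h2]
  ext v
  rfl

omit [FiniteDimensional ℝ E] in
theorem extDer_zeroForm_apply {f : M → ℂ} (hf : ContMDiff I 𝓘(ℝ, ℂ) ∞ f) (x : M) (v : E) :
    formVal (extDer (zeroForm I f)) x (fun _ => v) =
      differential I f x v := by
  unfold differential
  rw [extDer_eq_self, (hf.mdifferentiableAt (by simp)).mfderiv, I.range_eq_univ, fderivWithin_univ]
  exact congrArg (fun θ : E [⋀^Fin 1]→L[ℝ] ℂ => θ fun _ => v)
    (extDeriv_constOfIsEmpty (f ∘ (extChartAt I x).symm) _)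

omit [FiniteDimensional ℝ E] [I.Boundaryless] [IsManifold I ∞ M] in
theorem formSupport_zeroForm (f : M → ℂ) : formSupport (zeroForm I f) = tsupport f := by
  unfold formSupport tsupport
  congr 1
  ext x
  simp only [Set.mem_ofPred_eq, Function.mem_support, ne_eq, not_iff_not]
  constructor
  · intro h
    exact congrArg (fun θ : (TangentSpace I x) [⋀^Fin 0]→L[ℝ] ℂ => θ ![]) h
  · intro h
    ext v
    exact h

end Charts


/-! ### The Riemannian metric in charts, and product charts. -/

section Nondegenerate

variable {E : Type*} [NormedAddCommGroup E] [NormedSpace ℝ E]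
  {ι ι' : Type*} [Fintype ι] [Fintype ι'] [DecidableEq ι] [DecidableEq ι']

omit [DecidableEq ι] in
theorem posDef_gramOf {B : LinearMap.BilinForm ℝ E} (hs : ∀ v w, B v w = B w v)
    (hp : ∀ v, v ≠ 0 → 0 < B v v) (b : Module.Basis ι ℝ E) : (gramOf B b).PosDef := by
  refine Matrix.PosDef.of_dotProduct_mulVec_pos ?_ fun x hx => ?_
  · ext i j
    simp [gramOf, hs (b j) (b i)]
  · have h : star x ⬝ᵥ (gramOf B b).mulVec x = B (∑ i, x i • b i) (∑ i, x i • b i) := by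
      simp only [dotProduct, Matrix.mulVec, map_sum, LinearMap.sum_apply, map_smul,
        LinearMap.smul_apply, smul_eq_mul, gramOf, Matrix.of_apply, star_trivial, Finset.mul_sum]
      rw [Finset.sum_comm]
      refine Finset.sum_congr rfl fun i _ => Finset.sum_congr rfl fun j _ => ?_
      ring
    rw [h]
    apply hp
    intro h0
    apply hx
    funext i
    exact Fintype.linearIndependent_iff.1 b.linearIndependent x h0 i

end Nondegenerate

section Spatial

variable {n : ℕ} {S : Type*} [TopologicalSpace S] [ChartedSpace (EuclideanSpace ℝ (Fin n)) S]
  [IsManifold (𝓡 n) ∞ S] (h : SmoothMetric n S)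

theorem spatialMetric_symm (x : S) (v w : EuclideanSpace ℝ (Fin n)) :
    metricVal (spatialMetric h) x v w = metricVal (spatialMetric h) x w v := h.symm x v w

theorem spatialMetric_pos (x : S) (v : EuclideanSpace ℝ (Fin n)) (hv : v ≠ 0) :
    0 < metricVal (spatialMetric h) x v v := h.pos x v hv

theorem isUnit_det_spatial {ι : Type*} [Fintype ι] [DecidableEq ι] (x : S)
    (b : Module.Basis ι ℝ (EuclideanSpace ℝ (Fin n))) :
    IsUnit (gramOf (metricVal (spatialMetric h) x) b).det :=
  (posDef_gramOf (spatialMetric_symm h x) (spatialMetric_pos h x) b).det_pos.ne'.isUnit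

theorem metricVal_ultrastatic (p : ℝ × S) :
    metricVal (ultrastaticMetric h) p = lorentzForm (metricVal (spatialMetric h) p.2) := rfl

theorem chartBilin_symm (z : S) (y v w : EuclideanSpace ℝ (Fin n)) :
    chartBilin (spatialMetric h) z y v w = chartBilin (spatialMetric h) z y w v :=
  spatialMetric_symm h _ _ _

theorem chartBilin_pos {z : S} {y : EuclideanSpace ℝ (Fin n)}
    (hy : y ∈ (extChartAt (𝓡 n) z).target) {v : EuclideanSpace ℝ (Fin n)} (hv : v ≠ 0) :
    0 < chartBilin (spatialMetric h) z y v v := by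
  apply spatialMetric_pos
  intro h0
  exact hv ((chartDeriv_invertible hy).injective (by simpa using h0))

theorem posDef_chartGram {z : S} {y : EuclideanSpace ℝ (Fin n)}
    (hy : y ∈ (extChartAt (𝓡 n) z).target) : (chartGram (spatialMetric h) z y).PosDef := by
  rw [chartGram_eq]
  exact posDef_gramOf (chartBilin_symm h z y) (fun v hv => chartBilin_pos h hy hv) _

/-- The coordinate vector fields are continuous sections of the tangent bundle, being images of
constant fields under the tangent map of the inverse chart. Continuity of the coefficients is all
that is used later: the wave equation is kept in weak form, so the metric is never differentiated in
the energy estimate. -/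
theorem continuousOn_chartBilin (z : S) (v w : EuclideanSpace ℝ (Fin n)) :
    ContinuousOn (fun y => chartBilin (spatialMetric h) z y v w) (extChartAt (𝓡 n) z).target := by
  let : Bundle.RiemannianBundle (fun x : S => TangentSpace (𝓡 n) x) := ⟨h.toRiemannianMetric⟩
  have : IsContinuousRiemannianBundle (EuclideanSpace ℝ (Fin n))
      (fun x : S => TangentSpace (𝓡 n) x) := ⟨⟨h.inner, h.contMDiff.continuous, fun _ _ _ => rfl⟩⟩
  have hT : ∀ u : EuclideanSpace ℝ (Fin n), ContinuousOn (fun y => (⟨(extChartAt (𝓡 n) z).symm y,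
      mfderiv 𝓘(ℝ, EuclideanSpace ℝ (Fin n)) (𝓡 n) (extChartAt (𝓡 n) z).symm y u⟩ :
        TangentBundle (𝓡 n) S)) (extChartAt (𝓡 n) z).target := by
    intro u
    have h1 := (contMDiffOn_extChartAt_symm (I := 𝓡 n) (n := ∞) z).continuousOn_tangentMapWithin
      (by simp) (isOpen_chartTarget z).uniqueMDiffOn
    have h2 : Continuous (fun y : EuclideanSpace ℝ (Fin n) =>
        (⟨y, u⟩ : TangentBundle 𝓘(ℝ, EuclideanSpace ℝ (Fin n)) (EuclideanSpace ℝ (Fin n)))) :=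
      (contMDiff_vectorSpace_iff_contDiff (n := 0)
        (V := fun _ : EuclideanSpace ℝ (Fin n) => u)|>.2 contDiff_const).continuous
    refine (h1.comp h2.continuousOn fun y hy => hy).congr fun y hy => ?_
    simp only [Function.comp, tangentMapWithin]
    rw [mfderivWithin_of_isOpen (isOpen_chartTarget z) hy]
  exact ContinuousOn.inner_bundle (F := EuclideanSpace ℝ (Fin n))
    (E := fun x : S => TangentSpace (𝓡 n) x) (hT v) (hT w)

theorem continuousOn_chartGram (z : S) :
    ContinuousOn (chartGram (spatialMetric h) z) (extChartAt (𝓡 n) z).target := by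
  refine continuousOn_pi.2 fun i => continuousOn_pi.2 fun j => ?_
  exact continuousOn_chartBilin h z _ _

theorem continuousOn_chartGram_inv (z : S) :
    ContinuousOn (fun y => (chartGram (spatialMetric h) z y)⁻¹) (extChartAt (𝓡 n) z).target := by
  simp only [Matrix.inv_def, Ring.inverse_eq_inv']
  have hc := continuousOn_chartGram h z
  refine ContinuousOn.smul (ContinuousOn.inv₀ ?_ fun y hy => (posDef_chartGram h hy).det_pos.ne') ?_
  · exact (Continuous.matrix_det continuous_id).comp_continuousOn hc
  · exact (Continuous.matrix_adjugate continuous_id).comp_continuousOn hc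

end Spatial

section Product

variable {n : ℕ} {S : Type*} [TopologicalSpace S] [ChartedSpace (EuclideanSpace ℝ (Fin n)) S]

theorem prodChart_target (p : ℝ × S) :
    (extChartAt (𝓘(ℝ, ℝ).prod (𝓡 n)) p).target = Set.univ ×ˢ (extChartAt (𝓡 n) p.2).target := by
  rw [extChartAt_prod, extChartAt_model_space_eq_id]
  simp

theorem prodChart_symm_apply (p : ℝ × S) (q : ℝ × EuclideanSpace ℝ (Fin n)) :
    (extChartAt (𝓘(ℝ, ℝ).prod (𝓡 n)) p).symm q = (q.1, (extChartAt (𝓡 n) p.2).symm q.2) := by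
  rw [extChartAt_prod, extChartAt_model_space_eq_id]
  simp

theorem prodChart_apply (p q : ℝ × S) :
    extChartAt (𝓘(ℝ, ℝ).prod (𝓡 n)) p q = (q.1, extChartAt (𝓡 n) p.2 q.2) := by
  rw [extChartAt_prod, extChartAt_model_space_eq_id]
  simp

variable [IsManifold (𝓡 n) ∞ S]

theorem prodChart_chartDeriv (p : ℝ × S) {q : ℝ × EuclideanSpace ℝ (Fin n)}
    (hq : q.2 ∈ (extChartAt (𝓡 n) p.2).target) :
    chartDeriv (𝓘(ℝ, ℝ).prod (𝓡 n)) p q =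
      (ContinuousLinearMap.id ℝ ℝ).prodMap (chartDeriv (𝓡 n) p.2 q.2) := by
  have h1 : ((extChartAt (𝓘(ℝ, ℝ).prod (𝓡 n)) p).symm : ℝ × EuclideanSpace ℝ (Fin n) → ℝ × S) =
      fun q => (q.1, (extChartAt (𝓡 n) p.2).symm q.2) := by
    funext q
    rw [prodChart_symm_apply]
  have hsymm : MDifferentiableAt 𝓘(ℝ, EuclideanSpace ℝ (Fin n)) (𝓡 n) (extChartAt (𝓡 n) p.2).symm q.2 :=
    (mdifferentiableOn_extChartAt_symm (I := 𝓡 n) (x := p.2) q.2 hq).mdifferentiableAt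
      ((isOpen_chartTarget p.2).mem_nhds hq)
  have hfst : HasMFDerivAt 𝓘(ℝ, ℝ × EuclideanSpace ℝ (Fin n)) 𝓘(ℝ, ℝ) Prod.fst q
      (ContinuousLinearMap.fst ℝ ℝ (EuclideanSpace ℝ (Fin n))) := hasFDerivAt_fst.hasMFDerivAt
  have hsnd : HasMFDerivAt 𝓘(ℝ, ℝ × EuclideanSpace ℝ (Fin n)) 𝓘(ℝ, EuclideanSpace ℝ (Fin n))
      Prod.snd q (ContinuousLinearMap.snd ℝ ℝ (EuclideanSpace ℝ (Fin n))) :=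
    hasFDerivAt_snd.hasMFDerivAt
  have h2 := hfst.prodMk (hsymm.hasMFDerivAt.comp q hsnd)
  unfold chartDeriv
  rw [h1]
  exact h2.mfderiv

end Product


/-- The Euclidean model space. -/
abbrev Euc (n : ℕ) : Type := EuclideanSpace ℝ (Fin n)

/-! ### Forms on the slice depending smoothly on time. -/

section TimeDependent

variable {n : ℕ} {S : Type*} [TopologicalSpace S] [ChartedSpace (EuclideanSpace ℝ (Fin n)) S]
  {k : ℕ}

/-- A family of forms on `S` which depends smoothly on time. -/
def SmoothInTime (B : ℝ → DiffForm (𝓡 n) S k) : Prop :=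
  ∀ z : S, ContDiffOn ℝ ∞ (fun q : ℝ × Euc n => chartForm z (B q.1) q.2)
    (Set.univ ×ˢ (extChartAt (𝓡 n) z).target)

/-- The time derivative of a family of forms. -/
noncomputable def timeDeriv (B : ℝ → DiffForm (𝓡 n) S k) (t : ℝ) : DiffForm (𝓡 n) S k :=
  fun x => (deriv (fun s => formVal (B s) x) t : (Euc n) [⋀^Fin k]→L[ℝ] ℂ)

theorem isOpen_prodTarget (z : S) :
    IsOpen ((Set.univ : Set ℝ) ×ˢ (extChartAt (𝓡 n) z).target) :=
  isOpen_univ.prod (isOpen_chartTarget z)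

theorem SmoothInTime.differentiableAt {B : ℝ → DiffForm (𝓡 n) S k} (hB : SmoothInTime B) {z : S}
    {q : ℝ × Euc n} (hq : q.2 ∈ (extChartAt (𝓡 n) z).target) :
    DifferentiableAt ℝ (fun q : ℝ × Euc n => chartForm z (B q.1) q.2) q :=
  ((hB z).contDiffAt ((isOpen_prodTarget z).mem_nhds ⟨trivial, hq⟩)).differentiableAt (by simp)

theorem hasDerivAt_slice {E G : Type*} [NormedAddCommGroup E] [NormedSpace ℝ E]
    [NormedAddCommGroup G] [NormedSpace ℝ G] {F : ℝ × E → G} {t : ℝ} {y : E}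
    (hF : DifferentiableAt ℝ F (t, y)) :
    HasDerivAt (fun s => F (s, y)) (fderiv ℝ F (t, y) (1, 0)) t :=
  hF.hasFDerivAt.comp_hasDerivAt t ((hasDerivAt_id t).prodMk (hasDerivAt_const t y))

theorem hasFDerivAt_slice {E G : Type*} [NormedAddCommGroup E] [NormedSpace ℝ E]
    [NormedAddCommGroup G] [NormedSpace ℝ G] {F : ℝ × E → G} {t : ℝ} {y : E}
    (hF : DifferentiableAt ℝ F (t, y)) :
    HasFDerivAt (fun y' => F (t, y'))
      ((fderiv ℝ F (t, y)).comp (ContinuousLinearMap.inr ℝ ℝ E)) y :=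
  hF.hasFDerivAt.comp y (hasFDerivAt_prodMk_right t y)

variable [IsManifold (𝓡 n) ∞ S]

theorem SmoothInTime.hasDerivAt {B : ℝ → DiffForm (𝓡 n) S k} (hB : SmoothInTime B) (t : ℝ)
    (x : S) : HasDerivAt (fun s => formVal (B s) x) (formVal (timeDeriv B t) x) t := by
  have h1 := hasDerivAt_slice (hB.differentiableAt (z := x) (q := (t, extChartAt (𝓡 n) x x))
    (mem_extChartAt_target x))
  simp only [chartForm_self] at h1
  exact h1.differentiableAt.hasDerivAt

/-- Pulling a form back to a chart is linear and independent of time, hence commutes with the time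
derivative, which is defined pointwise on the manifold. -/
theorem SmoothInTime.chartForm_timeDeriv {B : ℝ → DiffForm (𝓡 n) S k} (hB : SmoothInTime B) {z : S}
    {q : ℝ × Euc n} (hq : q.2 ∈ (extChartAt (𝓡 n) z).target) :
    chartForm z (timeDeriv B q.1) q.2 =
      fderiv ℝ (fun q : ℝ × Euc n => chartForm z (B q.1) q.2) q (1, 0) := by
  have h1 := hasDerivAt_slice (hB.differentiableAt (z := z) (q := (q.1, q.2)) hq)
  have h2 := (ContinuousAlternatingMap.compContinuousLinearMapCLM (ι := Fin k) (F := ℂ)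
    (chartDeriv (𝓡 n) z q.2)).hasFDerivAt.comp_hasDerivAt q.1
      (hB.hasDerivAt q.1 ((extChartAt (𝓡 n) z).symm q.2))
  exact h2.unique h1

theorem SmoothInTime.timeDeriv {B : ℝ → DiffForm (𝓡 n) S k} (hB : SmoothInTime B) :
    SmoothInTime (timeDeriv B) := by
  intro z
  have h1 : ContDiffOn ℝ ∞ (fun q => fderiv ℝ (fun q : ℝ × Euc n => chartForm z (B q.1) q.2) q (1, 0))
      (Set.univ ×ˢ (extChartAt (𝓡 n) z).target) :=
    ((hB z).fderiv_of_isOpen (isOpen_prodTarget z) (by simp)).clm_apply contDiffOn_const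
  exact h1.congr fun q hq => hB.chartForm_timeDeriv hq.2

omit [IsManifold (𝓡 n) ∞ S] in
theorem SmoothInTime.isSmoothForm {B : ℝ → DiffForm (𝓡 n) S k} (hB : SmoothInTime B) (t : ℝ) :
    IsSmoothForm (B t) := by
  intro z
  exact (hB z).comp (f := fun y : Euc n => (t, y)) (contDiff_prodMk_right t).contDiffOn
    fun y hy => ⟨trivial, hy⟩

omit [IsManifold (𝓡 n) ∞ S] in
theorem smoothInTime_const {θ : DiffForm (𝓡 n) S k} (hθ : IsSmoothForm θ) :
    SmoothInTime fun _ => θ := by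
  intro z
  exact (hθ z).comp (f := Prod.snd) contDiff_snd.contDiffOn fun q hq => hq.2

theorem SmoothInTime.contMDiff {u : ℝ → S → ℂ}
    (hu : SmoothInTime fun t => zeroForm (𝓡 n) (u t)) (t : ℝ) : ContMDiff (𝓡 n) 𝓘(ℝ, ℂ) ∞ (u t) :=
  isSmoothForm_zeroForm_iff.1 (hu.isSmoothForm t)

omit [IsManifold (𝓡 n) ∞ S] in
theorem smoothInTime_zeroForm_iff {u : ℝ → S → ℂ} :
    (SmoothInTime fun t => zeroForm (𝓡 n) (u t)) ↔ ∀ z : S,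
      ContDiffOn ℝ ∞ (fun q : ℝ × Euc n => u q.1 ((extChartAt (𝓡 n) z).symm q.2))
        (Set.univ ×ˢ (extChartAt (𝓡 n) z).target) := by
  refine forall_congr' fun z => ⟨fun h => ?_, fun h => ?_⟩
  · exact (ContinuousAlternatingMap.constOfIsEmptyLIE ℝ (Euc n) ℂ (Fin 0)).symm.contDiff.comp_contDiffOn h
  · exact (ContinuousAlternatingMap.constOfIsEmptyLIE ℝ (Euc n) ℂ (Fin 0)).contDiff.comp_contDiffOn h

theorem SmoothInTime.extDer {u : ℝ → S → ℂ}
    (hu : SmoothInTime fun t => zeroForm (𝓡 n) (u t)) :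
    SmoothInTime fun t => extDer (zeroForm (𝓡 n) (u t)) := by
  intro z
  have h0 := smoothInTime_zeroForm_iff.1 hu z
  have h1 : ContDiffOn ℝ ∞ (fun q => (fderiv ℝ (fun q : ℝ × Euc n =>
      u q.1 ((extChartAt (𝓡 n) z).symm q.2)) q).comp (ContinuousLinearMap.inr ℝ ℝ (Euc n)))
      (Set.univ ×ˢ (extChartAt (𝓡 n) z).target) :=
    (h0.fderiv_of_isOpen (isOpen_prodTarget z) (by simp)).clm_comp contDiffOn_const
  refine ((ContinuousAlternatingMap.ofSubsingletonLIE (𝕜 := ℝ) (E := Euc n) (F := ℂ) (0 : Fin 1)).contDiff.comp_contDiffOn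
    h1).congr fun q hq => ?_
  rw [chartForm_extDer_zeroForm (hu.contMDiff q.1) hq.2]
  have h2 := hasFDerivAt_slice (t := q.1) (y := q.2)
    ((h0.contDiffAt ((isOpen_prodTarget z).mem_nhds hq)).differentiableAt (by simp))
  rw [show u q.1 ∘ (extChartAt (𝓡 n) z).symm =
    fun y => u q.1 ((extChartAt (𝓡 n) z).symm y) from rfl, h2.fderiv]
  rfl

/-! ### Pointwise products -/

variable (h : SmoothMetric n S)

/-- The basis in the definition of `formInner` is at each point the coordinate frame of the
preferred chart there, which may jump from point to point. Continuity becomes visible only after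
rewriting the contraction in one fixed chart. -/
theorem continuous_formInner {B C : ℝ → DiffForm (𝓡 n) S k} (hB : SmoothInTime B)
    (hC : SmoothInTime C) :
    Continuous fun p : ℝ × S => formInner (spatialMetric h) (B p.1) (C p.1) p.2 := by
  have hloc : ∀ z : S, ContinuousOn (fun q : ℝ × Euc n => tensorInner
      (chartBilin (spatialMetric h) z q.2) (Module.finBasis ℝ (Euc n)) (chartForm z (B q.1) q.2)
      (chartForm z (C q.1) q.2)) (Set.univ ×ˢ (extChartAt (𝓡 n) z).target) := by
    intro z
    unfold tensorInner
    simp only [← chartGram_eq]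
    have hG : ContinuousOn (fun q : ℝ × Euc n => (chartGram (spatialMetric h) z q.2)⁻¹)
        (Set.univ ×ˢ (extChartAt (𝓡 n) z).target) :=
      (continuousOn_chartGram_inv h z).comp continuous_snd.continuousOn fun q hq => hq.2
    have happ : ∀ {D : ℝ → DiffForm (𝓡 n) S k}, SmoothInTime D → ∀ v : Fin k → Euc n,
        ContinuousOn (fun q : ℝ × Euc n => chartForm z (D q.1) q.2 v)
          (Set.univ ×ˢ (extChartAt (𝓡 n) z).target) := fun hD v =>
      (ContinuousAlternatingMap.apply ℝ (Euc n) ℂ v).continuous.comp_continuousOn (hD z).continuousOn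
    refine continuousOn_const.mul (continuousOn_finsetSum _ fun i _ =>
      continuousOn_finsetSum _ fun j _ => ContinuousOn.mul ?_ (ContinuousOn.mul ?_ (happ hC _)))
    · refine Complex.continuous_ofReal.comp_continuousOn (continuousOn_finsetProd _ fun m _ => ?_)
      exact continuousOn_pi.1 (continuousOn_pi.1 hG (i m)) (j m)
    · exact Complex.continuous_conj.comp_continuousOn (happ hB _)
  rw [continuous_iff_continuousAt]
  rintro ⟨t, z⟩
  have hz : (extChartAt (𝓡 n) z).source ∈ 𝓝 z := extChartAt_source_mem_nhds z
  have h1 : ContinuousAt (fun p : ℝ × S => (p.1, extChartAt (𝓡 n) z p.2)) (t, z) :=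
    continuousAt_fst.prodMk (ContinuousAt.comp (g := extChartAt (𝓡 n) z) (f := Prod.snd)
      (continuousAt_extChartAt z) continuousAt_snd)
  have h2 : ContinuousAt (fun q : ℝ × Euc n => tensorInner
      (chartBilin (spatialMetric h) z q.2) (Module.finBasis ℝ (Euc n)) (chartForm z (B q.1) q.2)
      (chartForm z (C q.1) q.2)) ((fun p : ℝ × S => (p.1, extChartAt (𝓡 n) z p.2)) (t, z)) :=
    (hloc z).continuousAt ((isOpen_prodTarget z).mem_nhds ⟨trivial, mem_extChartAt_target z⟩)
  refine (ContinuousAt.comp (f := fun p : ℝ × S => (p.1, extChartAt (𝓡 n) z p.2)) h2 h1).congr ?_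
  filter_upwards [prod_mem_nhds Filter.univ_mem hz] with p hp
  have h3 := formInner_symm_chart (spatialMetric h) (fun x => isUnit_det_spatial h x _) (B p.1) (C p.1)
    ((extChartAt (𝓡 n) z).map_source hp.2)
  rw [(extChartAt (𝓡 n) z).left_inv hp.2] at h3
  exact h3.symm

theorem hasDerivAt_formInner {C : ℝ → DiffForm (𝓡 n) S k} (hC : SmoothInTime C)
    (α : DiffForm (𝓡 n) S k) (t : ℝ) (x : S) :
    HasDerivAt (fun s => formInner (spatialMetric h) α (C s) x)
      (formInner (spatialMetric h) α (timeDeriv C t) x) t := by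
  simp only [formInner_eq, tensorInner]
  refine HasDerivAt.const_mul _ (HasDerivAt.fun_sum fun i _ => HasDerivAt.fun_sum fun j _ =>
    HasDerivAt.const_mul _ (HasDerivAt.const_mul _ ?_))
  exact (ContinuousAlternatingMap.apply ℝ (Euc n) ℂ _).hasFDerivAt.comp_hasDerivAt t (hC.hasDerivAt t x)

end TimeDependent

/-! ### Time and space components of forms on the spacetime. -/

section Spacetime

variable {n : ℕ} {S : Type*} [TopologicalSpace S] [ChartedSpace (EuclideanSpace ℝ (Fin n)) S]
  [IsManifold (𝓡 n) ∞ S]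

theorem chartForm_prod {k : ℕ} (A : DiffForm (𝓘(ℝ, ℝ).prod (𝓡 n)) (ℝ × S) k) (p : ℝ × S)
    {q : ℝ × Euc n} (hq : q.2 ∈ (extChartAt (𝓡 n) p.2).target) :
    chartForm p A q = (formVal A (q.1, (extChartAt (𝓡 n) p.2).symm q.2)).compContinuousLinearMap
      ((ContinuousLinearMap.id ℝ ℝ).prodMap (chartDeriv (𝓡 n) p.2 q.2)) := by
  rw [chartForm_eq, prodChart_symm_apply, prodChart_chartDeriv p hq]

theorem chartForm_spatialPart (A : DiffForm (𝓘(ℝ, ℝ).prod (𝓡 n)) (ℝ × S) 1) (p : ℝ × S)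
    {q : ℝ × Euc n} (hq : q.2 ∈ (extChartAt (𝓡 n) p.2).target) :
    chartForm p.2 (spatialPart A q.1) q.2 =
      (chartForm p A q).compContinuousLinearMap (ContinuousLinearMap.inr ℝ ℝ (Euc n)) := by
  rw [chartForm_prod A p hq]
  ext v
  rw [chartForm_eq]
  simp only [ContinuousAlternatingMap.compContinuousLinearMap_apply]
  change formVal A _ _ = formVal A _ _
  congr 1

theorem timeComponent_chart (A : DiffForm (𝓘(ℝ, ℝ).prod (𝓡 n)) (ℝ × S) 1) (p : ℝ × S)
    {q : ℝ × Euc n} (hq : q.2 ∈ (extChartAt (𝓡 n) p.2).target) :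
    timeComponent A (q.1, (extChartAt (𝓡 n) p.2).symm q.2) = chartForm p A q fun _ => (1, 0) := by
  rw [chartForm_prod A p hq]
  simp only [ContinuousAlternatingMap.compContinuousLinearMap_apply]
  change formVal A _ _ = formVal A _ _
  congr 1
  funext i
  simp [partialT]
  rfl

omit [IsManifold (𝓡 n) ∞ S] in
theorem smoothOn_chartForm {k : ℕ} {A : DiffForm (𝓘(ℝ, ℝ).prod (𝓡 n)) (ℝ × S) k}
    (hA : IsSmoothForm A) (p : ℝ × S) :
    ContDiffOn ℝ ∞ (chartForm p A) (Set.univ ×ˢ (extChartAt (𝓡 n) p.2).target) := by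
  rw [← prodChart_target p]
  exact hA p

theorem smoothInTime_spatialPart {A : DiffForm (𝓘(ℝ, ℝ).prod (𝓡 n)) (ℝ × S) 1}
    (hA : IsSmoothForm A) : SmoothInTime (spatialPart A) := by
  intro z
  exact ((ContinuousAlternatingMap.compContinuousLinearMapCLM (ι := Fin 1) (F := ℂ)
    (ContinuousLinearMap.inr ℝ ℝ (Euc n))).contDiff.comp_contDiffOn
    (smoothOn_chartForm hA (0, z))).congr fun q hq => chartForm_spatialPart A (0, z) hq.2

theorem smoothInTime_timeComponent {A : DiffForm (𝓘(ℝ, ℝ).prod (𝓡 n)) (ℝ × S) 1}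
    (hA : IsSmoothForm A) :
    SmoothInTime fun t => zeroForm (𝓡 n) fun x => timeComponent A (t, x) := by
  rw [smoothInTime_zeroForm_iff]
  intro z
  exact ((ContinuousAlternatingMap.apply ℝ (ℝ × Euc n) ℂ
    fun _ : Fin 1 => ((1 : ℝ), (0 : Euc n))).contDiff.comp_contDiffOn
    (smoothOn_chartForm hA (0, z))).congr fun q hq => timeComponent_chart A (0, z) hq.2

omit [IsManifold (𝓡 n) ∞ S] in
theorem differentiableAt_chartForm {k : ℕ} {A : DiffForm (𝓘(ℝ, ℝ).prod (𝓡 n)) (ℝ × S) k}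
    (hA : IsSmoothForm A) (p : ℝ × S) :
    DifferentiableAt ℝ (chartForm p A) (p.1, extChartAt (𝓡 n) p.2 p.2) :=
  ((smoothOn_chartForm hA p).contDiffAt ((isOpen_prodTarget p.2).mem_nhds
    ⟨trivial, mem_extChartAt_target p.2⟩)).differentiableAt (by simp)

theorem extDer_function_apply {a : ℝ × S → ℂ}
    (ha : ContMDiff (𝓘(ℝ, ℝ).prod (𝓡 n)) 𝓘(ℝ, ℂ) ∞ a) (p : ℝ × S) (v : ℝ × Euc n) :
    DifferentiableAt ℝ (fun q : ℝ × Euc n => a (q.1, (extChartAt (𝓡 n) p.2).symm q.2))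
      (p.1, extChartAt (𝓡 n) p.2 p.2) ∧
    formVal (extDer (zeroForm (𝓘(ℝ, ℝ).prod (𝓡 n)) a)) p (fun _ => v) =
      fderiv ℝ (fun q : ℝ × Euc n => a (q.1, (extChartAt (𝓡 n) p.2).symm q.2))
        (p.1, extChartAt (𝓡 n) p.2 p.2) v := by
  have hfun : a ∘ (extChartAt (𝓘(ℝ, ℝ).prod (𝓡 n)) p).symm =
      fun q : ℝ × Euc n => a (q.1, (extChartAt (𝓡 n) p.2).symm q.2) := by
    funext q
    rw [Function.comp, prodChart_symm_apply]
  constructor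
  · have h1 := differentiableAt_chartForm (isSmoothForm_zeroForm_iff.2 ha) p
    have h2 := (ContinuousAlternatingMap.constOfIsEmptyLIE ℝ (ℝ × Euc n) ℂ
      (Fin 0)).symm.differentiable.differentiableAt.comp _ h1
    rw [← hfun]
    exact h2
  · rw [extDer_eq_self, ← hfun, prodChart_apply]
    exact congrArg (fun θ : (ℝ × Euc n) [⋀^Fin 1]→L[ℝ] ℂ => θ fun _ => v)
      (extDeriv_constOfIsEmpty (a ∘ (extChartAt (𝓘(ℝ, ℝ).prod (𝓡 n)) p).symm) _)

theorem extDer_function_time {a : ℝ × S → ℂ}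
    (ha : ContMDiff (𝓘(ℝ, ℝ).prod (𝓡 n)) 𝓘(ℝ, ℂ) ∞ a) (p : ℝ × S) :
    formVal (extDer (zeroForm (𝓘(ℝ, ℝ).prod (𝓡 n)) a)) p (fun _ => (1, 0)) =
      deriv (fun s => a (s, p.2)) p.1 := by
  obtain ⟨h1, h2⟩ := extDer_function_apply ha p (1, 0)
  rw [h2, ← (hasDerivAt_slice h1).deriv]
  simp only [(extChartAt (𝓡 n) p.2).left_inv (mem_extChartAt_source p.2)]

omit [IsManifold (𝓡 n) ∞ S] in
theorem contMDiff_slice {a : ℝ × S → ℂ} (ha : ContMDiff (𝓘(ℝ, ℝ).prod (𝓡 n)) 𝓘(ℝ, ℂ) ∞ a) (t : ℝ) :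
    ContMDiff (𝓡 n) 𝓘(ℝ, ℂ) ∞ fun x => a (t, x) :=
  ha.comp (contMDiff_const.prodMk contMDiff_id)

theorem extDer_function_space {a : ℝ × S → ℂ}
    (ha : ContMDiff (𝓘(ℝ, ℝ).prod (𝓡 n)) 𝓘(ℝ, ℂ) ∞ a) (p : ℝ × S) :
    (formVal (extDer (zeroForm (𝓘(ℝ, ℝ).prod (𝓡 n)) a)) p).compContinuousLinearMap
      (ContinuousLinearMap.inr ℝ ℝ (Euc n)) =
      formVal (extDer (zeroForm (𝓡 n) fun x => a (p.1, x))) p.2 := by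
  ext v
  obtain ⟨w, rfl⟩ : ∃ w, v = fun _ => w := ⟨v 0, by funext i; rw [Fin.fin_one_eq_zero i]⟩
  obtain ⟨h1, h2⟩ := extDer_function_apply ha p (0, w)
  have h3 : formVal (extDer (zeroForm (𝓡 n) fun x => a (p.1, x))) p.2 (fun _ => w) =
      fderiv ℝ ((fun x => a (p.1, x)) ∘ (extChartAt (𝓡 n) p.2).symm) (extChartAt (𝓡 n) p.2 p.2) w := by
    rw [extDer_eq_self]
    exact congrArg (fun θ : (Euc n) [⋀^Fin 1]→L[ℝ] ℂ => θ fun _ => w)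
      (extDeriv_constOfIsEmpty ((fun x => a (p.1, x)) ∘ (extChartAt (𝓡 n) p.2).symm) _)
  have h4 := (hasFDerivAt_slice h1).fderiv
  rw [h3, show (fun x => a (p.1, x)) ∘ (extChartAt (𝓡 n) p.2).symm =
    fun y => a (p.1, (extChartAt (𝓡 n) p.2).symm y) from rfl, h4]
  exact h2

/-- The electric components of `dA`. -/
theorem extDer_time_space {A : DiffForm (𝓘(ℝ, ℝ).prod (𝓡 n)) (ℝ × S) 1} (hA : IsSmoothForm A)
    (p : ℝ × S) (v : Euc n) :
    formVal (extDer A) p ![(1, 0), (0, v)] =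
      formVal (timeDeriv (spatialPart A) p.1) p.2 (fun _ => v) -
        formVal (extDer (zeroForm (𝓡 n) fun x => timeComponent A (p.1, x))) p.2 (fun _ => v) := by
  have hd := differentiableAt_chartForm hA p
  have hu := smoothInTime_timeComponent hA
  rw [extDer_eq_self, prodChart_apply, extDeriv_apply hd, Fin.sum_univ_two]
  have h1 : (Fin.removeNth 0 ![((1 : ℝ), (0 : Euc n)), (0, v)]) = fun _ => (0, v) := by
    ext i <;> simp [Fin.removeNth]
  have h2 : (Fin.removeNth 1 ![((1 : ℝ), (0 : Euc n)), (0, v)]) = fun _ => (1, 0) := by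
    ext i <;> simp [Fin.removeNth, Subsingleton.elim i 0]
  have happ : ∀ w : ℝ × Euc n, DifferentiableAt ℝ (fun q => chartForm p A q fun _ => w)
      (p.1, extChartAt (𝓡 n) p.2 p.2) := fun w =>
    (ContinuousAlternatingMap.apply ℝ (ℝ × Euc n) ℂ
      fun _ : Fin 1 => w).differentiableAt.comp _ hd
  have e1 := hasDerivAt_slice (happ (0, v))
  have e2 := (hasFDerivAt_slice (happ (1, 0)))
  have e3 : (fun s => chartForm p A (s, extChartAt (𝓡 n) p.2 p.2) fun _ => ((0 : ℝ), v)) =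
      fun s => formVal (spatialPart A s) p.2 fun _ => v := by
    funext s
    rw [← chartForm_self, chartForm_spatialPart A p (q := (s, extChartAt (𝓡 n) p.2 p.2))
      (mem_extChartAt_target p.2)]
    rfl
  rw [e3] at e1
  have e4 := (ContinuousAlternatingMap.apply ℝ (Euc n) ℂ fun _ => v).hasFDerivAt.comp_hasDerivAt p.1
    ((smoothInTime_spatialPart hA).hasDerivAt p.1 p.2)
  have e5 := e4.unique e1
  have e6 : (fun y => chartForm p A (p.1, y) fun _ => ((1 : ℝ), (0 : Euc n)))
      =ᶠ[𝓝 (extChartAt (𝓡 n) p.2 p.2)]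
      (fun x => timeComponent A (p.1, x)) ∘ (extChartAt (𝓡 n) p.2).symm := by
    filter_upwards [(isOpen_chartTarget (I := 𝓡 n) p.2).mem_nhds (mem_extChartAt_target p.2)] with y hy
    exact (timeComponent_chart A p (q := (p.1, y)) hy).symm
  have e7 := e6.fderiv_eq (𝕜 := ℝ)
  rw [e2.fderiv] at e7
  have e8 : formVal (extDer (zeroForm (𝓡 n) fun x => timeComponent A (p.1, x))) p.2 (fun _ => v) =
      fderiv ℝ ((fun x => timeComponent A (p.1, x)) ∘ (extChartAt (𝓡 n) p.2).symm)
        (extChartAt (𝓡 n) p.2 p.2) v := by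
    rw [extDer_eq_self]
    exact congrArg (fun θ : (Euc n) [⋀^Fin 1]→L[ℝ] ℂ => θ fun _ => v)
      (extDeriv_constOfIsEmpty ((fun x => timeComponent A (p.1, x)) ∘ (extChartAt (𝓡 n) p.2).symm) _)
  rw [e8, ← e7]
  simp only [h1, h2]
  simp only [Fin.val_zero, pow_zero, one_smul, Fin.val_one, pow_one, neg_smul, Matrix.cons_val_zero,
    Matrix.cons_val_one]
  rw [sub_eq_add_neg]
  congr 1
  exact e5.symm

theorem extDer_space_space {A : DiffForm (𝓘(ℝ, ℝ).prod (𝓡 n)) (ℝ × S) 1} (hA : IsSmoothForm A)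
    (h0 : ∀ t x, formVal (spatialPart A t) x = 0) (p : ℝ × S) (v w : Euc n) :
    formVal (extDer A) p ![(0, v), (0, w)] = 0 := by
  have hd := differentiableAt_chartForm hA p
  rw [extDer_eq_self, prodChart_apply, extDeriv_apply hd, Fin.sum_univ_two]
  have h1 : (Fin.removeNth 0 ![((0 : ℝ), v), (0, w)]) = fun _ => (0, w) := by
    ext i <;> simp [Fin.removeNth]
  have h2 : (Fin.removeNth 1 ![((0 : ℝ), v), (0, w)]) = fun _ => (0, v) := by
    ext i <;> simp [Fin.removeNth, Subsingleton.elim i 0]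
  have h3 : ∀ v : Euc n, fderiv ℝ (fun q => chartForm p A q fun _ => ((0 : ℝ), v))
      (p.1, extChartAt (𝓡 n) p.2 p.2) = 0 := by
    intro v
    have : (fun q => chartForm p A q fun _ => ((0 : ℝ), v)) =ᶠ[𝓝 (p.1, extChartAt (𝓡 n) p.2 p.2)]
        fun _ => 0 := by
      have hmem : (p.1, extChartAt (𝓡 n) p.2 p.2) ∈
          (Set.univ : Set ℝ) ×ˢ (extChartAt (𝓡 n) p.2).target := ⟨trivial, mem_extChartAt_target p.2⟩
      filter_upwards [(isOpen_prodTarget p.2).mem_nhds hmem] with q hq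
      have e := chartForm_spatialPart A p hq.2
      rw [chartForm_eq, h0] at e
      exact (congrArg (fun θ : (Euc n) [⋀^Fin 1]→L[ℝ] ℂ => θ fun _ => v) e).symm
    rw [this.fderiv_eq]
    simp
  simp only [h1, h2, h3]
  simp

/-- The `1`-form `w dt`. -/
noncomputable def timeForm (n : ℕ) {S : Type*} [TopologicalSpace S]
    [ChartedSpace (EuclideanSpace ℝ (Fin n)) S] (w : ℝ × S → ℂ) :
    DiffForm (𝓘(ℝ, ℝ).prod (𝓡 n)) (ℝ × S) 1 := fun p =>
  (ContinuousAlternatingMap.ofSubsingleton ℝ (ℝ × Euc n) ℂ (0 : Fin 1)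
    ((ContinuousLinearMap.fst ℝ ℝ (Euc n)).smulRight (w p)) : (ℝ × Euc n) [⋀^Fin 1]→L[ℝ] ℂ)

omit [IsManifold (𝓡 n) ∞ S] in
theorem timeForm_apply (w : ℝ × S → ℂ) (p : ℝ × S) (v : Fin 1 → ℝ × Euc n) :
    formVal (timeForm n w) p v = (v 0).1 • w p := rfl

omit [IsManifold (𝓡 n) ∞ S] in
theorem timeComponent_timeForm (w : ℝ × S → ℂ) (p : ℝ × S) :
    timeComponent (timeForm n w) p = w p := by
  change formVal (timeForm n w) p (fun _ => ((1 : ℝ), (0 : Euc n))) = _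
  rw [timeForm_apply]
  simp

omit [IsManifold (𝓡 n) ∞ S] in
theorem spatialPart_timeForm (w : ℝ × S → ℂ) (t : ℝ) (x : S) :
    formVal (spatialPart (timeForm n w) t) x = 0 := by
  ext v
  change formVal (timeForm n w) (t, x) (fun i => ((0 : ℝ), v i)) = _
  rw [timeForm_apply]
  simp

theorem isSmoothForm_timeForm {w : ℝ × S → ℂ}
    (hw : ContMDiff (𝓘(ℝ, ℝ).prod (𝓡 n)) 𝓘(ℝ, ℂ) ∞ w) : IsSmoothForm (timeForm n w) := by
  intro p
  have h0 : ContDiffOn ℝ ∞ (w ∘ (extChartAt (𝓘(ℝ, ℝ).prod (𝓡 n)) p).symm)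
      (extChartAt (𝓘(ℝ, ℝ).prod (𝓡 n)) p).target :=
    (hw.comp_contMDiffOn (contMDiffOn_extChartAt_symm p)).contDiffOn
  refine (((ContinuousAlternatingMap.ofSubsingletonLIE (𝕜 := ℝ) (E := ℝ × Euc n) (F := ℂ) (0 : Fin 1)).contDiff.comp
    (ContinuousLinearMap.smulRightL ℝ (ℝ × Euc n) ℂ
      (ContinuousLinearMap.fst ℝ ℝ (Euc n))).contDiff).comp_contDiffOn h0).congr fun q hq => ?_
  rw [prodChart_target] at hq
  rw [chartForm_prod _ p hq.2]
  ext v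
  simp only [ContinuousAlternatingMap.compContinuousLinearMap_apply, timeForm_apply, Function.comp,
    prodChart_symm_apply]
  rfl

/-! ### The Hodge products on the spacetime -/

variable (h : SmoothMetric n S)

theorem formInner_ultrastatic_one {A : DiffForm (𝓘(ℝ, ℝ).prod (𝓡 n)) (ℝ × S) 1}
    {a : ℝ × S → ℂ} (ha : ContMDiff (𝓘(ℝ, ℝ).prod (𝓡 n)) 𝓘(ℝ, ℂ) ∞ a) (p : ℝ × S) :
    formInner (ultrastaticMetric h) (extDer (zeroForm _ a)) A p =
      -(starRingEnd ℂ (deriv (fun s => a (s, p.2)) p.1) * timeComponent A p) +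
      formInner (spatialMetric h) (extDer (zeroForm (𝓡 n) fun x => a (p.1, x)))
        (spatialPart A p.1) p.2 := by
  rw [formInner_eq, metricVal_ultrastatic, tensorInner_eq_of_basis _
    (prodBasis (Module.finBasis ℝ (Euc n))) _ ?_, tensorInner_lorentz_one_form _ _
    (isUnit_det_spatial h p.2 _), extDer_function_time ha, extDer_function_space ha, formInner_eq]
  · rfl
  · rw [det_gramOf_lorentzForm]
    exact (isUnit_det_spatial h p.2 _).neg

theorem tensorInner_one_sub {E ι : Type*} [NormedAddCommGroup E] [NormedSpace ℝ E] [Fintype ι]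
    [DecidableEq ι] {k : ℕ} (B : LinearMap.BilinForm ℝ E) (b : ι → E)
    (α β γ : E [⋀^Fin k]→L[ℝ] ℂ) :
    tensorInner B b α (β - γ) = tensorInner B b α β - tensorInner B b α γ := by
  simp only [tensorInner, ContinuousAlternatingMap.sub_apply, mul_sub, Finset.sum_sub_distrib]

/-- The form d(w dt) has only the mixed components -d_Σ w, so the pairing with dA sees the electric
field ∂_t A_Σ - d_Σ A₀ alone. The sign of these components cancels the sign of the time direction in
the metric. -/
theorem formInner_ultrastatic_two {A : DiffForm (𝓘(ℝ, ℝ).prod (𝓡 n)) (ℝ × S) 1}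
    (hA : IsSmoothForm A) {w : ℝ × S → ℂ}
    (hw : ContMDiff (𝓘(ℝ, ℝ).prod (𝓡 n)) 𝓘(ℝ, ℂ) ∞ w) (p : ℝ × S) :
    formInner (ultrastaticMetric h) (extDer (timeForm n w)) (extDer A) p =
      formInner (spatialMetric h) (extDer (zeroForm (𝓡 n) fun x => w (p.1, x)))
        (timeDeriv (spatialPart A) p.1) p.2 -
      formInner (spatialMetric h) (extDer (zeroForm (𝓡 n) fun x => w (p.1, x)))
        (extDer (zeroForm (𝓡 n) fun x => timeComponent A (p.1, x))) p.2 := by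
  have hdet : IsUnit (gramOf (lorentzForm (metricVal (spatialMetric h) p.2))
      (prodBasis (Module.finBasis ℝ (Euc n)))).det := by
    rw [det_gramOf_lorentzForm]
    exact (isUnit_det_spatial h p.2 _).neg
  have hsm := isSmoothForm_timeForm hw
  have hz : spatialPart (timeForm n w) = fun _ => 0 := by
    funext t x
    exact spatialPart_timeForm w t x
  rw [formInner_eq, metricVal_ultrastatic, tensorInner_eq_of_basis _
    (prodBasis (Module.finBasis ℝ (Euc n))) _ hdet, tensorInner_lorentz_two_form _ _
    (isUnit_det_spatial h p.2 _) _ _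
    (fun v w' => extDer_space_space hsm (spatialPart_timeForm w) p v w')
    (-formVal (extDer (zeroForm (𝓡 n) fun x => w (p.1, x))) p.2)
    (formVal (timeDeriv (spatialPart A) p.1) p.2 -
      formVal (extDer (zeroForm (𝓡 n) fun x => timeComponent A (p.1, x))) p.2) ?_ ?_,
    tensorInner_one_sub]
  · simp only [formInner_eq, tensorInner, ContinuousAlternatingMap.neg_apply, map_neg, neg_mul,
      mul_neg, Finset.sum_neg_distrib]
    ring
  · intro v
    rw [extDer_time_space hsm]
    simp only [timeComponent_timeForm]
    have : formVal (timeDeriv (spatialPart (timeForm n w)) p.1) p.2 = 0 := by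
      change deriv (fun s => formVal (spatialPart (timeForm n w) s) p.2) p.1 = 0
      simp [spatialPart_timeForm]
    rw [this]
    simp
  · intro v
    rw [extDer_time_space hA]
    rfl

end Spacetime


/-! ### Gluing measures along a countable cover. -/

section Gluing

variable {X ι : Type*} [MeasurableSpace X]

/-- The index set may be uncountable, but a countable subcover made disjoint already recovers ν: on
each disjoint piece a single restriction agrees with ν. -/
theorem iSup_restrict_eq_of_countable_cover {ν : Measure X} {V : ι → Set X}
    (hV : ∀ i, MeasurableSet (V i)) {c : ℕ → ι} (hc : ⋃ k, V (c k) = Set.univ) :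
    ⨆ i, ν.restrict (V i) = ν := by
  refine le_antisymm (iSup_le fun i => Measure.restrict_le_self) ?_
  rw [Measure.le_iff]
  intro C hC
  have hD : ∀ k, MeasurableSet (disjointed (fun k => V (c k)) k) :=
    fun k => MeasurableSet.disjointed (fun k => hV (c k)) k
  have hsum : ∀ ρ : Measure X, ρ C = ∑' k, ρ (C ∩ disjointed (fun k => V (c k)) k) := by
    intro ρ
    rw [← measure_iUnion (fun i j hij => ((disjoint_disjointed _) hij).mono
      Set.inter_subset_right Set.inter_subset_right) (fun k => hC.inter (hD k)),
      ← Set.inter_iUnion, iUnion_disjointed, hc, Set.inter_univ]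
  rw [hsum ν, hsum (⨆ i, ν.restrict (V i))]
  refine ENNReal.tsum_le_tsum fun k => ?_
  have h1 : ν.restrict (V (c k)) ≤ ⨆ i, ν.restrict (V i) := le_iSup (fun i => ν.restrict (V i)) _
  refine le_trans (le_of_eq ?_) (h1 _)
  rw [Measure.restrict_apply (hC.inter (hD k)), Set.inter_assoc,
    Set.inter_eq_left.2 (disjointed_subset (fun k => V (c k)) k)]

/-- The glued measure is the sum of the local ones restricted to disjoint pieces of a countable
subcover; compatibility on overlaps makes it agree with every member of the family. -/
theorem exists_measure_restrict_eq {μ : ι → Measure X} {V : ι → Set X}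
    (hV : ∀ i, MeasurableSet (V i)) {c : ℕ → ι} (hc : ⋃ k, V (c k) = Set.univ)
    (hcompat : ∀ i j, (μ i).restrict (V j) = (μ j).restrict (V i)) :
    ∃ ν : Measure X, ∀ i, ν.restrict (V i) = μ i := by
  have hD : ∀ k, MeasurableSet (disjointed (fun k => V (c k)) k) :=
    fun k => MeasurableSet.disjointed (fun k => hV (c k)) k
  refine ⟨Measure.sum fun k => (μ (c k)).restrict (disjointed (fun k => V (c k)) k), fun i => ?_⟩
  ext C hC
  rw [Measure.restrict_apply hC, Measure.sum_apply _ (hC.inter (hV i))]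
  have hsum : μ i C = ∑' k, μ i (C ∩ disjointed (fun k => V (c k)) k) := by
    rw [← measure_iUnion (fun i j hij => ((disjoint_disjointed _) hij).mono
      Set.inter_subset_right Set.inter_subset_right) (fun k => hC.inter (hD k)),
      ← Set.inter_iUnion, iUnion_disjointed, hc, Set.inter_univ]
  rw [hsum]
  refine tsum_congr fun k => ?_
  have hm : MeasurableSet (C ∩ disjointed (fun k => V (c k)) k) := hC.inter (hD k)
  calc _ = (μ (c k)).restrict (V i) (C ∩ disjointed (fun k => V (c k)) k) := by
        rw [Measure.restrict_apply (hC.inter (hV i)), Measure.restrict_apply hm]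
        congr 1
        ext x
        simp only [Set.mem_inter_iff]
        tauto
    _ = (μ i) (C ∩ disjointed (fun k => V (c k)) k) := by
        rw [hcompat, Measure.restrict_apply hm, Set.inter_assoc,
          Set.inter_eq_left.2 (disjointed_subset (fun k => V (c k)) k)]

end Gluing

/-! ### Invariance of the metric density under a change of basis. -/

section BasisChange

variable {E ι : Type*} [NormedAddCommGroup E] [NormedSpace ℝ E] [FiniteDimensional ℝ E]
  [MeasurableSpace E] [BorelSpace E] [Fintype ι] [DecidableEq ι]

omit [FiniteDimensional ℝ E] [MeasurableSpace E] [BorelSpace E] in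
theorem det_gramOf_comp (B : LinearMap.BilinForm ℝ E) (b : Module.Basis ι ℝ E) (L : E →ₗ[ℝ] E) :
    (gramOf B fun i => L (b i)).det = LinearMap.det L ^ 2 * (gramOf B b).det := by
  have hP : ∀ i, L (b i) = ∑ a, (LinearMap.toMatrix b b L).transpose i a • b a := fun i => by
    simp only [Matrix.transpose_apply, LinearMap.toMatrix_apply]
    exact (b.sum_repr (L (b i))).symm
  rw [gramOf_eq_mul hP, Matrix.det_mul, Matrix.det_mul]
  simp only [Matrix.det_transpose, LinearMap.det_toMatrix]
  ring

omit [FiniteDimensional ℝ E] [MeasurableSpace E] [BorelSpace E] in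
theorem sqrt_det_gramOf_comp (B : LinearMap.BilinForm ℝ E) (b : Module.Basis ι ℝ E) (L : E →ₗ[ℝ] E) :
    Real.sqrt |(gramOf B fun i => L (b i)).det| =
      |LinearMap.det L| * Real.sqrt |(gramOf B b).det| := by
  rw [det_gramOf_comp, abs_mul, abs_pow, Real.sqrt_mul (by positivity), Real.sqrt_sq (abs_nonneg _)]

/-- The density `√|det g|` times the Lebesgue measure does not depend on the basis. -/
theorem withDensity_gramOf_eq (B : E → LinearMap.BilinForm ℝ E) (b b' : Module.Basis ι ℝ E)
    (T : Set E) :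
    (b'.addHaar.restrict T).withDensity
        (fun y => ENNReal.ofReal (Real.sqrt |(gramOf (B y) b').det|)) =
      (b.addHaar.restrict T).withDensity
        (fun y => ENNReal.ofReal (Real.sqrt |(gramOf (B y) b).det|)) := by
  set L : E ≃ₗ[ℝ] E := b.equiv b' (Equiv.refl ι) with hL
  have hLb : ∀ i, (L : E →ₗ[ℝ] E) (b i) = b' i := fun i => by simp [hL]
  have hLb' : (fun i => (L : E →ₗ[ℝ] E) (b i)) = b' := funext hLb
  have hdet : LinearMap.det (L : E →ₗ[ℝ] E) ≠ 0 := (LinearEquiv.isUnit_det' L).ne_zero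
  -- The map L carries the parallelepiped of b to that of b', which has unit volume for b'. Thus the
  -- Haar measures differ by 1/|det L|, which cancels the factor |det L| in the square root of the
  -- Gram determinant.
  have h1 : b'.addHaar (parallelepiped b) * ENNReal.ofReal |LinearMap.det (L : E →ₗ[ℝ] E)| = 1 := by
    rw [mul_comm, ← Measure.addHaar_image_linearMap, image_parallelepiped]
    have : (⇑(L : E →ₗ[ℝ] E) ∘ b) = b' := hLb'
    rw [this, b'.addHaar_self]
  have h2 : b'.addHaar = b'.addHaar (parallelepiped b) • b.addHaar := by
    have := Measure.addHaarMeasure_unique b'.addHaar b.parallelepiped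
    rwa [← Module.Basis.addHaar_def] at this
  have hne : b'.addHaar (parallelepiped b) ≠ ⊤ := by
    intro h
    rw [h, ENNReal.top_mul] at h1
    · simp at h1
    · simpa using hdet
  rw [h2, Measure.restrict_smul, withDensity_smul_measure, ← withDensity_smul' _ _ hne]
  congr 1
  funext y
  simp only [Pi.smul_apply, smul_eq_mul]
  rw [← hLb', sqrt_det_gramOf_comp, ENNReal.ofReal_mul (abs_nonneg _), ← mul_assoc]
  rw [h1, one_mul]

end BasisChange

/-! ### The Riemannian volume and the product formula for the spacetime. -/

section Volume

variable {n : ℕ} {S : Type*} [TopologicalSpace S] [ChartedSpace (EuclideanSpace ℝ (Fin n)) S]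
  [IsManifold (𝓡 n) ∞ S] (h : SmoothMetric n S)

/-- The density of the volume measure in the preferred chart around `z`. -/
noncomputable def coordDensity (z : S) (y : Euc n) : ENNReal :=
  ENNReal.ofReal (Real.sqrt |(chartGram (spatialMetric h) z y).det|)

/-- The volume measure in the preferred chart around `z`. -/
noncomputable def coordVolume (z : S) : Measure (Euc n) :=
  ((Module.finBasis ℝ (Euc n)).addHaar.restrict (extChartAt (𝓡 n) z).target).withDensity
    (coordDensity h z)

theorem coordVolume_apply (z : S) {C : Set (Euc n)} (hC : MeasurableSet C) :
    coordVolume h z C = ∫⁻ y in C ∩ (extChartAt (𝓡 n) z).target, coordDensity h z y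
      ∂(Module.finBasis ℝ (Euc n)).addHaar := by
  rw [coordVolume, withDensity_apply _ hC, Measure.restrict_restrict hC]

theorem continuousOn_coordDensity_real (z : S) :
    ContinuousOn (fun y => Real.sqrt |(chartGram (spatialMetric h) z y).det|)
      (extChartAt (𝓡 n) z).target :=
  (Real.continuous_sqrt.comp (continuous_abs.comp (Continuous.matrix_det continuous_id))).comp_continuousOn
    (continuousOn_chartGram h z)

theorem coordDensity_pos {z : S} {y : Euc n} (hy : y ∈ (extChartAt (𝓡 n) z).target) :
    0 < coordDensity h z y := by
  unfold coordDensity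
  rw [ENNReal.ofReal_pos, Real.sqrt_pos, abs_pos]
  exact (posDef_chartGram h hy).det_pos.ne'

theorem coordVolume_lt_top {z : S} {K : Set (Euc n)} (hK : IsCompact K)
    (hKt : K ⊆ (extChartAt (𝓡 n) z).target) : coordVolume h z K < ⊤ := by
  obtain ⟨C, hC⟩ := hK.exists_bound_of_continuousOn ((continuousOn_coordDensity_real h z).mono hKt)
  rw [coordVolume_apply h z hK.measurableSet]
  refine lt_of_le_of_lt (setLIntegral_mono' (g := fun _ => ENNReal.ofReal C)
    (hK.measurableSet.inter (isOpen_chartTarget z).measurableSet) fun y hy => ?_) ?_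
  · refine ENNReal.ofReal_le_ofReal ((le_abs_self _).trans ?_)
    exact hC y hy.1
  · rw [setLIntegral_const]
    exact ENNReal.mul_lt_top ENNReal.ofReal_lt_top
      ((measure_mono Set.inter_subset_left).trans_lt hK.measure_lt_top)

theorem coordVolume_pos {z : S} {O : Set (Euc n)} (hO : IsOpen O) (hne : O.Nonempty)
    (hOt : O ⊆ (extChartAt (𝓡 n) z).target) : 0 < coordVolume h z O := by
  rw [coordVolume_apply h z hO.measurableSet, Set.inter_eq_left.2 hOt]
  have hm : AEMeasurable (coordDensity h z)
      ((Module.finBasis ℝ (Euc n)).addHaar.restrict O) :=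
    (((continuousOn_coordDensity_real h z).mono hOt).aemeasurable hO.measurableSet).ennreal_ofReal
  rw [pos_iff_ne_zero]
  intro h0
  rw [lintegral_eq_zero_iff' hm] at h0
  have h1 := (ae_restrict_iff' hO.measurableSet).1 h0
  have h2 : (Module.finBasis ℝ (Euc n)).addHaar O = 0 := by
    refine measure_mono_null (fun y hy => ?_) h1
    intro h3
    exact (coordDensity_pos h (hOt hy)).ne' (h3 hy)
  exact (hO.measure_pos _ hne).ne' h2

theorem aemeasurable_chart_symm [MeasurableSpace S] [BorelSpace S] (z : S) :
    AEMeasurable (extChartAt (𝓡 n) z).symm (coordVolume h z) := by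
  refine AEMeasurable.mono_ac ?_ (withDensity_absolutelyContinuous _ _)
  exact (continuousOn_extChartAt_symm z).aemeasurable (isOpen_chartTarget z).measurableSet

theorem chartVolume_eq_map [MeasurableSpace S] (z : S) :
    chartVolume (spatialMetric h) z = (coordVolume h z).map (extChartAt (𝓡 n) z).symm := rfl

variable [MeasurableSpace S] [BorelSpace S]

omit [IsManifold (𝓡 n) ∞ S] in
theorem measurableSet_target_inter_preimage (z : S) {C : Set S} (hC : MeasurableSet C) :
    MeasurableSet ((extChartAt (𝓡 n) z).target ∩ (extChartAt (𝓡 n) z).symm ⁻¹' C) := by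
  have h1 : Measurable ((extChartAt (𝓡 n) z).target.domRestrict (extChartAt (𝓡 n) z).symm) :=
    (continuousOn_iff_continuous_domRestrict.1 (continuousOn_extChartAt_symm z)).measurable
  have h2 := (MeasurableEmbedding.subtype_coe
    (isOpen_chartTarget (I := 𝓡 n) z).measurableSet).measurableSet_image.2 (h1 hC)
  convert h2 using 1
  ext y
  simp [and_comm]

theorem chartVolume_apply (z : S) {C : Set S} (hC : MeasurableSet C) :
    chartVolume (spatialMetric h) z C =
      ∫⁻ y in (extChartAt (𝓡 n) z).target ∩ (extChartAt (𝓡 n) z).symm ⁻¹' C, coordDensity h z y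
        ∂(Module.finBasis ℝ (Euc n)).addHaar := by
  have hm := measurableSet_target_inter_preimage (n := n) z hC
  rw [chartVolume_eq_map, Measure.map_apply_of_aemeasurable (aemeasurable_chart_symm h z) hC]
  have h1 : coordVolume h z ((extChartAt (𝓡 n) z).symm ⁻¹' C) =
      coordVolume h z ((extChartAt (𝓡 n) z).target ∩ (extChartAt (𝓡 n) z).symm ⁻¹' C) := by
    refine measure_congr ?_
    have h2 : ∀ᵐ y ∂(coordVolume h z), y ∈ (extChartAt (𝓡 n) z).target :=
      (withDensity_absolutelyContinuous _ _).ae_le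
        (ae_restrict_mem (isOpen_chartTarget z).measurableSet)
    filter_upwards [h2] with y hy
    exact propext ⟨fun h => ⟨hy, h⟩, fun h => h.2⟩
  rw [h1, coordVolume_apply h z hm, Set.inter_right_comm, Set.inter_self]

/-- Change of variables along the transition map τ: its Jacobian |det τ'| is exactly the factor by
which the square root of the Gram determinant changes between the two charts. -/
theorem chartVolume_compat (x z : S) :
    (chartVolume (spatialMetric h) x).restrict (extChartAt (𝓡 n) z).source =
      (chartVolume (spatialMetric h) z).restrict (extChartAt (𝓡 n) x).source := by
  ext C hC
  have hx := (isOpen_extChartAt_source (I := 𝓡 n) x).measurableSet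
  have hz := (isOpen_extChartAt_source (I := 𝓡 n) z).measurableSet
  rw [Measure.restrict_apply hC, Measure.restrict_apply hC, chartVolume_apply h x (hC.inter hz),
    chartVolume_apply h z (hC.inter hx)]
  set φx := extChartAt (𝓡 n) x with hφx
  set φz := extChartAt (𝓡 n) z with hφz
  set T := φz.target ∩ φz.symm ⁻¹' (C ∩ φx.source) with hT
  have hTm : MeasurableSet T := measurableSet_target_inter_preimage z (hC.inter hx)
  set τ : Euc n → Euc n := φx ∘ φz.symm with hτ
  have hmaps : ∀ y ∈ T, τ y ∈ φx.target ∧ φx.symm (τ y) = φz.symm y := fun y hy =>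
    ⟨φx.map_source hy.2.2, φx.left_inv hy.2.2⟩
  have himg : φx.target ∩ φx.symm ⁻¹' (C ∩ φz.source) = τ '' T := by
    ext w
    constructor
    · rintro ⟨hw, hwC, hwz⟩
      refine ⟨φz (φx.symm w), ⟨φz.map_source hwz, ?_⟩, ?_⟩
      · simp only [Set.mem_preimage, φz.left_inv hwz]
        exact ⟨hwC, φx.map_target hw⟩
      · simp only [hτ, Function.comp, φz.left_inv hwz, φx.right_inv hw]
    · rintro ⟨y, hy, rfl⟩
      refine ⟨(hmaps y hy).1, ?_⟩
      simp only [Set.mem_preimage, (hmaps y hy).2]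
      exact ⟨hy.2.1, φz.map_target hy.1⟩
  have hinj : Set.InjOn τ T := by
    intro y hy y' hy' he
    have h1 := (hmaps y hy).2
    rw [he, (hmaps y' hy').2] at h1
    rw [← φz.right_inv hy.1, ← φz.right_inv hy'.1, h1]
  have hder : ∀ y ∈ T, HasFDerivAt τ (fderiv ℝ τ y) y ∧
      chartDeriv (𝓡 n) z y = (chartDeriv (𝓡 n) x (τ y)).comp (fderiv ℝ τ y) := by
    intro y hy
    have hs : MDifferentiableAt 𝓘(ℝ, Euc n) (𝓡 n) φz.symm y :=
      (mdifferentiableOn_extChartAt_symm (I := 𝓡 n) (x := z) y hy.1).mdifferentiableAt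
        ((isOpen_chartTarget z).mem_nhds hy.1)
    have hc : MDifferentiableAt (𝓡 n) 𝓘(ℝ, Euc n) φx (φz.symm y) :=
      mdifferentiableAt_extChartAt (by simpa [hφx] using hy.2.2)
    have hd : MDifferentiableAt 𝓘(ℝ, Euc n) 𝓘(ℝ, Euc n) τ y := hc.comp y hs
    have hd' := mdifferentiableAt_iff_differentiableAt.1 hd
    refine ⟨hd'.hasFDerivAt, ?_⟩
    have hs' : MDifferentiableAt 𝓘(ℝ, Euc n) (𝓡 n) φx.symm (τ y) :=
      (mdifferentiableOn_extChartAt_symm (I := 𝓡 n) (x := x) (τ y) (hmaps y hy).1).mdifferentiableAt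
        ((isOpen_chartTarget x).mem_nhds (hmaps y hy).1)
    have hev : φz.symm =ᶠ[𝓝 y] φx.symm ∘ τ := by
      have hopen : IsOpen (φz.target ∩ φz.symm ⁻¹' φx.source) :=
        (continuousOn_extChartAt_symm z).isOpen_inter_preimage (isOpen_chartTarget z)
          (isOpen_extChartAt_source x)
      filter_upwards [hopen.mem_nhds ⟨hy.1, hy.2.2⟩] with w hw
      exact (φx.left_inv hw.2).symm
    have h1 := hev.mfderiv_eq (I := 𝓘(ℝ, Euc n)) (I' := 𝓡 n)
    have h2 := mfderiv_comp y hs' hd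
    have h3 : (mfderiv 𝓘(ℝ, Euc n) 𝓘(ℝ, Euc n) τ y : Euc n →L[ℝ] Euc n) = fderiv ℝ τ y :=
      mfderiv_eq_fderiv
    ext1 v
    have h4 : (mfderiv 𝓘(ℝ, Euc n) (𝓡 n) φz.symm y : Euc n →L[ℝ] Euc n) v =
      (mfderiv 𝓘(ℝ, Euc n) (𝓡 n) (φx.symm ∘ τ) y : Euc n →L[ℝ] Euc n) v :=
        congrArg (fun L : Euc n →L[ℝ] Euc n => L v) h1
    have h5 : (mfderiv 𝓘(ℝ, Euc n) (𝓡 n) (φx.symm ∘ τ) y : Euc n →L[ℝ] Euc n) v =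
        chartDeriv (𝓡 n) x (τ y) ((mfderiv 𝓘(ℝ, Euc n) 𝓘(ℝ, Euc n) τ y : Euc n →L[ℝ] Euc n) v) :=
      congrArg (fun L : Euc n →L[ℝ] Euc n => L v) h2
    rw [h3] at h5
    exact h4.trans h5
  rw [himg, lintegral_image_eq_lintegral_abs_det_fderiv_mul _ hTm
    (fun y hy => (hder y hy).1.hasFDerivWithinAt) hinj]
  refine setLIntegral_congr_fun hTm fun y hy => ?_
  have hB : gramOf (chartBilin (spatialMetric h) z y) (Module.finBasis ℝ (Euc n)) =
      gramOf (chartBilin (spatialMetric h) x (τ y))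
        fun i => (fderiv ℝ τ y : Euc n →ₗ[ℝ] Euc n) (Module.finBasis ℝ (Euc n) i) := by
    ext i j
    simp only [gramOf, Matrix.of_apply, chartBilin, (hder y hy).2, LinearMap.BilinForm.comp_apply]
    rw [← (hmaps y hy).2]
    rfl
  simp only [coordDensity, chartGram_eq]
  rw [hB, sqrt_det_gramOf_comp, ENNReal.ofReal_mul (abs_nonneg _)]

variable [SecondCountableTopology S] [Nonempty S]

omit [IsManifold (𝓡 n) ∞ S] [MeasurableSpace S] [BorelSpace S] in
theorem exists_countable_charts :
    ∃ c : ℕ → S, ⋃ k, (extChartAt (𝓡 n) (c k)).source = Set.univ := by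
  obtain ⟨s, hs, hcov⟩ := TopologicalSpace.countable_cover_nhds
    (f := fun x : S => (extChartAt (𝓡 n) x).source) fun x => extChartAt_source_mem_nhds x
  have hne : s.Nonempty := by
    by_contra h0
    rw [Set.not_nonempty_iff_eq_empty] at h0
    subst h0
    rw [Set.biUnion_empty] at hcov
    exact Set.empty_ne_univ hcov
  obtain ⟨c, rfl⟩ := hs.exists_eq_range hne
  exact ⟨c, by simpa using hcov⟩

theorem volumeMeasure_restrict_source (z : S) :
    (volumeMeasure (spatialMetric h)).restrict (extChartAt (𝓡 n) z).source =
      chartVolume (spatialMetric h) z := by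
  obtain ⟨c, hc⟩ := exists_countable_charts (n := n) (S := S)
  have hV : ∀ z : S, MeasurableSet (extChartAt (𝓡 n) z).source :=
    fun z => (isOpen_extChartAt_source z).measurableSet
  -- A supremum of measures is not computed set by set, so a glued measure is built first and then
  -- identified with the supremum of its own restrictions.
  obtain ⟨ν, hν⟩ := exists_measure_restrict_eq hV hc (chartVolume_compat h)
  have h1 : volumeMeasure (spatialMetric h) = ν := by
    unfold volumeMeasure
    simp only [← hν]
    exact iSup_restrict_eq_of_countable_cover hV hc
  rw [h1, hν]

instance isLocallyFinite_volumeMeasure :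
    IsLocallyFiniteMeasure (volumeMeasure (spatialMetric h)) := by
  refine ⟨fun z => ?_⟩
  obtain ⟨r, hr, hrt⟩ := Metric.nhds_basis_closedBall.mem_iff.1
    ((isOpen_chartTarget (I := 𝓡 n) z).mem_nhds (mem_extChartAt_target z))
  have hN : (extChartAt (𝓡 n) z).source ∩
      (extChartAt (𝓡 n) z) ⁻¹' Metric.ball (extChartAt (𝓡 n) z z) r ∈ 𝓝 z :=
    Filter.inter_mem (extChartAt_source_mem_nhds z)
      ((continuousAt_extChartAt z).preimage_mem_nhds (Metric.ball_mem_nhds _ hr))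
  have hopen : IsOpen ((extChartAt (𝓡 n) z).source ∩
      (extChartAt (𝓡 n) z) ⁻¹' Metric.ball (extChartAt (𝓡 n) z z) r) :=
    (continuousOn_extChartAt z).isOpen_inter_preimage (isOpen_extChartAt_source z) Metric.isOpen_ball
  refine ⟨_, hN, ?_⟩
  have h1 : volumeMeasure (spatialMetric h) ((extChartAt (𝓡 n) z).source ∩
      (extChartAt (𝓡 n) z) ⁻¹' Metric.ball (extChartAt (𝓡 n) z z) r) =
      chartVolume (spatialMetric h) z ((extChartAt (𝓡 n) z).source ∩
        (extChartAt (𝓡 n) z) ⁻¹' Metric.ball (extChartAt (𝓡 n) z z) r) := by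
    rw [← volumeMeasure_restrict_source h z, Measure.restrict_apply hopen.measurableSet,
      Set.inter_right_comm, Set.inter_self]
  rw [h1, chartVolume_apply h z hopen.measurableSet,]
  refine lt_of_le_of_lt (lintegral_mono_set (t := Metric.closedBall (extChartAt (𝓡 n) z z) r ∩
    (extChartAt (𝓡 n) z).target) ?_) ?_
  · rintro y ⟨hy, hy', hy''⟩
    rw [Set.mem_preimage, (extChartAt (𝓡 n) z).right_inv hy] at hy''
    exact ⟨Metric.ball_subset_closedBall hy'', hy⟩
  · rw [← coordVolume_apply h z Metric.isClosed_closedBall.measurableSet]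
    exact coordVolume_lt_top h (isCompact_closedBall _ _) hrt

instance isOpenPos_volumeMeasure :
    (volumeMeasure (spatialMetric h)).IsOpenPosMeasure := by
  refine ⟨fun O hO hne h0 => ?_⟩
  obtain ⟨z, hz⟩ := hne
  have h1 : chartVolume (spatialMetric h) z O = 0 := by
    rw [← volumeMeasure_restrict_source h z]
    exact le_antisymm ((Measure.restrict_le_self O).trans h0.le) zero_le
  have hop : IsOpen ((extChartAt (𝓡 n) z).target ∩ (extChartAt (𝓡 n) z).symm ⁻¹' O) :=
    (continuousOn_extChartAt_symm z).isOpen_inter_preimage (isOpen_chartTarget z) hO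
  have h2 := coordVolume_pos h hop ⟨extChartAt (𝓡 n) z z, mem_extChartAt_target z, by simpa using hz⟩
    Set.inter_subset_left
  rw [coordVolume_apply h z hop.measurableSet, Set.inter_right_comm, Set.inter_self,
    ← chartVolume_apply h z hO.measurableSet, h1] at h2
  exact lt_irrefl _ h2

theorem integral_volumeMeasure_eq_coord {G : Type*} [NormedAddCommGroup G] [NormedSpace ℝ G]
    (z : S) {F : S → G} (hF : StronglyMeasurable F) (h0 : ∀ x ∉ (extChartAt (𝓡 n) z).source, F x = 0) :
    ∫ x, F x ∂(volumeMeasure (spatialMetric h)) =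
      ∫ y, F ((extChartAt (𝓡 n) z).symm y) ∂(coordVolume h z) := by
  rw [← setIntegral_eq_integral_of_forall_compl_eq_zero h0, volumeMeasure_restrict_source,
    chartVolume_eq_map, integral_map (aemeasurable_chart_symm h z) hF.aestronglyMeasurable]

/-! ### The volume of the spacetime -/

/-- The Gram determinant of -dt² + h is minus that of h, so the density does not depend on time and
equals the density of the slice. -/
theorem chartVolume_ultrastatic (p : ℝ × S) :
    chartVolume (ultrastaticMetric h) p =
      (volume : Measure ℝ).prod (chartVolume (spatialMetric h) p.2) := by
  have hsf : SigmaFinite (chartVolume (spatialMetric h) p.2) := by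
    rw [← volumeMeasure_restrict_source]
    infer_instance
  refine (Measure.prod_eq fun s C hs hC => ?_).symm
  set b := Module.finBasis ℝ (Euc n)
  have hcard : Fintype.card (Unit ⊕ Fin (Module.finrank ℝ (Euc n))) =
      Module.finrank ℝ (ℝ × Euc n) := by simp [add_comm]
  set e := Fintype.equivFinOfCardEq hcard
  -- The basis fixed on the product model space is unrelated to the product of the chosen bases, so
  -- invariance of the density under a change of basis is needed before Fubini.
  set b'' : Module.Basis (Fin (Module.finrank ℝ (ℝ × Euc n))) ℝ (ℝ × Euc n) := (prodBasis b).reindex e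
  have hdens : ((Module.finBasis ℝ (ℝ × Euc n)).addHaar.restrict
      (extChartAt (𝓘(ℝ, ℝ).prod (𝓡 n)) p).target).withDensity
      (fun y => ENNReal.ofReal (Real.sqrt |(chartGram (ultrastaticMetric h) p y).det|)) =
      (((volume : Measure ℝ).prod b.addHaar).restrict
        (Set.univ ×ˢ (extChartAt (𝓡 n) p.2).target)).withDensity fun q => coordDensity h p.2 q.2 := by
    have h1 := withDensity_gramOf_eq (chartBilin (ultrastaticMetric h) p) b''
      (Module.finBasis ℝ (ℝ × Euc n)) (extChartAt (𝓘(ℝ, ℝ).prod (𝓡 n)) p).target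
    have h2 : b''.addHaar = (volume : Measure ℝ).prod b.addHaar := by
      rw [Module.Basis.addHaar_reindex, prodBasis, Module.Basis.prod_addHaar]
      congr 1
      have h3 : (Module.Basis.singleton Unit ℝ).addHaar =
          ((OrthonormalBasis.singleton Unit ℝ).toBasis).addHaar := by
        congr 1
        ext i
        simp
      rw [h3, OrthonormalBasis.addHaar_eq_volume]
    simp only [chartGram_eq]
    rw [h1, h2, prodChart_target]
    refine withDensity_congr_ae ?_
    filter_upwards [ae_restrict_mem (isOpen_prodTarget p.2).measurableSet] with q hq
    have h4 : chartBilin (ultrastaticMetric h) p q = lorentzForm (chartBilin (spatialMetric h) p.2 q.2) := by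
      unfold chartBilin
      rw [prodChart_symm_apply, prodChart_chartDeriv p hq.2, metricVal_ultrastatic]
      rfl
    have h5 : gramOf (chartBilin (ultrastaticMetric h) p q) b'' =
        (gramOf (lorentzForm (chartBilin (spatialMetric h) p.2 q.2)) (prodBasis b)).submatrix e.symm e.symm := by
      ext i j
      simp [gramOf, b'', h4]
    rw [h5, Matrix.det_submatrix_equiv_self, det_gramOf_lorentzForm, abs_neg]
    rfl
  have hsymm : AEMeasurable (extChartAt (𝓘(ℝ, ℝ).prod (𝓡 n)) p).symm
      ((((volume : Measure ℝ).prod b.addHaar).restrict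
        (Set.univ ×ˢ (extChartAt (𝓡 n) p.2).target)).withDensity fun q => coordDensity h p.2 q.2) := by
    refine AEMeasurable.mono_ac ?_ (withDensity_absolutelyContinuous _ _)
    have := continuousOn_extChartAt_symm (I := 𝓘(ℝ, ℝ).prod (𝓡 n)) p
    rw [prodChart_target] at this
    exact this.aemeasurable (isOpen_prodTarget p.2).measurableSet
  conv_lhs => unfold chartVolume
  rw [hdens, Measure.map_apply_of_aemeasurable hsymm (hs.prod hC)]
  have hpre : (extChartAt (𝓘(ℝ, ℝ).prod (𝓡 n)) p).symm ⁻¹' (s ×ˢ C) =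
      s ×ˢ ((extChartAt (𝓡 n) p.2).symm ⁻¹' C) := by
    ext q
    simp only [Set.mem_preimage, prodChart_symm_apply, Set.mem_prod]
  have hT := measurableSet_target_inter_preimage (n := n) p.2 hC
  set T := (extChartAt (𝓡 n) p.2).target ∩ (extChartAt (𝓡 n) p.2).symm ⁻¹' C
  have hae : ((((volume : Measure ℝ).prod b.addHaar).restrict
        (Set.univ ×ˢ (extChartAt (𝓡 n) p.2).target)).withDensity fun q => coordDensity h p.2 q.2)
        (s ×ˢ ((extChartAt (𝓡 n) p.2).symm ⁻¹' C)) =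
      ((((volume : Measure ℝ).prod b.addHaar).restrict
        (Set.univ ×ˢ (extChartAt (𝓡 n) p.2).target)).withDensity fun q => coordDensity h p.2 q.2)
        (s ×ˢ T) := by
    refine measure_congr ?_
    have h2 := (withDensity_absolutelyContinuous
      (((volume : Measure ℝ).prod b.addHaar).restrict
        (Set.univ ×ˢ (extChartAt (𝓡 n) p.2).target)) (fun q => coordDensity h p.2 q.2)).ae_le
        (ae_restrict_mem (isOpen_prodTarget p.2).measurableSet)
    filter_upwards [h2] with q hq
    exact propext ⟨fun h => ⟨h.1, hq.2, h.2⟩, fun h => ⟨h.1, h.2.2⟩⟩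
  rw [hpre, hae, withDensity_apply _ (hs.prod hT), Measure.restrict_restrict (hs.prod hT),
    Set.prod_inter_prod, Set.inter_univ, Set.inter_eq_left.2 (Set.inter_subset_left : T ⊆ _),
    ← Measure.prod_restrict]
  have hm : AEMeasurable (coordDensity h p.2) (b.addHaar.restrict T) :=
    (((continuousOn_coordDensity_real h p.2).mono Set.inter_subset_left).aemeasurable hT).ennreal_ofReal
  have := lintegral_prod_mul (μ := (volume : Measure ℝ).restrict s) (ν := b.addHaar.restrict T)
    (f := fun _ => 1) (g := coordDensity h p.2) aemeasurable_const hm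
  simp only [one_mul] at this
  rw [this, lintegral_one, Measure.restrict_apply_univ, ← chartVolume_apply h p.2 hC]

theorem volumeMeasure_ultrastatic :
    volumeMeasure (ultrastaticMetric h) =
      (volume : Measure ℝ).prod (volumeMeasure (spatialMetric h)) := by
  obtain ⟨c, hc⟩ := exists_countable_charts (n := n) (S := S)
  have h1 : ∀ p : ℝ × S, chartVolume (ultrastaticMetric h) p =
      ((volume : Measure ℝ).prod (volumeMeasure (spatialMetric h))).restrict
        (Set.univ ×ˢ (extChartAt (𝓡 n) p.2).source) := by
    intro p
    rw [chartVolume_ultrastatic, ← volumeMeasure_restrict_source, ← Measure.prod_restrict,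
      Measure.restrict_univ]
  unfold volumeMeasure
  simp only [h1]
  refine iSup_restrict_eq_of_countable_cover (c := fun k => ((0 : ℝ), c k)) (fun p =>
    MeasurableSet.univ.prod (isOpen_extChartAt_source p.2).measurableSet) ?_
  rw [← Set.prod_iUnion, hc, Set.univ_prod_univ]

end Volume


/-! ### Compactness of balls in complete, locally compact length spaces. -/

section LengthSpace

variable {X : Type*} [EMetricSpace X] [CompleteSpace X] [WeaklyLocallyCompactSpace X]

/-- In a complete locally compact length space the closed balls are compact. -/
theorem isCompact_closedEBall_of_length
    (hlen : ∀ (x y : X) (r s : ENNReal), 0 < r → 0 < s → edist x y < r + s →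
      ∃ z, edist x z < r ∧ edist z y < s) (p : X) (R : NNReal) :
    IsCompact (Metric.closedEBall p R) := by
  by_contra hR
  set T : Set NNReal := {r | IsCompact (Metric.closedEBall p (r : ENNReal))} with hT
  have hdown : ∀ r ∈ T, ∀ r' ≤ r, r' ∈ T := fun r hr r' hr' =>
    IsCompact.of_isClosed_subset hr Metric.isClosed_closedEBall
      (Metric.closedEBall_subset_closedEBall (by exact_mod_cast hr'))
  have hlt : ∀ r ∈ T, r < R := fun r hr => lt_of_not_ge fun hRr => hR (hdown r hr R hRr)
  have h0 : (0 : NNReal) ∈ T := by simp [hT, Metric.closedEBall_zero]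
  have hbdd : BddAbove T := ⟨R, fun r hr => (hlt r hr).le⟩
  set s := sSup T with hs
  -- The supremum is attained: the length property puts the ball of radius s within e of a compact
  -- ball of radius r with s < r + e, so it is totally bounded, and completeness finishes.
  have hsT : s ∈ T := by
    rcases eq_or_lt_of_le (zero_le : 0 ≤ s) with h | hspos
    · rw [← h]; exact h0
    refine isCompact_iff_totallyBounded_isComplete.2
      ⟨?_, Metric.isClosed_closedEBall.isComplete⟩
    refine EMetric.totallyBounded_iff.2 fun ε hε => ?_
    obtain ⟨e, he, heε⟩ : ∃ e : NNReal, 0 < e ∧ (e : ENNReal) + e ≤ ε := by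
      obtain ⟨e, he, heε⟩ := ENNReal.lt_iff_exists_nnreal_btwn.1 (ENNReal.half_pos hε.ne')
      refine ⟨e, by exact_mod_cast he, ?_⟩
      calc (e : ENNReal) + e ≤ ε / 2 + ε / 2 := add_le_add heε.le heε.le
        _ = ε := ENNReal.add_halves ε
    -- The minimum with s keeps the truncated subtraction genuine and hence r positive, as the
    -- length property requires.
    obtain ⟨r, hrT, hr⟩ : ∃ r ∈ T, s - min e s / 2 < r := by
      refine exists_lt_of_lt_csSup ⟨0, h0⟩ ?_
      exact tsub_lt_self hspos (half_pos (lt_min he hspos))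
    have hr0 : 0 < r := lt_of_le_of_lt zero_le hr
    have hsr : s < r + e := by
      have h1 : s < r + min e s / 2 := (tsub_lt_iff_right
        ((NNReal.half_le_self _).trans (min_le_right _ _))).1 hr
      refine h1.trans_le (add_le_add le_rfl ((NNReal.half_le_self _).trans (min_le_left _ _)))
    obtain ⟨t, ht, hcov⟩ := EMetric.totallyBounded_iff.1 (IsCompact.totallyBounded hrT) e
      (by exact_mod_cast he)
    refine ⟨t, ht, fun q hq => ?_⟩
    have hpq : edist p q < (r : ENNReal) + e := by
      rw [edist_comm]
      refine lt_of_le_of_lt (Metric.mem_closedEBall.1 hq) ?_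
      exact_mod_cast hsr
    obtain ⟨z, hz1, hz2⟩ := hlen p q r e (by exact_mod_cast hr0) (by exact_mod_cast he) hpq
    have hzc := hcov (show z ∈ Metric.closedEBall p (r : ENNReal) by
      rw [Metric.mem_closedEBall, edist_comm]; exact hz1.le)
    simp only [Set.mem_iUnion, exists_prop] at hzc ⊢
    obtain ⟨y, hy, hyz⟩ := hzc
    refine ⟨y, hy, ?_⟩
    rw [Metric.mem_eball] at hyz ⊢
    calc edist q y ≤ edist q z + edist z y := edist_triangle _ _ _
      _ < e + e := ENNReal.add_lt_add (by rwa [edist_comm]) hyz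
      _ ≤ ε := heε
  obtain ⟨K, hK, hsK⟩ := exists_compact_superset hsT
  obtain ⟨δ, hδ, hth⟩ := IsCompact.exists_thickening_subset_open hsT isOpen_interior hsK
  set d : NNReal := ⟨δ, hδ.le⟩ with hd
  have hd0 : 0 < d := hδ
  -- Local compactness thickens the compact ball of radius s by d, and the length property places
  -- the ball of radius s + d/2 inside this thickening. So T exceeds its supremum.
  have hnew : s + d / 2 ∈ T := by
    refine IsCompact.of_isClosed_subset hK Metric.isClosed_closedEBall fun q hq =>
      interior_subset (hth ?_)
    rw [Metric.mem_thickening_iff_exists_edist_lt]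
    have hδd : ENNReal.ofReal δ = d := by rw [ENNReal.ofReal]; congr 1; exact Real.toNNReal_of_nonneg hδ.le
    rw [hδd]
    have hpq : edist p q < (s : ENNReal) + d := by
      rw [edist_comm]
      refine lt_of_le_of_lt (Metric.mem_closedEBall.1 hq) ?_
      have := NNReal.half_lt_self hd0.ne'
      exact_mod_cast add_lt_add_right this s
    rcases eq_or_lt_of_le (zero_le : 0 ≤ s) with h | hspos
    · refine ⟨p, by simp, ?_⟩
      rw [← h] at hpq
      simpa [edist_comm] using hpq
    · obtain ⟨z, hz1, hz2⟩ := hlen p q s d (by exact_mod_cast hspos) (by exact_mod_cast hd0) hpq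
      exact ⟨z, by rw [Metric.mem_closedEBall, edist_comm]; exact hz1.le, by rwa [edist_comm]⟩
  have := le_csSup hbdd hnew
  have h2 : s < s + d / 2 := lt_add_of_pos_right s (half_pos hd0)
  exact absurd this (not_le.2 h2)

end LengthSpace

/-! ### Riemannian distance and lengths of curves. -/

section Distance

variable {n : ℕ} {S : Type*} [TopologicalSpace S] [ChartedSpace (EuclideanSpace ℝ (Fin n)) S]
  [IsManifold (𝓡 n) ∞ S] (h : SmoothMetric n S)

/-- The Riemannian distance of `h`. -/
noncomputable def riemEDist (x y : S) : ENNReal :=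
  letI : Bundle.RiemannianBundle (fun x : S => TangentSpace (𝓡 n) x) := ⟨h.toRiemannianMetric⟩
  Manifold.riemannianEDist (𝓡 n) x y

/-- The speed of a curve. -/
noncomputable def speed (γ : ℝ → S) (s : ℝ) : ℝ :=
  Real.sqrt (h.inner (γ s) (velocity (I := 𝓡 n) γ s) (velocity (I := 𝓡 n) γ s))

theorem continuous_speed {γ : ℝ → S} (hγ : ContMDiff 𝓘(ℝ, ℝ) (𝓡 n) 1 γ) :
    Continuous (speed h γ) := by
  let : Bundle.RiemannianBundle (fun x : S => TangentSpace (𝓡 n) x) := ⟨h.toRiemannianMetric⟩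
  have : IsContinuousRiemannianBundle (EuclideanSpace ℝ (Fin n))
      (fun x : S => TangentSpace (𝓡 n) x) := ⟨⟨h.inner, h.contMDiff.continuous, fun _ _ _ => rfl⟩⟩
  have h2 : Continuous (fun s : ℝ => (⟨s, (1 : ℝ)⟩ : TangentBundle 𝓘(ℝ, ℝ) ℝ)) :=
    (contMDiff_vectorSpace_iff_contDiff (n := 0) (V := fun _ : ℝ => (1 : ℝ))|>.2
      contDiff_const).continuous
  have h1 := (hγ.continuous_tangentMap le_rfl).comp h2
  exact Real.continuous_sqrt.comp (Continuous.inner_bundle (F := EuclideanSpace ℝ (Fin n))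
    (E := fun x : S => TangentSpace (𝓡 n) x) h1 h1)

theorem pathELength_eq_lintegral_speed (γ : ℝ → S) (a b : ℝ) :
    letI : Bundle.RiemannianBundle (fun x : S => TangentSpace (𝓡 n) x) := ⟨h.toRiemannianMetric⟩
    Manifold.pathELength (𝓡 n) γ a b = ∫⁻ s in Set.Icc a b, ENNReal.ofReal (speed h γ s) := by
  let : Bundle.RiemannianBundle (fun x : S => TangentSpace (𝓡 n) x) := ⟨h.toRiemannianMetric⟩
  change Manifold.pathELength (𝓡 n) γ a b = _
  rw [Manifold.pathELength_eq_lintegral_mfderiv_Icc]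
  refine lintegral_congr fun s => ?_
  rw [← ofReal_norm, norm_eq_sqrt_real_inner]
  rfl

theorem riemEDist_le_lintegral_speed {γ : ℝ → S} {a b : ℝ}
    (hγ : ContMDiffOn 𝓘(ℝ, ℝ) (𝓡 n) 1 γ (Set.Icc a b)) (hab : a ≤ b) :
    riemEDist h (γ a) (γ b) ≤ ∫⁻ s in Set.Icc a b, ENNReal.ofReal (speed h γ s) := by
  rw [← pathELength_eq_lintegral_speed]
  let : Bundle.RiemannianBundle (fun x : S => TangentSpace (𝓡 n) x) := ⟨h.toRiemannianMetric⟩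
  exact Manifold.riemannianEDist_le_pathELength hγ rfl rfl hab

/-- Curves that are constant near both ends can be joined to one another without losing
differentiability; that is the point of the last two conditions. -/
theorem exists_curve_of_riemEDist_lt {x y : S} {r : ENNReal} (hr : riemEDist h x y < r) {a b : ℝ}
    (hab : a < b) : ∃ γ : ℝ → S, ContMDiff 𝓘(ℝ, ℝ) (𝓡 n) 1 γ ∧
      ∫⁻ s in Set.Icc a b, ENNReal.ofReal (speed h γ s) < r ∧
      γ =ᶠ[𝓝 a] (fun _ => x) ∧ γ =ᶠ[𝓝 b] (fun _ => y) := by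
  let : Bundle.RiemannianBundle (fun x : S => TangentSpace (𝓡 n) x) := ⟨h.toRiemannianMetric⟩
  obtain ⟨γ, -, -, h1, h2, h3, h4⟩ :=
    Manifold.exists_lt_locally_constant_of_riemannianEDist_lt (I := 𝓡 n) hr hab
  exact ⟨γ, h1, by rwa [← pathELength_eq_lintegral_speed], h3, h4⟩

/-- The length-space property: cut a curve of length below r + s at the point where the arc length
has reached a value c, chosen so that both pieces are short enough. -/
theorem exists_riemEDist_lt {x y : S} {r s : ENNReal} (hr : 0 < r) (hs : 0 < s)
    (hd : riemEDist h x y < r + s) : ∃ z, riemEDist h x z < r ∧ riemEDist h z y < s := by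
  by_cases hrd : riemEDist h x y < r
  · refine ⟨y, hrd, ?_⟩
    let : Bundle.RiemannianBundle (fun x : S => TangentSpace (𝓡 n) x) := ⟨h.toRiemannianMetric⟩
    have : riemEDist h y y = 0 := Manifold.riemannianEDist_self
    rwa [this]
  rw [not_lt] at hrd
  have hr_inf : r ≠ ⊤ := by
    rintro rfl
    simp at hd
    exact hd.not_ge hrd
  obtain ⟨γ, hγ, hL, h0, h1⟩ := exists_curve_of_riemEDist_lt h hd zero_lt_one
  have hx : γ 0 = x := h0.eq_of_nhds
  have hy : γ 1 = y := h1.eq_of_nhds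
  set f : ℝ → ℝ := fun u => ∫ s in (0:ℝ)..u, speed h γ s with hf
  have hc := continuous_speed h hγ
  have hnn : ∀ s, 0 ≤ speed h γ s := fun s => Real.sqrt_nonneg _
  have hfc : Continuous f := intervalIntegral.continuous_primitive
    (fun a b => hc.intervalIntegrable a b) 0
  have hlint : ∀ a b, a ≤ b → ∫⁻ s in Set.Icc a b, ENNReal.ofReal (speed h γ s) =
      ENNReal.ofReal (f b - f a) := by
    intro a b hab
    rw [intervalIntegral.integral_interval_sub_left (hc.intervalIntegrable _ _)
      (hc.intervalIntegrable _ _), intervalIntegral.integral_of_le hab, ← integral_Icc_eq_integral_Ioc,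
      ofReal_integral_eq_lintegral_ofReal (hc.continuousOn.integrableOn_Icc)
        (Filter.Eventually.of_forall hnn)]
  have hf0 : f 0 = 0 := by simp [hf]
  rw [hlint 0 1 zero_le_one, hf0, sub_zero] at hL
  have hf1 : r ≤ ENNReal.ofReal (f 1) := by
    refine hrd.trans ?_
    have := riemEDist_le_lintegral_speed h (hγ.contMDiffOn (s := Set.Icc 0 1)) zero_le_one
    rwa [hx, hy, hlint 0 1 zero_le_one, hf0, sub_zero] at this
  obtain ⟨c, hc0, hcr, hcs⟩ : ∃ c : ℝ, 0 ≤ c ∧ ENNReal.ofReal c < r ∧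
      ENNReal.ofReal (f 1 - c) < s := by
    by_cases hs_inf : s = ⊤
    · exact ⟨0, le_rfl, by simpa using hr, by simp [hs_inf]⟩
    lift r to NNReal using hr_inf
    lift s to NNReal using hs_inf
    have hlt : f 1 < r + s := by
      have h3 := (ENNReal.ofReal_lt_iff_lt_toReal
        (intervalIntegral.integral_nonneg zero_le_one fun u _ => hnn u) (by simp)).1 hL
      rwa [ENNReal.toReal_add (by simp) (by simp), ENNReal.coe_toReal, ENNReal.coe_toReal] at h3
    have hr' : (0:ℝ) < r := by exact_mod_cast hr
    have hs' : (0:ℝ) < s := by exact_mod_cast hs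
    -- The first piece needs c < r, the second f 1 - c < s, and c must be nonnegative to be a value
    -- of the arc length.
    obtain ⟨c, hc1, hc2⟩ := exists_between (show max 0 (f 1 - s) < (r : ℝ) from
      max_lt hr' (by linarith))
    have hc1' := max_lt_iff.1 hc1
    refine ⟨c, hc1'.1.le, ?_, ?_⟩
    · rw [← ENNReal.ofReal_coe_nnreal, ENNReal.ofReal_lt_ofReal_iff hr']; exact hc2
    · rw [← ENNReal.ofReal_coe_nnreal, ENNReal.ofReal_lt_ofReal_iff hs']; linarith [hc1'.2]
  have hcf : c ≤ f 1 := by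
    have h3 := hcr.trans_le hf1
    by_contra h4
    exact absurd (ENNReal.ofReal_le_ofReal (not_le.1 h4).le) (not_le.2 h3)
  obtain ⟨u, hu, hfu⟩ := intermediate_value_Icc zero_le_one hfc.continuousOn
    (show c ∈ Set.Icc (f 0) (f 1) from ⟨by rwa [hf0], hcf⟩)
  refine ⟨γ u, ?_, ?_⟩
  · have := riemEDist_le_lintegral_speed h (hγ.contMDiffOn (s := Set.Icc 0 u)) hu.1
    rw [hx, hlint 0 u hu.1, hf0, sub_zero, hfu] at this
    exact this.trans_lt hcr
  · have := riemEDist_le_lintegral_speed h (hγ.contMDiffOn (s := Set.Icc u 1)) hu.2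
    rw [hy, hlint u 1 hu.2, hfu] at this
    exact this.trans_lt hcs

end Distance


open Filter

/-! ### Completeness of the slice from global hyperbolicity. -/

section Completeness

variable {n : ℕ} {S : Type*} [TopologicalSpace S] [ChartedSpace (EuclideanSpace ℝ (Fin n)) S]

theorem velocity_congr {γ γ' : ℝ → S} {s : ℝ} (hs : γ =ᶠ[𝓝 s] γ') :
    (velocity (I := 𝓡 n) γ s : EuclideanSpace ℝ (Fin n)) = velocity (I := 𝓡 n) γ' s :=
  congrArg (fun L : ℝ →L[ℝ] EuclideanSpace ℝ (Fin n) => L 1)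
    (hs.mfderiv_eq (I := 𝓘(ℝ, ℝ)) (I' := 𝓡 n))

theorem velocity_const (x : S) (s : ℝ) :
    (velocity (I := 𝓡 n) (fun _ : ℝ => x) s : EuclideanSpace ℝ (Fin n)) = 0 := by
  unfold velocity
  rw [mfderiv_const]
  rfl

/-- The velocity of a curve in `ℝ × S`. -/
theorem velocity_prod {γ : ℝ → ℝ × S} (hγ : ContMDiff 𝓘(ℝ, ℝ) (𝓘(ℝ, ℝ).prod (𝓡 n)) 1 γ) (s : ℝ) :
    (velocity (I := 𝓘(ℝ, ℝ).prod (𝓡 n)) γ s : ℝ × EuclideanSpace ℝ (Fin n)) =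
      (deriv (fun s => (γ s).1) s, velocity (I := 𝓡 n) (fun s => (γ s).2) s) := by
  have h1 : MDifferentiableAt 𝓘(ℝ, ℝ) 𝓘(ℝ, ℝ) (fun s => (γ s).1) s :=
    ((contMDiff_fst.comp hγ).mdifferentiable one_ne_zero) s
  have h2 : MDifferentiableAt 𝓘(ℝ, ℝ) (𝓡 n) (fun s => (γ s).2) s :=
    ((contMDiff_snd.comp hγ).mdifferentiable one_ne_zero) s
  have h3 := congrArg (fun L : ℝ →L[ℝ] ℝ × EuclideanSpace ℝ (Fin n) => L 1) (mfderiv_prodMk h1 h2)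
  refine Eq.trans h3 ?_
  refine Prod.ext ?_ rfl
  change (mfderiv 𝓘(ℝ, ℝ) 𝓘(ℝ, ℝ) (fun s => (γ s).1) s : ℝ →L[ℝ] ℝ) 1 = _
  rw [mfderiv_eq_fderiv]
  rfl

variable [IsManifold (𝓡 n) ∞ S] (h : SmoothMetric n S)

theorem speed_sq (γ : ℝ → S) (s : ℝ) :
    speed h γ s ^ 2 = h.inner (γ s) (velocity (I := 𝓡 n) γ s) (velocity (I := 𝓡 n) γ s) := by
  refine Real.sq_sqrt ?_
  by_cases h0 : velocity (I := 𝓡 n) γ s = 0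
  · rw [h0]; simp
  · exact (h.pos _ _ h0).le

theorem speed_nonneg (γ : ℝ → S) (s : ℝ) : 0 ≤ speed h γ s := Real.sqrt_nonneg _

theorem speed_congr {γ γ' : ℝ → S} {s : ℝ} (hs : γ =ᶠ[𝓝 s] γ') : speed h γ s = speed h γ' s := by
  have h1 : ∀ (x y : S) (v w : EuclideanSpace ℝ (Fin n)), x = y → v = w →
      metricVal (spatialMetric h) x v v = metricVal (spatialMetric h) y w w := by
    rintro x y v w rfl rfl; rfl
  exact congrArg Real.sqrt (h1 _ _ _ _ hs.eq_of_nhds (velocity_congr hs))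

theorem ultrastatic_velocity {γ : ℝ → ℝ × S}
    (hγ : ContMDiff 𝓘(ℝ, ℝ) (𝓘(ℝ, ℝ).prod (𝓡 n)) 1 γ) (s : ℝ) :
    ultrastaticMetric h (γ s) (velocity γ s) (velocity γ s) =
      -(deriv (fun s => (γ s).1) s ^ 2) + speed h (fun s => (γ s).2) s ^ 2 := by
  have h1 : metricVal (ultrastaticMetric h) (γ s)
      (velocity (I := 𝓘(ℝ, ℝ).prod (𝓡 n)) γ s) (velocity (I := 𝓘(ℝ, ℝ).prod (𝓡 n)) γ s) =
      metricVal (ultrastaticMetric h) (γ s)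
      (deriv (fun s => (γ s).1) s, velocity (I := 𝓡 n) (fun s => (γ s).2) s)
      (deriv (fun s => (γ s).1) s, velocity (I := 𝓡 n) (fun s => (γ s).2) s) := by
    rw [velocity_prod hγ]
    rfl
  refine h1.trans ((ultrastaticMetric_apply h (γ s) _ _ _ _).trans ?_)
  rw [speed_sq, sq]

/-- Concatenation of curves `c k` on `[k, k + 1]`, constant for negative times. -/
theorem exists_concatenation {X : Type*} {x : ℕ → X} {c : ℕ → ℝ → X}
    (hc0 : ∀ k : ℕ, c k =ᶠ[𝓝 (k : ℝ)] fun _ => x k)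
    (hc1 : ∀ k : ℕ, c k =ᶠ[𝓝 ((k : ℝ) + 1)] fun _ => x (k + 1)) :
    ∃ γ : ℝ → X, (∀ s < 0, γ =ᶠ[𝓝 s] fun _ => x 0) ∧
      (∀ k : ℕ, ∀ s ∈ Set.Icc (k : ℝ) (k + 1), γ =ᶠ[𝓝 s] c k) := by
  set γ : ℝ → X := fun s => if s < 0 then x 0 else c ⌊s⌋₊ s with hγ
  have hIoo : ∀ k : ℕ, ∀ s ∈ Set.Ioo (k : ℝ) (k + 1), γ =ᶠ[𝓝 s] c k := by
    intro k s hs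
    filter_upwards [isOpen_Ioo.mem_nhds hs] with u hu
    have hu0 : (0:ℝ) ≤ u := (Nat.cast_nonneg k).trans hu.1.le
    have : ⌊u⌋₊ = k := (Nat.floor_eq_iff hu0).2 ⟨hu.1.le, hu.2⟩
    simp [hγ, not_lt.2 hu0, this]
  have hneg : ∀ s < 0, γ =ᶠ[𝓝 s] fun _ => x 0 := by
    intro s hs
    filter_upwards [isOpen_Iio.mem_nhds hs] with u hu
    simp only [hγ, if_pos (show u < 0 from hu)]
  have hnat : ∀ k : ℕ, γ =ᶠ[𝓝 (k : ℝ)] fun _ => x k := by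
    intro k
    have hright : ∀ᶠ u : ℝ in 𝓝 (k : ℝ), (k : ℝ) ≤ u → γ u = x k := by
      filter_upwards [hc0 k, isOpen_Iio.mem_nhds (show (k:ℝ) < k + 1 by linarith)] with u hu hu1 hu2
      have hu0 : (0:ℝ) ≤ u := (Nat.cast_nonneg k).trans hu2
      have : ⌊u⌋₊ = k := (Nat.floor_eq_iff hu0).2 ⟨hu2, hu1⟩
      simp only [hγ, if_neg (not_lt.2 hu0), this, hu]
    have hleft : ∀ᶠ u : ℝ in 𝓝 (k : ℝ), u < k → γ u = x k := by
      rcases k with _ | k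
      · refine Eventually.of_forall fun u hu => ?_
        have : u < 0 := by simpa using hu
        simp only [hγ, if_pos this]
      · have h1 := hc1 k
        rw [← Nat.cast_succ] at h1
        filter_upwards [h1, isOpen_Ioi.mem_nhds (show (k:ℝ) < (k + 1 : ℕ) by push_cast; linarith)]
          with u hu hu1 hu2
        have hu0 : (0:ℝ) ≤ u := (Nat.cast_nonneg k).trans (le_of_lt hu1)
        have : ⌊u⌋₊ = k := (Nat.floor_eq_iff hu0).2 ⟨le_of_lt hu1, by push_cast at hu2; exact hu2⟩
        simp only [hγ, if_neg (not_lt.2 hu0), this, hu]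
    filter_upwards [hright, hleft] with u h1 h2
    rcases lt_or_ge u k with h3 | h3
    exacts [h2 h3, h1 h3]
  refine ⟨γ, hneg, fun k s hs => ?_⟩
  rcases eq_or_lt_of_le hs.1 with h1 | h1
  · rw [← h1]
    exact (hnat k).trans (hc0 k).symm
  rcases eq_or_lt_of_le hs.2 with h2 | h2
  · rw [h2]
    have := hnat (k + 1)
    rw [Nat.cast_succ] at this
    exact this.trans (hc1 k).symm
  · exact hIoo k s ⟨h1, h2⟩

/-- In a globally hyperbolic ultrastatic spacetime, a curve of finite length has an endpoint. -/
theorem exists_tendsto_of_bounded_length (hgh : IsGloballyHyperbolicUltrastatic h) {γ : ℝ → S}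
    (hγ : ContMDiff 𝓘(ℝ, ℝ) (𝓡 n) 1 γ) (hneg : ∀ s < 0, speed h γ s = 0) {L : ℝ}
    (hL : ∀ s, ∫ u in (0:ℝ)..s, speed h γ u ≤ L) : ∃ p, Tendsto γ atTop (𝓝 p) := by
  have hc := continuous_speed h hγ
  -- The time function of the lift (τ, γ). The extra term has positive derivative, which makes the
  -- lift timelike; it stays below 1, so that τ is bounded by L + 1; and it tends to -∞ in the past,
  -- where γ does not move, so that there is no past endpoint.
  set τ : ℝ → ℝ := fun s => (∫ u in (0:ℝ)..s, speed h γ u) + (1 - Real.exp (-s)) with hτ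
  have hτd : ∀ s, HasDerivAt τ (speed h γ s + Real.exp (-s)) s := by
    intro s
    have h1 := intervalIntegral.integral_hasDerivAt_right
      (hc.intervalIntegrable 0 s)
      (hc.stronglyMeasurableAtFilter _ _) hc.continuousAt
    have h2 : HasDerivAt (fun s : ℝ => 1 - Real.exp (-s)) (Real.exp (-s)) s := by
      have := ((hasDerivAt_neg s).exp).const_sub 1
      simpa using this
    exact h1.add h2
  have hτC : ContDiff ℝ 1 τ := by
    refine contDiff_one_iff_deriv.2 ⟨fun s => (hτd s).differentiableAt, ?_⟩
    rw [show deriv τ = fun s => speed h γ s + Real.exp (-s) from funext fun s => (hτd s).deriv]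
    exact hc.add (Real.continuous_exp.comp continuous_neg)
  set Γ : ℝ → ℝ × S := fun s => (τ s, γ s) with hΓ
  have hΓC : ContMDiff 𝓘(ℝ, ℝ) (𝓘(ℝ, ℝ).prod (𝓡 n)) 1 Γ := (contMDiff_iff_contDiff.2 hτC).prodMk hγ
  by_contra hno
  have hinext : IsInextensibleTimelike (ultrastaticMetric h) Γ := by
    refine ⟨hΓC, fun s => ?_, ?_, ?_⟩
    · unfold TimelikeAt
      rw [ultrastatic_velocity h hΓC]
      change -(deriv τ s ^ 2) + speed h γ s ^ 2 < 0
      rw [(hτd s).deriv]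
      have h1 := speed_nonneg h γ s
      have h2 := Real.exp_pos (-s)
      nlinarith
    · rintro ⟨p, hp⟩
      exact hno ⟨p.2, (continuous_snd.tendsto p).comp hp⟩
    · rintro ⟨p, hp⟩
      have h1 : Tendsto τ atBot (𝓝 p.1) := (continuous_fst.tendsto p).comp hp
      have h2 : Tendsto τ atBot atBot := by
        have h3 : ∀ s < 0, τ s = 1 - Real.exp (-s) := by
          intro s hs
          have : ∫ u in (0:ℝ)..s, speed h γ u = 0 := by
            rw [intervalIntegral.integral_symm, neg_eq_zero]
            refine intervalIntegral.integral_zero_ae ?_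
            have : ∀ᵐ u : ℝ, u ≠ 0 := by simp [ae_iff]
            filter_upwards [this] with u hu0 hu
            rw [Set.uIoc_of_le hs.le] at hu
            exact hneg u (lt_of_le_of_ne hu.2 hu0)
          simp only [hτ, this, zero_add]
        have h4 : Tendsto (fun s : ℝ => 1 - Real.exp (-s)) atBot atBot :=
          tendsto_atBot_add_const_left _ _ (tendsto_neg_atTop_atBot.comp
            (Real.tendsto_exp_atTop.comp tendsto_neg_atBot_atTop))
        refine h4.congr' ?_
        filter_upwards [eventually_lt_atBot 0] with s hs
        exact (h3 s hs).symm
      exact not_tendsto_nhds_of_tendsto_atBot h2 _ h1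
  -- A slice beyond the reach of the lift: τ < L + 1 always.
  obtain ⟨s, hs, -⟩ := (hgh (L + 2)).2 Γ hinext
  have h1 : τ s = L + 2 := hs
  have h2 := hL s
  have h3 := Real.exp_pos (-s)
  simp only [hτ] at h1
  linarith

/-- Join consecutive points by curves of length below 2⁻ᵏ and concatenate. The resulting curve has
length at most 2, hence an endpoint, and it passes through every member of the sequence. -/
theorem exists_tendsto_of_riemEDist_lt (hgh : IsGloballyHyperbolicUltrastatic h) {x : ℕ → S}
    (hx : ∀ k, riemEDist h (x k) (x (k + 1)) < ENNReal.ofReal ((1 / 2) ^ k)) :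
    ∃ p, Tendsto x atTop (𝓝 p) := by
  choose c hcC hcL hc0 hc1 using fun k : ℕ =>
    exists_curve_of_riemEDist_lt h (hx k) (show (k : ℝ) < k + 1 by linarith)
  obtain ⟨γ, hγneg, hγ⟩ := exists_concatenation hc0 hc1
  have hcover : ∀ s : ℝ, 0 ≤ s → s ∈ Set.Icc (⌊s⌋₊ : ℝ) (⌊s⌋₊ + 1) := fun s hs =>
    ⟨Nat.floor_le hs, (Nat.lt_floor_add_one s).le⟩
  have hγC : ContMDiff 𝓘(ℝ, ℝ) (𝓡 n) 1 γ := by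
    intro s
    rcases lt_or_ge s 0 with hs | hs
    · exact (contMDiffAt_const (c := x 0)).congr_of_eventuallyEq (hγneg s hs)
    · exact (hcC ⌊s⌋₊ s).congr_of_eventuallyEq (hγ _ s (hcover s hs))
  have hneg : ∀ s < 0, speed h γ s = 0 := by
    intro s hs
    rw [speed_congr h (hγneg s hs)]
    have h1 := speed_sq h (fun _ : ℝ => x 0) s
    have h2 : ∀ v : EuclideanSpace ℝ (Fin n), v = 0 → metricVal (spatialMetric h) (x 0) v v = 0 := by
      rintro v rfl
      simp
    rw [show h.inner (x 0) _ _ = 0 from h2 _ (velocity_const (x 0) s)] at h1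
    exact pow_eq_zero_iff two_ne_zero |>.1 h1
  have hc := continuous_speed h hγC
  have hpiece : ∀ k : ℕ, ∫ u in (k : ℝ)..(k + 1 : ℕ), speed h γ u ≤ (1 / 2) ^ k := by
    intro k
    have hk : (k : ℝ) ≤ (k + 1 : ℕ) := by push_cast; linarith
    have h1 : ∫⁻ s in Set.Icc (k : ℝ) (k + 1), ENNReal.ofReal (speed h γ s) <
        ENNReal.ofReal ((1 / 2) ^ k) := by
      refine lt_of_eq_of_lt (setLIntegral_congr_fun measurableSet_Icc fun s hs => ?_) (hcL k)
      rw [speed_congr h (hγ k s hs)]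
    rw [intervalIntegral.integral_of_le hk, ← integral_Icc_eq_integral_Ioc]
    push_cast
    rw [← ofReal_integral_eq_lintegral_ofReal hc.continuousOn.integrableOn_Icc
      (Eventually.of_forall (speed_nonneg h γ))] at h1
    exact ((ENNReal.ofReal_lt_ofReal_iff (by positivity)).1 h1).le
  have hnat : ∀ k : ℕ, ∫ u in (0:ℝ)..k, speed h γ u ≤ 2 := by
    intro k
    have h1 := intervalIntegral.sum_integral_adjacent_intervals (f := speed h γ) (μ := volume)
      (a := fun k : ℕ => (k : ℝ)) (n := k) fun i _ => hc.intervalIntegrable _ _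
    rw [Nat.cast_zero] at h1
    rw [← h1]
    refine (Finset.sum_le_sum fun i _ => hpiece i).trans ?_
    exact (summable_geometric_two.sum_le_tsum _ fun i _ => by positivity).trans tsum_geometric_two.le
  obtain ⟨p, hp⟩ := exists_tendsto_of_bounded_length h hgh hγC hneg (L := 2) fun s => by
    rcases lt_or_ge s 0 with hs | hs
    · rw [intervalIntegral.integral_symm]
      have := intervalIntegral.integral_nonneg (μ := volume) hs.le fun u _ => speed_nonneg h γ u
      linarith
    · obtain ⟨k, hk⟩ := exists_nat_ge s
      refine le_trans ?_ (hnat k)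
      exact intervalIntegral.integral_mono_interval le_rfl hs hk
        (Eventually.of_forall (speed_nonneg h γ)) (hc.intervalIntegrable _ _)
  refine ⟨p, (hp.comp tendsto_natCast_atTop_atTop).congr fun k => ?_⟩
  have h1 := (hγ k k ⟨le_rfl, by linarith⟩).eq_of_nhds
  exact h1.trans (hc0 k).eq_of_nhds

end Completeness


/-! ### Compact balls, causal curves and comparison with a frozen metric. -/

section Balls

variable {n : ℕ} {S : Type*} [TopologicalSpace S] [ChartedSpace (EuclideanSpace ℝ (Fin n)) S]
  [IsManifold (𝓡 n) ∞ S] [T2Space S] (h : SmoothMetric n S)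

/-- The Riemannian distance of `h`, inducing the given topology. -/
@[reducible] noncomputable def riemEMetricSpace : EMetricSpace S :=
  letI : Bundle.RiemannianBundle (fun x : S => TangentSpace (𝓡 n) x) := ⟨h.toRiemannianMetric⟩
  haveI : IsContinuousRiemannianBundle (EuclideanSpace ℝ (Fin n))
      (fun x : S => TangentSpace (𝓡 n) x) := ⟨⟨h.inner, h.contMDiff.continuous, fun _ _ _ => rfl⟩⟩
  haveI : LocallyCompactSpace S := Manifold.locallyCompact_of_finiteDimensional (𝓡 n)
  haveI : IsManifold (𝓡 n) 1 S := IsManifold.of_le (n := ∞) (by simp)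
  EMetricSpace.ofRiemannianMetric (𝓡 n) S

theorem riemEDist_comm (x y : S) : riemEDist h x y = riemEDist h y x :=
  letI := riemEMetricSpace h
  edist_comm x y

theorem riemEDist_triangle (x y z : S) : riemEDist h x z ≤ riemEDist h x y + riemEDist h y z :=
  letI := riemEMetricSpace h
  edist_triangle x y z

theorem isOpen_riemBall (x : S) (r : ENNReal) : IsOpen {y | riemEDist h y x < r} :=
  letI := riemEMetricSpace h
  Metric.isOpen_eball (x := x) (ε := r)

theorem continuous_riemEDist (x : S) : Continuous fun y => riemEDist h x y :=
  letI := riemEMetricSpace h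
  continuous_const.edist continuous_id

theorem completeSpace_riemEMetricSpace (hgh : IsGloballyHyperbolicUltrastatic h) :
    letI := riemEMetricSpace h
    CompleteSpace S := by
  let := riemEMetricSpace h
  refine EMetric.complete_of_convergent_controlled_sequences
    (fun k => ENNReal.ofReal ((1 / 2) ^ k)) (fun k => by simp) fun u hu => ?_
  exact exists_tendsto_of_riemEDist_lt h hgh fun k => hu k k (k + 1) le_rfl (Nat.le_succ k)

theorem isCompact_riemEDist_le (hgh : IsGloballyHyperbolicUltrastatic h) (p : S) (R : NNReal) :
    IsCompact {x | riemEDist h x p ≤ R} := by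
  let := riemEMetricSpace h
  have := completeSpace_riemEMetricSpace h hgh
  have : LocallyCompactSpace S := Manifold.locallyCompact_of_finiteDimensional (𝓡 n)
  exact isCompact_closedEBall_of_length (fun x y r s hr hs hd => exists_riemEDist_lt h hr hs hd) p R

variable [ConnectedSpace S]

/-- The points at finite distance from x form a clopen set, and the manifold is connected. -/
theorem riemEDist_ne_top (x y : S) : riemEDist h x y ≠ ⊤ := by
  have hclopen : IsClopen {y : S | riemEDist h y x < ⊤} := by
    refine ⟨⟨?_⟩, isOpen_riemBall h x ⊤⟩
    rw [isOpen_iff_mem_nhds]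
    intro z hz
    filter_upwards [(isOpen_riemBall h z ⊤).mem_nhds (show riemEDist h z z < ⊤ by
      let := riemEMetricSpace h
      exact (edist_self z).trans_lt ENNReal.zero_lt_top)] with w hw hwx
    exact hz ((riemEDist_triangle h z w x).trans_lt
      (ENNReal.add_lt_top.2 ⟨by rwa [riemEDist_comm], hwx⟩))
  have huniv := hclopen.eq_univ ⟨x, show riemEDist h x x < ⊤ by
    let := riemEMetricSpace h
    exact (edist_self x).trans_lt ENNReal.zero_lt_top⟩
  have : y ∈ {y : S | riemEDist h y x < ⊤} := by rw [huniv]; trivial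
  rw [riemEDist_comm]
  exact ne_of_lt this

/-- The Riemannian distance of `h`, as a real number. -/
noncomputable def riemDist (x y : S) : ℝ := (riemEDist h x y).toReal

omit [ConnectedSpace S] in
theorem riemDist_self (x : S) : riemDist h x x = 0 := by
  have : riemEDist h x x = 0 := by
    let := riemEMetricSpace h
    exact edist_self x
  rw [riemDist, this, ENNReal.toReal_zero]

omit [ConnectedSpace S] in
theorem riemDist_comm (x y : S) : riemDist h x y = riemDist h y x := by
  rw [riemDist, riemEDist_comm, riemDist]

theorem riemDist_triangle (x y z : S) : riemDist h x z ≤ riemDist h x y + riemDist h y z := by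
  unfold riemDist
  rw [← ENNReal.toReal_add (riemEDist_ne_top h _ _) (riemEDist_ne_top h _ _)]
  exact ENNReal.toReal_mono (ENNReal.add_ne_top.2 ⟨riemEDist_ne_top h _ _, riemEDist_ne_top h _ _⟩)
    (riemEDist_triangle h x y z)

theorem continuous_riemDist (x : S) : Continuous fun y => riemDist h x y :=
  ENNReal.continuousOn_toReal.comp_continuous (continuous_riemEDist h x)
    fun y => riemEDist_ne_top h x y

/-- Hopf–Rinow: the closed balls of `h` are compact. -/
theorem isCompact_riemDist_le (hgh : IsGloballyHyperbolicUltrastatic h) (p : S) (R : ℝ) :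
    IsCompact {x | riemDist h p x ≤ R} := by
  refine IsCompact.of_isClosed_subset (isCompact_riemEDist_le h hgh p R.toNNReal)
    (isClosed_le (continuous_riemDist h p) continuous_const) fun x hx => ?_
  have h1 : riemEDist h x p = ENNReal.ofReal (riemDist h x p) :=
    (ENNReal.ofReal_toReal (riemEDist_ne_top h _ _)).symm
  change riemEDist h x p ≤ _
  rw [h1, riemDist_comm]
  exact ENNReal.ofReal_le_ofReal hx

omit [T2Space S] [ConnectedSpace S] in
theorem riemDist_le_of_speed_le {γ : ℝ → S} {a b : ℝ}
    (hγ : ContMDiffOn 𝓘(ℝ, ℝ) (𝓡 n) 1 γ (Set.Icc a b)) (hab : a ≤ b) {f : ℝ → ℝ} (hf : Continuous f)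
    (hs : ∀ s ∈ Set.Ioo a b, speed h γ s ≤ f s) (hf0 : ∀ s ∈ Set.Icc a b, 0 ≤ f s) :
    riemDist h (γ a) (γ b) ≤ ∫ s in a..b, f s := by
  refine ENNReal.toReal_le_of_le_ofReal (intervalIntegral.integral_nonneg hab hf0) ?_
  refine (riemEDist_le_lintegral_speed h hγ hab).trans ?_
  rw [intervalIntegral.integral_of_le hab, integral_Ioc_eq_integral_Ioo,
    ofReal_integral_eq_lintegral_ofReal
      (hf.continuousOn.integrableOn_Icc.mono_set Set.Ioo_subset_Icc_self)
      ((ae_restrict_iff' measurableSet_Ioo).2 (Eventually.of_forall fun s hs => hf0 s ⟨hs.1.le, hs.2.le⟩)),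
    ← restrict_Ioo_eq_restrict_Icc]
  exact setLIntegral_mono' measurableSet_Ioo fun s hs' => ENNReal.ofReal_le_ofReal (hs s hs')

/-! ### Causal curves -/

omit [T2Space S] [ConnectedSpace S] in
-- Causality bounds the spatial speed by |dt/ds|. The integral of this bound is the elapsed time,
-- because dt/ds cannot change sign along a causal curve of either time direction.
theorem riemDist_le_of_causal {γ : ℝ → ℝ × S} {a b : ℝ} (hab : a < b)
    (hγ : ContMDiff 𝓘(ℝ, ℝ) (𝓘(ℝ, ℝ).prod (𝓡 n)) 1 γ)
    (hc : ∀ s ∈ Set.Icc a b, CausalAt (ultrastaticMetric h) γ s) :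
    riemDist h (γ a).2 (γ b).2 ≤ |(γ b).1 - (γ a).1| := by
  set τ : ℝ → ℝ := fun s => (γ s).1 with hτ
  have hτC : ContDiff ℝ 1 τ := contMDiff_iff_contDiff.1 (contMDiff_fst.comp hγ)
  have hx : ContMDiff 𝓘(ℝ, ℝ) (𝓡 n) 1 (fun s => (γ s).2) := contMDiff_snd.comp hγ
  have hd : Continuous (deriv τ) := hτC.continuous_deriv le_rfl
  have hle : ∀ s ∈ Set.Icc a b, speed h (fun s => (γ s).2) s ≤ |deriv τ s| := by
    intro s hs
    have h1 := (hc s hs).2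
    rw [ultrastatic_velocity h hγ] at h1
    refine abs_le_of_sq_le_sq' ?_ (abs_nonneg _) |>.2
    rw [sq_abs]
    linarith
  -- A zero of dt/ds forces the spatial speed to vanish too, whereas a causal velocity is nonzero.
  have hne : ∀ s ∈ Set.Icc a b, deriv τ s ≠ 0 := by
    intro s hs h0
    refine (hc s hs).1 ?_
    have h1 := velocity_prod hγ s
    have h2 : speed h (fun s => (γ s).2) s = 0 := by
      have := hle s hs
      rw [h0, abs_zero] at this
      exact le_antisymm this (speed_nonneg _ _ _)
    have h3 : velocity (I := 𝓡 n) (fun s => (γ s).2) s = 0 := by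
      by_contra h4
      have h5 := h.pos _ _ h4
      have h6 := speed_sq h (fun s => (γ s).2) s
      rw [h2] at h6
      rw [← h6] at h5
      norm_num at h5
    exact h1.trans (Prod.ext h0 h3)
  refine (riemDist_le_of_speed_le h hx.contMDiffOn hab.le hd.abs
    (fun s hs => hle s ⟨hs.1.le, hs.2.le⟩) fun s _ => abs_nonneg _).trans (le_of_eq ?_)
  have hftc : ∫ s in a..b, deriv τ s = τ b - τ a :=
    intervalIntegral.integral_deriv_eq_sub (fun s _ => (hτC.differentiable one_ne_zero) s)
      (hd.intervalIntegrable a b)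
  change _ = |τ b - τ a|
  -- A continuous derivative without zeros has constant sign on the interval, so the absolute value
  -- comes out of the integral.
  rcases (isPreconnected_Icc (a := a) (b := b)).image (deriv τ) hd.continuousOn |>.ordConnected with ⟨hoc⟩
  rcases lt_or_gt_of_ne (hne a ⟨le_rfl, hab.le⟩) with ha | ha
  · have hneg : ∀ s ∈ Set.Icc a b, deriv τ s < 0 := by
      intro s hs
      by_contra h1
      obtain ⟨u, hu, hu0⟩ := hoc (Set.mem_image_of_mem _ ⟨le_rfl, hab.le⟩) (Set.mem_image_of_mem _ hs)
        (show (0:ℝ) ∈ _ from ⟨ha.le, not_lt.1 h1⟩)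
      exact hne u hu hu0
    have h1 : ∫ s in a..b, |deriv τ s| = ∫ s in a..b, -deriv τ s :=
      intervalIntegral.integral_congr fun s hs => by
        rw [Set.uIcc_of_le hab.le] at hs
        exact abs_of_neg (hneg s hs)
    have h0 : 0 ≤ ∫ s in a..b, |deriv τ s| := intervalIntegral.integral_nonneg hab.le fun _ _ => abs_nonneg _
    rw [h1, intervalIntegral.integral_neg, hftc] at *
    rw [abs_of_nonpos (by linarith)]
  · have hpos : ∀ s ∈ Set.Icc a b, 0 < deriv τ s := by
      intro s hs
      by_contra h1
      obtain ⟨u, hu, hu0⟩ := hoc (Set.mem_image_of_mem _ hs) (Set.mem_image_of_mem _ ⟨le_rfl, hab.le⟩)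
        (show (0:ℝ) ∈ _ from ⟨not_lt.1 h1, ha.le⟩)
      exact hne u hu hu0
    have h1 : ∫ s in a..b, |deriv τ s| = ∫ s in a..b, deriv τ s :=
      intervalIntegral.integral_congr fun s hs => by
        rw [Set.uIcc_of_le hab.le] at hs
        exact abs_of_pos (hpos s hs)
    have h0 : 0 ≤ ∫ s in a..b, |deriv τ s| := intervalIntegral.integral_nonneg hab.le fun _ _ => abs_nonneg _
    rw [h1, hftc] at *
    rw [abs_of_nonneg (by linarith)]

omit [ConnectedSpace S] in
theorem exists_riemDist_le_of_mem_causalHull {K : Set (ℝ × S)} {q : ℝ × S}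
    (hq : q ∈ causalHull (ultrastaticMetric h) K) :
    ∃ k ∈ K, riemDist h k.2 q.2 ≤ |q.1 - k.1| := by
  rcases hq with hq | ⟨γ, a, b, hab, hγ, hc, ha, rfl⟩
  · exact ⟨q, hq, by rw [riemDist_self]; simp⟩
  · exact ⟨γ a, ha, riemDist_le_of_causal h hab hγ hc⟩

/-- Sections of spacelike compact form are compactly supported. -/
theorem isCompact_tsupport_of_isSpacelikeCompact (hgh : IsGloballyHyperbolicUltrastatic h) {k : ℕ}
    {A : DiffForm (𝓘(ℝ, ℝ).prod (𝓡 n)) (ℝ × S) k}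
    (hA : IsSpacelikeCompact (ultrastaticMetric h) A) (t : ℝ) {G : Type*} [Zero G] {f : S → G}
    (hf : ∀ x, f x ≠ 0 → A (t, x) ≠ 0) : HasCompactSupport f := by
  obtain ⟨K, hK, hAK⟩ := hA
  obtain ⟨p⟩ : Nonempty S := inferInstance
  -- By the causal estimate each point of the section lies within d(p, k) + |t - k⁰| of p for some k
  -- in K. This is bounded on K, so the section lies in a closed ball, which is compact.
  have hb := hK.bddAbove_image (f := fun k : ℝ × S => riemDist h p k.2 + |t - k.1|)
    (((continuous_riemDist h p).comp continuous_snd).add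
      (continuous_const.sub continuous_fst).abs).continuousOn
  obtain ⟨R, hR⟩ := hb
  refine HasCompactSupport.intro (isCompact_riemDist_le h hgh p R) fun x hx => ?_
  by_contra h0
  refine hx ?_
  obtain ⟨k, hk, hkd⟩ := exists_riemDist_le_of_mem_causalHull h
    (hAK (subset_closure (hf x h0) : (t, x) ∈ formSupport A))
  have h1 := hR (Set.mem_image_of_mem _ hk)
  simp only at h1 hkd
  exact (riemDist_triangle h p k.2 x).trans ((add_le_add le_rfl hkd).trans h1)

/-! ### Comparison with the metric at a point -/

omit [T2Space S] [ConnectedSpace S] in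
/-- Near `z`, the metric in the chart around `z` is comparable with its value at `z`. -/
theorem eventually_chartBilin_comparable (z : S) :
    ∀ᶠ y in 𝓝 (extChartAt (𝓡 n) z z), ∀ v : Euc n,
      chartBilin (spatialMetric h) z y v v ≤
        4 * chartBilin (spatialMetric h) z (extChartAt (𝓡 n) z z) v v ∧
      chartBilin (spatialMetric h) z (extChartAt (𝓡 n) z z) v v ≤
        4 * chartBilin (spatialMetric h) z y v v := by
  set y0 := extChartAt (𝓡 n) z z with hy0
  set T := (extChartAt (𝓡 n) z).target
  have hTo : IsOpen T := isOpen_chartTarget z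
  have hy0T : y0 ∈ T := mem_extChartAt_target z
  have hexp : ∀ y v, chartBilin (spatialMetric h) z y v v =
      ∑ i, ∑ j, v i * v j * chartBilin (spatialMetric h) z y
        (EuclideanSpace.basisFun (Fin n) ℝ i) (EuclideanSpace.basisFun (Fin n) ℝ j) := by
    intro y v
    have hv : v = ∑ i, v i • (EuclideanSpace.basisFun (Fin n) ℝ i) := by
      conv_lhs => rw [← (EuclideanSpace.basisFun (Fin n) ℝ).sum_repr v]
      rfl
    conv_lhs => rw [hv]
    simp only [map_sum, LinearMap.sum_apply, map_smul, LinearMap.smul_apply, smul_eq_mul]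
    simp only [Finset.mul_sum]
    rw [Finset.sum_comm]
    exact Finset.sum_congr rfl fun i _ => Finset.sum_congr rfl fun j _ => by ring
  have hcont : ContinuousOn (fun q : Euc n × Euc n => chartBilin (spatialMetric h) z q.1 q.2 q.2)
      (T ×ˢ Set.univ) := by
    simp only [hexp]
    refine continuousOn_finsetSum _ fun i _ => continuousOn_finsetSum _ fun j _ => ContinuousOn.mul ?_ ?_
    · exact ((PiLp.continuous_apply 2 _ i).comp continuous_snd |>.mul
        ((PiLp.continuous_apply 2 _ j).comp continuous_snd)).continuousOn
    · exact (continuousOn_chartBilin h z _ _).comp continuousOn_fst fun q hq => hq.1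
  -- By homogeneity it suffices to compare on the compact unit sphere, where continuity gives a
  -- uniform neighbourhood. Any constant above 1 would do; 4 makes the comparison of lengths a
  -- factor 2.
  have hsph : ∀ᶠ y in 𝓝 y0, ∀ v ∈ Metric.sphere (0 : Euc n) 1,
      chartBilin (spatialMetric h) z y v v < 4 * chartBilin (spatialMetric h) z y0 v v ∧
      chartBilin (spatialMetric h) z y0 v v < 4 * chartBilin (spatialMetric h) z y v v := by
    refine (isCompact_sphere (0 : Euc n) 1).eventually_forall_of_forall_eventually fun v hv => ?_
    have hv0 : v ≠ 0 := by
      rintro rfl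
      simp at hv
    have hpos := chartBilin_pos h hy0T hv0
    have hc1 : ContinuousAt (fun q : Euc n × Euc n => chartBilin (spatialMetric h) z q.1 q.2 q.2)
        (y0, v) := hcont.continuousAt ((hTo.prod isOpen_univ).mem_nhds ⟨hy0T, trivial⟩)
    have hc2 : ContinuousAt (fun q : Euc n × Euc n => chartBilin (spatialMetric h) z y0 q.2 q.2)
        (y0, v) := ContinuousAt.comp
          (g := fun q : Euc n × Euc n => chartBilin (spatialMetric h) z q.1 q.2 q.2)
          (f := fun q : Euc n × Euc n => (y0, q.2)) (x := (y0, v)) hc1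
          (continuousAt_const.prodMk continuousAt_snd)
    exact (hc1.eventually_lt (hc2.const_mul 4) (by simp only; linarith)).and
      (hc2.eventually_lt (hc1.const_mul 4) (by simp only; linarith))
  filter_upwards [hsph] with y hy v
  rcases eq_or_ne v 0 with rfl | hv
  · simp
  have hv' : ‖v‖ ≠ 0 := norm_ne_zero_iff.2 hv
  have h1 := hy (‖v‖⁻¹ • v) (by simp [norm_smul, hv'])
  simp only [map_smul, LinearMap.smul_apply, smul_eq_mul] at h1
  have h2 : 0 < ‖v‖⁻¹ * ‖v‖⁻¹ := by positivity
  constructor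
  · refine le_of_mul_le_mul_left ?_ h2
    linarith [h1.1]
  · refine le_of_mul_le_mul_left ?_ h2
    linarith [h1.2]

omit [T2Space S] [ConnectedSpace S] in
/-- The distance to `z` is controlled by the norm of `h z` in the chart around `z`. -/
theorem riemDist_chart_le (z : S) {r : ℝ}
    (hT : ∀ y : Euc n, chartBilin (spatialMetric h) z (extChartAt (𝓡 n) z z)
      (y - extChartAt (𝓡 n) z z) (y - extChartAt (𝓡 n) z z) ≤ r → y ∈ (extChartAt (𝓡 n) z).target ∧
      ∀ v, chartBilin (spatialMetric h) z y v v ≤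
        4 * chartBilin (spatialMetric h) z (extChartAt (𝓡 n) z z) v v)
    {y : Euc n} (hy : chartBilin (spatialMetric h) z (extChartAt (𝓡 n) z z)
      (y - extChartAt (𝓡 n) z z) (y - extChartAt (𝓡 n) z z) ≤ r) :
    riemDist h z ((extChartAt (𝓡 n) z).symm y) ≤
      2 * Real.sqrt (chartBilin (spatialMetric h) z (extChartAt (𝓡 n) z z)
        (y - extChartAt (𝓡 n) z z) (y - extChartAt (𝓡 n) z z)) := by
  set y0 := extChartAt (𝓡 n) z z with hy0
  set B := chartBilin (spatialMetric h) z y0 with hB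
  set v := y - y0 with hv
  set φ := extChartAt (𝓡 n) z
  have hBv : 0 ≤ B v v := by
    rcases eq_or_ne v 0 with h0 | h0
    · rw [h0]; simp
    · exact (chartBilin_pos h (mem_extChartAt_target z) h0).le
  -- The straight coordinate segment. It stays in the region of comparability because the frozen
  -- quadratic form scales by s² ≤ 1 along it.
  set c : ℝ → Euc n := fun s => y0 + s • v with hc
  have hcT : ∀ s ∈ Set.Icc (0:ℝ) 1, B (c s - y0) (c s - y0) ≤ r := by
    intro s hs
    have : c s - y0 = s • v := by simp [hc]
    rw [this]
    simp only [map_smul, LinearMap.smul_apply, smul_eq_mul]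
    have : s * (s * B v v) ≤ B v v := by
      have h1 : s * s ≤ 1 := by nlinarith [hs.1, hs.2]
      nlinarith
    exact this.trans hy
  have hcd : ∀ s, HasDerivAt c v s := fun s => by
    have := ((hasDerivAt_id s).smul_const v).const_add y0
    rwa [one_smul] at this
  have hcC : ContDiff ℝ 1 c := contDiff_const.add (contDiff_id.smul contDiff_const)
  have hγ : ContMDiffOn 𝓘(ℝ, ℝ) (𝓡 n) 1 (φ.symm ∘ c) (Set.Icc 0 1) :=
    ((contMDiffOn_extChartAt_symm (I := 𝓡 n) (n := ∞) z).of_le (by simp)).comp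
      (contMDiff_iff_contDiff.2 hcC).contMDiffOn fun s hs => (hT _ (hcT s hs)).1
  have hsp : ∀ s ∈ Set.Icc (0:ℝ) 1, speed h (φ.symm ∘ c) s ≤ 2 * Real.sqrt (B v v) := by
    intro s hs
    have hs1 := hT _ (hcT s hs)
    have hmd : MDifferentiableAt 𝓘(ℝ, Euc n) (𝓡 n) φ.symm (c s) :=
      (mdifferentiableOn_extChartAt_symm (I := 𝓡 n) (x := z) (c s) hs1.1).mdifferentiableAt
        ((isOpen_chartTarget z).mem_nhds hs1.1)
    have h1 := mfderiv_comp s hmd ((hcd s).differentiableAt.mdifferentiableAt)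
    have h2 : (velocity (I := 𝓡 n) (φ.symm ∘ c) s : Euc n) = chartDeriv (𝓡 n) z (c s) v := by
      refine (congrArg (fun L : ℝ →L[ℝ] Euc n => L 1) h1).trans ?_
      change chartDeriv (𝓡 n) z (c s) ((mfderiv 𝓘(ℝ, ℝ) 𝓘(ℝ, Euc n) c s : ℝ →L[ℝ] Euc n) 1) = _
      rw [mfderiv_eq_fderiv]
      congr 1
      exact (hcd s).deriv
    have h3 : speed h (φ.symm ∘ c) s ^ 2 = chartBilin (spatialMetric h) z (c s) v v := by
      rw [speed_sq]
      change metricVal (spatialMetric h) (φ.symm (c s)) (velocity (I := 𝓡 n) (φ.symm ∘ c) s : Euc n)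
        (velocity (I := 𝓡 n) (φ.symm ∘ c) s : Euc n) = _
      rw [h2]
      rfl
    refine abs_le_of_sq_le_sq' ?_ (by positivity) |>.2
    rw [h3, mul_pow, Real.sq_sqrt hBv]
    norm_num
    exact hs1.2 v
  have := riemDist_le_of_speed_le h hγ zero_le_one (continuous_const (y := 2 * Real.sqrt (B v v)))
    (fun s hs => hsp s ⟨hs.1.le, hs.2.le⟩) fun _ _ => by positivity
  have e0 : (φ.symm ∘ c) 0 = z := by simp [hc, hy0, φ]
  have e1 : (φ.symm ∘ c) 1 = φ.symm y := by simp [hc, hv]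
  rw [e0, e1] at this
  simpa using this

end Balls


/-! ### Test functions and Hodge products depending on time. -/

section TestForms

variable {n : ℕ} {S : Type*} [TopologicalSpace S] [ChartedSpace (EuclideanSpace ℝ (Fin n)) S]

section

variable [IsManifold (𝓡 n) ∞ S] {f : S → ℂ} (hf : ContMDiff (𝓡 n) 𝓘(ℝ, ℂ) ∞ f)

include hf in
theorem extDer_zeroForm_eq_zero {x : S} (hx : x ∉ tsupport f) :
    formVal (extDer (zeroForm (𝓡 n) f)) x = 0 := by
  ext v
  obtain ⟨w, rfl⟩ : ∃ w, v = fun _ => w := ⟨v 0, by funext i; rw [Fin.fin_one_eq_zero i]⟩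
  have h1 : f =ᶠ[𝓝 x] fun _ => (0 : ℂ) := notMem_tsupport_iff_eventuallyEq.1 hx
  rw [extDer_zeroForm_apply hf, differential, h1.mfderiv_eq, mfderiv_const]
  rfl

include hf in
theorem extDer_zeroForm_smul (c : ℝ) (x : S) :
    formVal (extDer (zeroForm (𝓡 n) fun x => c • f x)) x =
      c • formVal (extDer (zeroForm (𝓡 n) f)) x := by
  have hcf : ContMDiff (𝓡 n) 𝓘(ℝ, ℂ) ∞ fun x => c • f x :=
    (contMDiff_const (I := 𝓡 n) (I' := 𝓘(ℝ, ℝ)) (c := c)).smul hf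
  ext v
  obtain ⟨w, rfl⟩ : ∃ w, v = fun _ => w := ⟨v 0, by funext i; rw [Fin.fin_one_eq_zero i]⟩
  rw [ContinuousAlternatingMap.smul_apply, extDer_zeroForm_apply hf, extDer_zeroForm_apply hcf]
  have h1 := const_smul_mfderiv (hf.mdifferentiableAt (x := x) (by simp)) c
  exact congrArg (fun L : Euc n →L[ℝ] ℂ => L w) h1

end

theorem tensorInner_smul_left {E ι : Type*} [NormedAddCommGroup E] [NormedSpace ℝ E] [Fintype ι]
    [DecidableEq ι] {k : ℕ} (B : LinearMap.BilinForm ℝ E) (b : ι → E) (c : ℝ)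
    (α β : E [⋀^Fin k]→L[ℝ] ℂ) : tensorInner B b (c • α) β = c • tensorInner B b α β := by
  simp only [tensorInner, ContinuousAlternatingMap.smul_apply, Complex.real_smul, map_mul,
    Complex.conj_ofReal, Finset.mul_sum]
  refine Finset.sum_congr rfl fun i _ => Finset.sum_congr rfl fun j _ => by ring

theorem tensorInner_zero_left {E ι : Type*} [NormedAddCommGroup E] [NormedSpace ℝ E] [Fintype ι]
    [DecidableEq ι] {k : ℕ} (B : LinearMap.BilinForm ℝ E) (b : ι → E)
    (β : E [⋀^Fin k]→L[ℝ] ℂ) : tensorInner B b 0 β = 0 := by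
  simp [tensorInner]

theorem hodgeInner_zero_right {E H M : Type*} [NormedAddCommGroup E] [NormedSpace ℝ E]
    [FiniteDimensional ℝ E] [TopologicalSpace H] {I : ModelWithCorners ℝ E H} [TopologicalSpace M]
    [ChartedSpace H M] [MeasurableSpace E] [BorelSpace E] [MeasurableSpace M] {k : ℕ}
    (g : BilinField I M) (α : DiffForm I M k) : hodgeInner g α 0 = 0 := by
  have h0 : ∀ x, formInner g α 0 x = 0 := fun x => by
    refine mul_eq_zero_of_right _ (Finset.sum_eq_zero fun i _ => Finset.sum_eq_zero fun j _ => ?_)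
    exact mul_eq_zero_of_right _ (mul_eq_zero_of_right _ rfl)
  simp [hodgeInner, h0]

variable [IsManifold (𝓡 n) ∞ S] (h : SmoothMetric n S)

theorem formInner_zeroForm (f u : S → ℂ) (x : S) :
    formInner (spatialMetric h) (zeroForm (𝓡 n) f) (zeroForm (𝓡 n) u) x =
      starRingEnd ℂ (f x) * u x := by
  rw [formInner_eq, tensorInner_zero_form]
  rfl

theorem formInner_zeroForm_eq_zero {f : S → ℂ} {x : S} (hx : x ∉ tsupport f)
    (β : DiffForm (𝓡 n) S 0) : formInner (spatialMetric h) (zeroForm (𝓡 n) f) β x = 0 := by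
  rw [formInner_eq, tensorInner_zero_form,
    show formVal (zeroForm (𝓡 n) f) x ![] = f x from rfl, image_eq_zero_of_notMem_tsupport hx]
  simp

/-- The differential of a function, as a `1`-form. -/
noncomputable def gradForm (n : ℕ) {S : Type*} [TopologicalSpace S]
    [ChartedSpace (EuclideanSpace ℝ (Fin n)) S] (f : S → ℂ) : DiffForm (𝓡 n) S 1 :=
  extDer (zeroForm (𝓡 n) f)

theorem formInner_gradForm_eq_zero {f : S → ℂ} (hf : ContMDiff (𝓡 n) 𝓘(ℝ, ℂ) ∞ f) {x : S}
    (hx : x ∉ tsupport f) (β : DiffForm (𝓡 n) S 1) :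
    formInner (spatialMetric h) (gradForm n f) β x = 0 := by
  rw [formInner_eq, show formVal (gradForm n f) x = 0 from extDer_zeroForm_eq_zero hf hx,
    tensorInner_zero_left]

theorem formInner_gradForm_smul {f : S → ℂ} (hf : ContMDiff (𝓡 n) 𝓘(ℝ, ℂ) ∞ f) (c : ℝ)
    (x : S) (β : DiffForm (𝓡 n) S 1) :
    formInner (spatialMetric h) (gradForm n fun x => c • f x) β x =
      c • formInner (spatialMetric h) (gradForm n f) β x := by
  rw [formInner_eq, show formVal (gradForm n fun x => c • f x) x = c • formVal (gradForm n f) x from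
    extDer_zeroForm_smul hf c x, tensorInner_smul_left, formInner_eq]

theorem isSmoothForm_gradForm {f : S → ℂ} (hf : ContMDiff (𝓡 n) 𝓘(ℝ, ℂ) ∞ f) :
    IsSmoothForm (gradForm n f) :=
  SmoothInTime.isSmoothForm (SmoothInTime.extDer (u := fun _ => f)
    (smoothInTime_const (isSmoothForm_zeroForm_iff.2 hf))) 0

/-- The time component as a family of `0`-forms. -/
noncomputable def timeZeroForm (A : DiffForm (𝓘(ℝ, ℝ).prod (𝓡 n)) (ℝ × S) 1) (t : ℝ) :
    DiffForm (𝓡 n) S 0 :=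
  zeroForm (𝓡 n) fun x => timeComponent A (t, x)

/-- The differential of the time component. -/
noncomputable def gradTime (A : DiffForm (𝓘(ℝ, ℝ).prod (𝓡 n)) (ℝ × S) 1) (t : ℝ) :
    DiffForm (𝓡 n) S 1 :=
  gradForm n fun x => timeComponent A (t, x)

theorem smoothInTime_timeZeroForm {A : DiffForm (𝓘(ℝ, ℝ).prod (𝓡 n)) (ℝ × S) 1}
    (hA : IsSmoothForm A) : SmoothInTime (timeZeroForm A) :=
  smoothInTime_timeComponent hA

theorem smoothInTime_gradTime {A : DiffForm (𝓘(ℝ, ℝ).prod (𝓡 n)) (ℝ × S) 1}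
    (hA : IsSmoothForm A) : SmoothInTime (gradTime A) :=
  (smoothInTime_timeComponent hA).extDer

theorem continuous_formInner_const {k : ℕ} {α : DiffForm (𝓡 n) S k} (hα : IsSmoothForm α)
    {C : ℝ → DiffForm (𝓡 n) S k} (hC : SmoothInTime C) :
    Continuous fun p : ℝ × S => formInner (spatialMetric h) α (C p.1) p.2 := by
  have hα' : SmoothInTime fun _ => α := smoothInTime_const hα
  generalize hB : (fun _ : ℝ => α) = B at hα'
  have h1 := continuous_formInner h hα' hC
  have h2 : ∀ t, B t = α := fun t => (congrFun hB t).symm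
  simpa only [h2] using h1

/-! ### Hodge products depending on time -/

variable [MeasurableSpace S] [BorelSpace S] [T2Space S] [SecondCountableTopology S] [Nonempty S]
  {k : ℕ} {K : Set S} (hK : IsCompact K) {α : DiffForm (𝓡 n) S k} (hα : IsSmoothForm α)
  (h0 : ∀ x ∉ K, ∀ β, formInner (spatialMetric h) α β x = 0) {C : ℝ → DiffForm (𝓡 n) S k}
  (hC : SmoothInTime C)

include hK hα h0 hC in
theorem integrable_formInner (t : ℝ) :
    Integrable (fun x => formInner (spatialMetric h) α (C t) x) (volumeMeasure (spatialMetric h)) := by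
  have : LocallyCompactSpace S := Manifold.locallyCompact_of_finiteDimensional (𝓡 n)
  have hc : Continuous fun x => formInner (spatialMetric h) α (C t) x :=
    Continuous.comp (g := fun p : ℝ × S => formInner (spatialMetric h) α (C p.1) p.2)
      (f := fun x => (t, x)) (continuous_formInner_const h hα hC) (Continuous.prodMk_right t)
  exact hc.integrable_of_hasCompactSupport (HasCompactSupport.intro hK fun x hx => h0 x hx (C t))

include hK hα h0 hC in
theorem hasDerivAt_hodgeInner (t : ℝ) :
    HasDerivAt (fun t => hodgeInner (spatialMetric h) α (C t))
      (hodgeInner (spatialMetric h) α (timeDeriv C t)) t := by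
  have h1 : ∀ β, hodgeInner (spatialMetric h) α β =
      ∫ x in K, formInner (spatialMetric h) α β x ∂(volumeMeasure (spatialMetric h)) := fun β =>
    (setIntegral_eq_integral_of_forall_compl_eq_zero fun x hx => h0 x hx β).symm
  simp only [h1]
  exact hasDerivAt_setIntegral_of_isCompact (μ := volumeMeasure (spatialMetric h))
    (F := fun t x => formInner (spatialMetric h) α (C t) x)
    (F' := fun t x => formInner (spatialMetric h) α (timeDeriv C t) x)
    hK hK.measure_lt_top isOpen_univ
    (continuous_formInner_const h hα hC).continuousOn
    (continuous_formInner_const h hα hC.timeDeriv).continuousOn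
    (fun t _ x _ => hasDerivAt_formInner h hC α t x) (Set.mem_univ t)

include hK hα h0 hC in
theorem continuous_hodgeInner : Continuous fun t => hodgeInner (spatialMetric h) α (C t) :=
  continuous_iff_continuousAt.2 fun t => (hasDerivAt_hodgeInner h hK hα h0 hC t).continuousAt

theorem hodgeInner_ultrastatic_eq {k : ℕ} {α β : DiffForm (𝓘(ℝ, ℝ).prod (𝓡 n)) (ℝ × S) k}
    (hc : Continuous fun p => formInner (ultrastaticMetric h) α β p)
    (hs : HasCompactSupport fun p => formInner (ultrastaticMetric h) α β p) :
    hodgeInner (ultrastaticMetric h) α β =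
      ∫ t, ∫ x, formInner (ultrastaticMetric h) α β (t, x) ∂(volumeMeasure (spatialMetric h)) := by
  have : LocallyCompactSpace S := Manifold.locallyCompact_of_finiteDimensional (𝓡 n)
  unfold hodgeInner
  rw [volumeMeasure_ultrastatic, integral_prod]
  exact hc.integrable_of_hasCompactSupport hs

end TestForms

/-! ### Gauss's law, the Lorenz identity and the weak wave equation on a slice. -/

section WeakEquations

variable {n : ℕ} {S : Type*} [TopologicalSpace S] [ChartedSpace (EuclideanSpace ℝ (Fin n)) S]
  [IsManifold (𝓡 n) ∞ S] (h : SmoothMetric n S)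
  [MeasurableSpace S] [BorelSpace S] [T2Space S] [SecondCountableTopology S] [Nonempty S]
  {A : DiffForm (𝓘(ℝ, ℝ).prod (𝓡 n)) (ℝ × S) 1} (hA : IsSmoothForm A)
  {f : S → ℂ} (hf : ContMDiff (𝓡 n) 𝓘(ℝ, ℂ) ∞ f) (hfc : HasCompactSupport f)

omit [MeasurableSpace S] [BorelSpace S] [T2Space S] [SecondCountableTopology S] [Nonempty S]
  [IsManifold (𝓡 n) ∞ S] in
include hf in
theorem contMDiff_smul_test {χ : ℝ → ℝ} (hχ : ContDiff ℝ ∞ χ) :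
    ContMDiff (𝓘(ℝ, ℝ).prod (𝓡 n)) 𝓘(ℝ, ℂ) ∞ fun p : ℝ × S => χ p.1 • f p.2 :=
  ((contMDiff_iff_contDiff.2 hχ).comp contMDiff_fst).smul (hf.comp contMDiff_snd)

omit [MeasurableSpace S] [BorelSpace S] [SecondCountableTopology S] [Nonempty S]
  [IsManifold (𝓡 n) ∞ S] [ChartedSpace (EuclideanSpace ℝ (Fin n)) S] in
include hfc in
theorem hasCompactSupport_smul_test {G : Type*} [Zero G] {χ : ℝ → ℝ} (hχ : HasCompactSupport χ)
    {F : ℝ × S → G} (hF : ∀ p : ℝ × S, p.1 ∉ tsupport χ ∨ p.2 ∉ tsupport f → F p = 0) :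
    HasCompactSupport F :=
  HasCompactSupport.intro (hχ.isCompact.prod hfc.isCompact) fun p hp => hF p (by
    rw [Set.mem_prod, not_and_or] at hp
    exact hp)

omit [MeasurableSpace S] [BorelSpace S] [T2Space S] [SecondCountableTopology S] [Nonempty S]
  [IsManifold (𝓡 n) ∞ S] in
theorem isCompact_formSupport_timeForm {w : ℝ × S → ℂ} (hw : HasCompactSupport w) :
    IsCompact (formSupport (timeForm n w)) := by
  refine hw.isCompact.of_isClosed_subset isClosed_closure (closure_mono fun p hp => ?_)
  intro hp0
  apply hp
  change formVal (timeForm n w) p = 0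
  ext v
  rw [timeForm_apply, hp0]
  simp

include hA hf hfc in
/-- Maxwell's equation, tested with `χ(t) f(x) dt`. -/
theorem hodgeInner_timeDeriv_spatialPart (hPA : IsMaxwellSolution (ultrastaticMetric h) A) (t : ℝ) :
    hodgeInner (spatialMetric h) (gradForm n f) (timeDeriv (spatialPart A) t) =
      hodgeInner (spatialMetric h) (gradForm n f) (gradTime A t) := by
  have hα := isSmoothForm_gradForm hf
  have hα0 : ∀ x ∉ tsupport f, ∀ β, formInner (spatialMetric h) (gradForm n f) β x = 0 :=
    fun x hx β => formInner_gradForm_eq_zero h hf hx β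
  have hC1 := (smoothInTime_spatialPart hA).timeDeriv
  have hC2 := smoothInTime_gradTime hA
  rw [← sub_eq_zero]
  have hF : Continuous fun t => hodgeInner (spatialMetric h) (gradForm n f) (timeDeriv (spatialPart A) t) -
      hodgeInner (spatialMetric h) (gradForm n f) (gradTime A t) :=
    (continuous_hodgeInner h hfc.isCompact hα hα0 hC1).sub
      (continuous_hodgeInner h hfc.isCompact hα hα0 hC2)
  -- The identity is continuous in t, so it holds at each time as soon as it holds integrated
  -- against every χ; this turns a spacetime equation into one on each slice.
  refine eq_zero_of_integral_smul_eq_zero hF (fun χ hχ hχc => ?_) t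
  have hw := contMDiff_smul_test hf hχ
  set α : DiffForm (𝓘(ℝ, ℝ).prod (𝓡 n)) (ℝ × S) 1 := timeForm n fun p : ℝ × S => χ p.1 • f p.2
    with hαdef
  have hform : ∀ p : ℝ × S, formInner (ultrastaticMetric h) (extDer α) (extDer A) p =
      χ p.1 • (formInner (spatialMetric h) (gradForm n f) (timeDeriv (spatialPart A) p.1) p.2 -
      formInner (spatialMetric h) (gradForm n f) (gradTime A p.1) p.2) := by
    intro p
    refine (formInner_ultrastatic_two h hA hw p).trans ?_
    refine (congrArg₂ (· - ·) (formInner_gradForm_smul h hf (χ p.1) p.2 _)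
      (formInner_gradForm_smul h hf (χ p.1) p.2 (gradTime A p.1))).trans ?_
    rw [smul_sub]
  have hz : hodgeInner (ultrastaticMetric h) (extDer α) (extDer A) = 0 := by
    rw [hPA _ (isSmoothForm_timeForm hw) (isCompact_formSupport_timeForm
      (hasCompactSupport_smul_test hfc hχc ?_)), hodgeInner_zero_right]
    rintro p (hp | hp)
    · simp [image_eq_zero_of_notMem_tsupport hp]
    · simp [image_eq_zero_of_notMem_tsupport hp]
  have hc : Continuous fun p => formInner (ultrastaticMetric h) (extDer α) (extDer A) p := by
    simp only [hform]
    exact (hχ.continuous.comp continuous_fst).smul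
      ((continuous_formInner_const h hα hC1).sub (continuous_formInner_const h hα hC2))
  have hs : HasCompactSupport fun p => formInner (ultrastaticMetric h) (extDer α) (extDer A) p := by
    simp only [hform]
    refine hasCompactSupport_smul_test hfc hχc ?_
    rintro p (hp | hp)
    · rw [image_eq_zero_of_notMem_tsupport hp, zero_smul]
    · rw [hα0 _ hp, hα0 _ hp, sub_zero, smul_zero]
  rw [hodgeInner_ultrastatic_eq h hc hs] at hz
  rw [← hz]
  refine integral_congr_ae (Filter.Eventually.of_forall fun s => ?_)
  simp only [hform]
  rw [integral_smul, integral_sub (integrable_formInner h hfc.isCompact hα hα0 hC1 s)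
    (integrable_formInner h hfc.isCompact hα hα0 hC2 s)]
  rfl

include hA hf hfc in
/-- The Lorenz gauge, tested with `χ(t) f(x)`. -/
theorem hodgeInner_timeDeriv_timeZeroForm (hL : LorenzGauge (ultrastaticMetric h) A) (t : ℝ) :
    hodgeInner (spatialMetric h) (zeroForm (𝓡 n) f) (timeDeriv (timeZeroForm A) t) +
      hodgeInner (spatialMetric h) (gradForm n f) (spatialPart A t) = 0 := by
  have hα := isSmoothForm_gradForm hf
  have hα0 : ∀ x ∉ tsupport f, ∀ β, formInner (spatialMetric h) (gradForm n f) β x = 0 :=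
    fun x hx β => formInner_gradForm_eq_zero h hf hx β
  have hβ : IsSmoothForm (zeroForm (𝓡 n) f) := isSmoothForm_zeroForm_iff.2 hf
  have hβ0 : ∀ x ∉ tsupport f, ∀ β, formInner (spatialMetric h) (zeroForm (𝓡 n) f) β x = 0 :=
    fun x hx β => formInner_zeroForm_eq_zero h hx β
  have hC1 := smoothInTime_spatialPart hA
  have hC2 := smoothInTime_timeZeroForm hA
  have hF1 := continuous_hodgeInner h hfc.isCompact hα hα0 hC1
  have hF2 := continuous_hodgeInner h hfc.isCompact hβ hβ0 hC2
  have hF3 := continuous_hodgeInner h hfc.isCompact hβ hβ0 hC2.timeDeriv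
  have hF : Continuous fun t =>
      hodgeInner (spatialMetric h) (zeroForm (𝓡 n) f) (timeDeriv (timeZeroForm A) t) +
      hodgeInner (spatialMetric h) (gradForm n f) (spatialPart A t) := hF3.add hF1
  refine eq_zero_of_integral_smul_eq_zero hF (fun χ hχ hχc => ?_) t
  have hw := contMDiff_smul_test hf hχ
  have hχ' : Continuous (deriv χ) := hχ.continuous_deriv (by simp)
  set α : DiffForm (𝓘(ℝ, ℝ).prod (𝓡 n)) (ℝ × S) 0 :=
    zeroForm (𝓘(ℝ, ℝ).prod (𝓡 n)) fun p : ℝ × S => χ p.1 • f p.2 with hαdef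
  have hform : ∀ p : ℝ × S, formInner (ultrastaticMetric h) (extDer α) A p =
      χ p.1 • formInner (spatialMetric h) (gradForm n f) (spatialPart A p.1) p.2 -
      deriv χ p.1 • formInner (spatialMetric h) (zeroForm (𝓡 n) f) (timeZeroForm A p.1) p.2 := by
    intro p
    refine (formInner_ultrastatic_one h hw p).trans ?_
    have h1 : deriv (fun s => χ s • f p.2) p.1 = deriv χ p.1 • f p.2 :=
      (((hχ.differentiable (by simp)) p.1).hasDerivAt.smul_const (f p.2)).deriv
    have h2 := formInner_gradForm_smul h hf (χ p.1) p.2 (spatialPart A p.1)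
    have h3 : formInner (spatialMetric h) (zeroForm (𝓡 n) f) (timeZeroForm A p.1) p.2 =
        starRingEnd ℂ (f p.2) * timeComponent A p := formInner_zeroForm h f _ p.2
    refine (congrArg₂ (· + ·) (congrArg Neg.neg (congrArg (fun c => starRingEnd ℂ c *
      timeComponent A p) h1)) h2).trans ?_
    rw [h3]
    simp only [Complex.real_smul, map_mul, Complex.conj_ofReal]
    ring
  have hz : hodgeInner (ultrastaticMetric h) (extDer α) A = 0 := by
    rw [hL _ (isSmoothForm_zeroForm_iff.2 hw) ?_, hodgeInner_zero_right]
    rw [formSupport_zeroForm]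
    refine (hasCompactSupport_smul_test hfc hχc ?_).isCompact
    rintro p (hp | hp)
    · simp [image_eq_zero_of_notMem_tsupport hp]
    · simp [image_eq_zero_of_notMem_tsupport hp]
  have hc : Continuous fun p => formInner (ultrastaticMetric h) (extDer α) A p := by
    simp only [hform]
    exact ((hχ.continuous.comp continuous_fst).smul (continuous_formInner_const h hα hC1)).sub
      ((hχ'.comp continuous_fst).smul (continuous_formInner_const h hβ hC2))
  have hs : HasCompactSupport fun p => formInner (ultrastaticMetric h) (extDer α) A p := by
    simp only [hform]
    refine hasCompactSupport_smul_test hfc hχc ?_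
    rintro p (hp | hp)
    · have h2 : p.1 ∉ tsupport (deriv χ) := fun h3 => hp (tsupport_deriv_subset (𝕜 := ℝ) h3)
      rw [image_eq_zero_of_notMem_tsupport hp, image_eq_zero_of_notMem_tsupport h2, zero_smul,
        zero_smul, sub_zero]
    · rw [hα0 _ hp, hβ0 _ hp, smul_zero, smul_zero, sub_zero]
  rw [hodgeInner_ultrastatic_eq h hc hs] at hz
  have h1 : ∀ s, ∫ x, formInner (ultrastaticMetric h) (extDer α) A (s, x)
        ∂(volumeMeasure (spatialMetric h)) =
      χ s • hodgeInner (spatialMetric h) (gradForm n f) (spatialPart A s) -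
      deriv χ s • hodgeInner (spatialMetric h) (zeroForm (𝓡 n) f) (timeZeroForm A s) := by
    intro s
    simp only [hform]
    refine (integral_sub ((integrable_formInner h hfc.isCompact hα hα0 hC1 s).smul (χ s))
      ((integrable_formInner h hfc.isCompact hβ hβ0 hC2 s).smul (deriv χ s))).trans ?_
    exact congrArg₂ (· - ·)
      (integral_smul (χ s) fun x => formInner (spatialMetric h) (gradForm n f) (spatialPart A s) x)
      (integral_smul (deriv χ s) fun x =>
        formInner (spatialMetric h) (zeroForm (𝓡 n) f) (timeZeroForm A s) x)
  have hint1 : Integrable fun s => χ s • hodgeInner (spatialMetric h) (gradForm n f)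
      (spatialPart A s) :=
    (hχ.continuous.smul hF1).integrable_of_hasCompactSupport hχc.smul_right
  have hint2 : Integrable fun s => deriv χ s • hodgeInner (spatialMetric h) (zeroForm (𝓡 n) f)
      (timeZeroForm A s) :=
    (hχ'.smul hF2).integrable_of_hasCompactSupport hχc.deriv.smul_right
  have hint3 : Integrable fun s => χ s • hodgeInner (spatialMetric h) (zeroForm (𝓡 n) f)
      (timeDeriv (timeZeroForm A) s) :=
    (hχ.continuous.smul hF3).integrable_of_hasCompactSupport hχc.smul_right
  simp only [h1] at hz
  -- Only the time component comes with χ'; after integration by parts both terms carry χ.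
  rw [integral_sub hint1 hint2, integral_deriv_smul_eq_neg hχ hχc
    (fun s => hasDerivAt_hodgeInner h hfc.isCompact hβ hβ0 hC2 s) hF3, sub_neg_eq_add] at hz
  simp only [smul_add]
  rw [integral_add hint3 hint1, add_comm]
  exact hz

include hA hf hfc in
/-- The wave equation for the time component, in the weak form. -/
theorem hodgeInner_wave (hPA : IsMaxwellSolution (ultrastaticMetric h) A)
    (hL : LorenzGauge (ultrastaticMetric h) A) (t : ℝ) :
    hodgeInner (spatialMetric h) (zeroForm (𝓡 n) f) (timeDeriv (timeDeriv (timeZeroForm A)) t) =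
      -hodgeInner (spatialMetric h) (gradForm n f) (gradTime A t) := by
  have hα := isSmoothForm_gradForm hf
  have hα0 : ∀ x ∉ tsupport f, ∀ β, formInner (spatialMetric h) (gradForm n f) β x = 0 :=
    fun x hx β => formInner_gradForm_eq_zero h hf hx β
  have hβ : IsSmoothForm (zeroForm (𝓡 n) f) := isSmoothForm_zeroForm_iff.2 hf
  have hβ0 : ∀ x ∉ tsupport f, ∀ β, formInner (spatialMetric h) (zeroForm (𝓡 n) f) β x = 0 :=
    fun x hx β => formInner_zeroForm_eq_zero h hx β
  -- Differentiate the Lorenz identity in time with f fixed; Gauss's law then replaces ∂_t A_Σ by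
  -- dA₀.
  have h1 := (hasDerivAt_hodgeInner h hfc.isCompact hβ hβ0
    (smoothInTime_timeZeroForm hA).timeDeriv t).fun_add
    (hasDerivAt_hodgeInner h hfc.isCompact hα hα0 (smoothInTime_spatialPart hA) t)
  simp only [hodgeInner_timeDeriv_timeZeroForm h hA hf hfc hL] at h1
  have h3 := h1.unique (hasDerivAt_const t (0 : ℂ))
  rw [hodgeInner_timeDeriv_spatialPart h hA hf hfc hPA] at h3
  exact eq_neg_of_add_eq_zero_left h3

end WeakEquations


/-! ### The local energy estimate for a weak wave equation. -/

section Energy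

variable {V ι : Type*} [NormedAddCommGroup V] [NormedSpace ℝ V] [Fintype ι]

/-- The bilinear form with matrix `Q` on covectors. -/
def coPair (b : ι → V) (Q : Matrix ι ι ℝ) (a c : V →L[ℝ] ℝ) : ℝ :=
  ∑ i, ∑ j, Q i j * (a (b i) * c (b j))

section

variable (b : ι → V) (Q : Matrix ι ι ℝ) (a a' c c' : V →L[ℝ] ℝ) (r : ℝ)

theorem coPair_add_left : coPair b Q (a + a') c = coPair b Q a c + coPair b Q a' c := by
  simp only [coPair, add_apply, add_mul, mul_add, Finset.sum_add_distrib]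

theorem coPair_smul_left : coPair b Q (r • a) c = r * coPair b Q a c := by
  simp only [coPair, smul_apply, smul_eq_mul, Finset.mul_sum]
  exact Finset.sum_congr rfl fun i _ => Finset.sum_congr rfl fun j _ => by ring

theorem coPair_add_right : coPair b Q a (c + c') = coPair b Q a c + coPair b Q a c' := by
  simp only [coPair, add_apply, mul_add, Finset.sum_add_distrib]

theorem coPair_smul_right : coPair b Q a (r • c) = r * coPair b Q a c := by
  simp only [coPair, smul_apply, smul_eq_mul, Finset.mul_sum]
  exact Finset.sum_congr rfl fun i _ => Finset.sum_congr rfl fun j _ => by ring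

end

/-- The time derivative of a function of time and space. -/
noncomputable def partialTime (v : ℝ × V → ℝ) (q : ℝ × V) : ℝ := fderiv ℝ v q (1, 0)

/-- The spatial differential of a function of time and space. -/
noncomputable def partialSpace (v : ℝ × V → ℝ) (q : ℝ × V) : V →L[ℝ] ℝ :=
  (fderiv ℝ v q).comp (ContinuousLinearMap.inr ℝ ℝ V)

variable {T : Set V} {v : ℝ × V → ℝ}

omit [NormedSpace ℝ V] in
theorem isOpen_univ_prod (hT : IsOpen T) : IsOpen ((Set.univ : Set ℝ) ×ˢ T) := isOpen_univ.prod hT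

theorem contDiffOn_partialTime (hT : IsOpen T) (hv : ContDiffOn ℝ ∞ v (Set.univ ×ˢ T)) :
    ContDiffOn ℝ ∞ (partialTime v) (Set.univ ×ˢ T) :=
  (hv.fderiv_of_isOpen (isOpen_univ_prod hT) (by simp)).clm_apply contDiffOn_const

theorem contDiffOn_partialSpace (hT : IsOpen T) (hv : ContDiffOn ℝ ∞ v (Set.univ ×ˢ T)) :
    ContDiffOn ℝ ∞ (partialSpace v) (Set.univ ×ˢ T) :=
  (hv.fderiv_of_isOpen (isOpen_univ_prod hT) (by simp)).clm_comp contDiffOn_const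

theorem differentiableAt_of_contDiffOn {G : Type*} [NormedAddCommGroup G] [NormedSpace ℝ G]
    {w : ℝ × V → G} (hT : IsOpen T) (hv : ContDiffOn ℝ ∞ w (Set.univ ×ˢ T)) (t : ℝ) {y : V}
    (hy : y ∈ T) : DifferentiableAt ℝ w (t, y) :=
  (hv.contDiffAt ((isOpen_univ_prod hT).mem_nhds ⟨trivial, hy⟩)).differentiableAt (by simp)

theorem hasDerivAt_partialTime (hT : IsOpen T) (hv : ContDiffOn ℝ ∞ v (Set.univ ×ˢ T)) (t : ℝ) {y : V}
    (hy : y ∈ T) : HasDerivAt (fun s => v (s, y)) (partialTime v (t, y)) t :=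
  hasDerivAt_slice (differentiableAt_of_contDiffOn hT hv t hy)

theorem hasFDerivAt_partialSpace (hT : IsOpen T) (hv : ContDiffOn ℝ ∞ v (Set.univ ×ˢ T)) (t : ℝ)
    {y : V} (hy : y ∈ T) : HasFDerivAt (fun z => v (t, z)) (partialSpace v (t, y)) y :=
  hasFDerivAt_slice (differentiableAt_of_contDiffOn hT hv t hy)

theorem two_le_infty : (2 : WithTop ℕ∞) ≤ ∞ := WithTop.coe_le_coe.2 (le_top : (2 : ℕ∞) ≤ ⊤)

/-- Symmetry of second derivatives: the energy produces ∂_t d v, while the weak equation tested with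
∂_t v produces d ∂_t v. -/
theorem hasDerivAt_partialSpace (hT : IsOpen T) (hv : ContDiffOn ℝ ∞ v (Set.univ ×ˢ T)) (t : ℝ) {y : V}
    (hy : y ∈ T) :
    HasDerivAt (fun s => partialSpace v (s, y)) (partialSpace (partialTime v) (t, y)) t := by
  have h1 := hasDerivAt_slice (differentiableAt_of_contDiffOn hT (contDiffOn_partialSpace hT hv) t hy)
  refine h1.congr_deriv ?_
  have hcd : ContDiffAt ℝ ∞ v (t, y) := hv.contDiffAt ((isOpen_univ_prod hT).mem_nhds ⟨trivial, hy⟩)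
  have hsymm := hcd.isSymmSndFDerivAt (by simpa using two_le_infty)
  have hd : DifferentiableAt ℝ (fderiv ℝ v) (t, y) :=
    (hcd.fderiv_right (m := 1) (one_add_one_eq_two.trans_le two_le_infty)).differentiableAt one_ne_zero
  have e1 : fderiv ℝ (partialSpace v) (t, y) (1, 0) =
      (fderiv ℝ (fderiv ℝ v) (t, y) (1, 0)).comp (ContinuousLinearMap.inr ℝ ℝ V) := by
    have h2 := (((ContinuousLinearMap.compL ℝ V (ℝ × V) ℝ).flip
      (ContinuousLinearMap.inr ℝ ℝ V)).hasFDerivAt.comp (t, y) hd.hasFDerivAt).fderiv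
    exact congrArg (fun L : ℝ × V →L[ℝ] V →L[ℝ] ℝ => L (1, 0)) h2
  have e2 : ∀ w, fderiv ℝ (partialTime v) (t, y) w = fderiv ℝ (fderiv ℝ v) (t, y) w (1, 0) := by
    intro w
    have h2 := ((ContinuousLinearMap.apply ℝ ℝ ((1 : ℝ), (0 : V))).hasFDerivAt.comp (t, y)
      hd.hasFDerivAt).fderiv
    exact congrArg (fun L : ℝ × V →L[ℝ] ℝ => L w) h2
  rw [e1]
  ext w
  simp only [partialSpace, ContinuousLinearMap.comp_apply, e2]
  exact hsymm.eq _ _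

omit [NormedSpace ℝ V] in
theorem continuousOn_slice {G : Type*} [TopologicalSpace G] {w : ℝ × V → G} {K : Set V}
    (hw : ContinuousOn w (Set.univ ×ˢ T)) (hK : K ⊆ T) (s : ℝ) : ContinuousOn (fun z => w (s, z)) K :=
  hw.comp (f := fun z => (s, z)) (by fun_prop) fun z hz => ⟨trivial, hK hz⟩

/-- The cut-off profile: positive for `s < 1`, zero for `1 ≤ s`, and decreasing. -/
noncomputable def cutoff (s : ℝ) : ℝ := Real.smoothTransition (1 - s)

theorem contDiff_cutoff : ContDiff ℝ ∞ cutoff :=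
  Real.smoothTransition.contDiff.comp (contDiff_const.sub contDiff_id)

theorem cutoff_nonneg (s : ℝ) : 0 ≤ cutoff s := Real.smoothTransition.nonneg _

theorem cutoff_eq_zero {s : ℝ} (hs : 1 ≤ s) : cutoff s = 0 :=
  Real.smoothTransition.zero_of_nonpos (by linarith)

theorem cutoff_pos {s : ℝ} (hs : s < 1) : 0 < cutoff s :=
  Real.smoothTransition.pos_of_pos (by linarith)

theorem hasDerivAt_cutoff (s : ℝ) : HasDerivAt cutoff (deriv cutoff s) s :=
  ((contDiff_cutoff.differentiable (by simp)) s).hasDerivAt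

theorem deriv_cutoff_nonpos (s : ℝ) : deriv cutoff s ≤ 0 := by
  have : Antitone cutoff := fun a b hab => Real.smoothTransition.monotone (by linarith)
  exact this.deriv_nonpos

variable {b : ι → V} {Q : V → Matrix ι ι ℝ}

theorem continuousOn_coPair {X : Type*} [TopologicalSpace X] {s : Set X} {Q : X → Matrix ι ι ℝ}
    {a c : X → V →L[ℝ] ℝ} (hQ : ContinuousOn Q s) (ha : ContinuousOn a s) (hc : ContinuousOn c s) :
    ContinuousOn (fun x => coPair b (Q x) (a x) (c x)) s := by
  unfold coPair
  refine continuousOn_finsetSum _ fun i _ => continuousOn_finsetSum _ fun j _ => ContinuousOn.mul ?_ ?_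
  · exact continuousOn_pi.1 (continuousOn_pi.1 hQ i) j
  · exact (ha.clm_apply continuousOn_const).mul (hc.clm_apply continuousOn_const)

theorem hasDerivAt_coPair (Q : Matrix ι ι ℝ) {a c : ℝ → V →L[ℝ] ℝ} {a' c' : V →L[ℝ] ℝ} {t : ℝ}
    (ha : HasDerivAt a a' t) (hc : HasDerivAt c c' t) :
    HasDerivAt (fun s => coPair b Q (a s) (c s)) (coPair b Q a' (c t) + coPair b Q (a t) c') t := by
  unfold coPair
  rw [← Finset.sum_add_distrib]
  refine HasDerivAt.fun_sum fun i _ => ?_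
  rw [← Finset.sum_add_distrib]
  refine HasDerivAt.fun_sum fun j _ => ?_
  have h1 : HasDerivAt (fun s => a s (b i)) (a' (b i)) t := by
    simpa using ha.clm_apply (hasDerivAt_const t (b i))
  have h2 : HasDerivAt (fun s => c s (b j)) (c' (b j)) t := by
    simpa using hc.clm_apply (hasDerivAt_const t (b j))
  exact ((h1.fun_mul h2).const_mul (Q i j)).congr_deriv (by ring)

/-- The pointwise energy flux inequality. -/
theorem flux_nonneg {Q : Matrix ι ι ℝ} (hQs : ∀ a c : V →L[ℝ] ℝ, coPair b Q a c = coPair b Q c a)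
    (hQp : ∀ a : V →L[ℝ] ℝ, 0 ≤ coPair b Q a a) {r : ℝ} (hr : 0 < r) {θ : V →L[ℝ] ℝ}
    (hθ : coPair b Q θ θ ≤ r ^ 2) (w : ℝ) (a : V →L[ℝ] ℝ) :
    0 ≤ r * (w ^ 2 + coPair b Q a a) - 2 * w * coPair b Q θ a := by
  -- Completing the square: Q is nonnegative on a - (w/r) θ; multiply by r and use Q(θ, θ) ≤ r².
  have h1 := hQp (a + (-(w / r)) • θ)
  rw [coPair_add_left, coPair_add_right, coPair_add_right, coPair_smul_left, coPair_smul_right,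
    coPair_smul_left, coPair_smul_right, hQs a θ] at h1
  have h2 : 0 ≤ r * (coPair b Q a a + -(w / r) * coPair b Q θ a +
    (-(w / r) * coPair b Q θ a + -(w / r) * (-(w / r) * coPair b Q θ θ))) := mul_nonneg hr.le h1
  have h3 : r * (coPair b Q a a + -(w / r) * coPair b Q θ a +
    (-(w / r) * coPair b Q θ a + -(w / r) * (-(w / r) * coPair b Q θ θ))) =
    r * coPair b Q a a - 2 * w * coPair b Q θ a + w ^ 2 * (coPair b Q θ θ / r) := by
    field_simp
    ring
  rw [h3] at h2
  have h4 : w ^ 2 * (coPair b Q θ θ / r) ≤ w ^ 2 * r := by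
    refine mul_le_mul_of_nonneg_left ?_ (sq_nonneg w)
    rw [div_le_iff₀ hr]
    linarith
  linarith

variable [MeasurableSpace V] [BorelSpace V] {μ : Measure V}

/-- Local uniqueness for a weak wave equation, by the energy method. -/
theorem eq_zero_of_weak_wave (hT : IsOpen T) (hQc : ContinuousOn Q T)
    (hQs : ∀ y ∈ T, ∀ a c : V →L[ℝ] ℝ, coPair b (Q y) a c = coPair b (Q y) c a)
    (hQp : ∀ y ∈ T, ∀ a : V →L[ℝ] ℝ, 0 ≤ coPair b (Q y) a a)
    (hv : ContDiffOn ℝ ∞ v (Set.univ ×ˢ T)) {ρ : V → ℝ} (hρ : ContDiff ℝ ∞ ρ)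
    {ε : ℝ} (hε : 0 < ε) (hK : IsCompact {y | ρ y ≤ ε ^ 2}) (hKT : {y | ρ y ≤ ε ^ 2} ⊆ T)
    (hρQ : ∀ y, ρ y ≤ ε ^ 2 → coPair b (Q y) (fderiv ℝ ρ y) (fderiv ℝ ρ y) ≤ 16 * ρ y)
    (hμK : μ {y | ρ y ≤ ε ^ 2} < ⊤)
    (hμpos : ∀ O : Set V, IsOpen O → O.Nonempty → O ⊆ T → 0 < μ O)
    (hweak : ∀ (t : ℝ) (g : V → ℝ), ContDiff ℝ ∞ g → HasCompactSupport g → tsupport g ⊆ T →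
      ∫ y, (g y * partialTime (partialTime v) (t, y) +
        coPair b (Q y) (fderiv ℝ g y) (partialSpace v (t, y))) ∂μ = 0)
    {t₁ : ℝ} (h0 : ∀ y, ρ y ≤ ε ^ 2 → v (t₁, y) = 0 ∧ partialTime v (t₁, y) = 0)
    {t : ℝ} (ht : t₁ ≤ t) {y : V} (hy : ρ y / ε ^ 2 + 4 * (t - t₁) / ε < 1) : v (t, y) = 0 := by
  have hε2 : 0 < ε ^ 2 := by positivity
  set K := {y | ρ y ≤ ε ^ 2} with hKdef
  -- The region σ < 1 is a ρ-ball shrinking in time. Its rate 4/ε dominates the spatial gradient of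
  -- σ, since Q(dρ, dρ) ≤ 16ρ ≤ 16ε² there; so no energy flows in through the lateral boundary.
  set σ : ℝ → V → ℝ := fun s z => ρ z / ε ^ 2 + 4 * (s - t₁) / ε with hσ
  have hσK : ∀ s z, t₁ ≤ s → σ s z ≤ 1 → z ∈ K := by
    intro s z hs hz
    have h1 : 0 ≤ 4 * (s - t₁) / ε := by
      have := sub_nonneg.2 hs
      positivity
    have h2 : ρ z / ε ^ 2 ≤ 1 := by simp only [hσ] at hz; linarith
    rw [div_le_one hε2] at h2
    exact h2
  have hvt := contDiffOn_partialTime hT hv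
  have hvtt := contDiffOn_partialTime hT hvt
  have hdv := contDiffOn_partialSpace hT hv
  have hdvt := contDiffOn_partialSpace hT hvt
  have hsub : (Set.univ : Set ℝ) ×ˢ K ⊆ Set.univ ×ˢ T := Set.prod_mono subset_rfl hKT
  set e : ℝ → V → ℝ := fun s z => partialTime v (s, z) ^ 2 +
    coPair b (Q z) (partialSpace v (s, z)) (partialSpace v (s, z)) with he
  have he0 : ∀ s, ∀ z ∈ T, 0 ≤ e s z := fun s z hz => add_nonneg (sq_nonneg _) (hQp z hz _)
  have hec : ContinuousOn (Function.uncurry e) (Set.univ ×ˢ T) :=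
    (hvt.continuousOn.pow 2).add (continuousOn_coPair
      (hQc.comp continuousOn_snd fun q hq => hq.2) hdv.continuousOn hdv.continuousOn)
  have hσc : Continuous (Function.uncurry σ) := by
    have := hρ.continuous
    simp only [hσ, Function.uncurry_def]
    fun_prop
  set F : ℝ → V → ℝ := fun s z => cutoff (σ s z) * e s z with hF
  set F' : ℝ → V → ℝ := fun s z => deriv cutoff (σ s z) * (4 / ε) * e s z + cutoff (σ s z) *
    (2 * partialTime v (s, z) * partialTime (partialTime v) (s, z) +
      2 * coPair b (Q z) (partialSpace (partialTime v) (s, z)) (partialSpace v (s, z))) with hF'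
  have hFc : ContinuousOn (Function.uncurry F) (Set.univ ×ˢ T) :=
    (contDiff_cutoff.continuous.comp hσc).continuousOn.mul hec
  have hF'c : ContinuousOn (Function.uncurry F') (Set.univ ×ˢ T) := by
    have hd : Continuous (deriv cutoff) := contDiff_cutoff.continuous_deriv (by simp)
    refine (((hd.comp hσc).continuousOn.mul continuousOn_const).mul hec).add
      ((contDiff_cutoff.continuous.comp hσc).continuousOn.mul
        (((continuousOn_const.mul hvt.continuousOn).mul hvtt.continuousOn).add
          (continuousOn_const.mul (continuousOn_coPair
      (hQc.comp continuousOn_snd fun q hq => hq.2) hdvt.continuousOn hdv.continuousOn))))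
  have hFd : ∀ s, ∀ z ∈ T, HasDerivAt (fun s => F s z) (F' s z) s := by
    intro s z hz
    have h1 : HasDerivAt (fun s => σ s z) (4 / ε) s := by
      have := (((hasDerivAt_id s).sub_const t₁).const_mul 4).div_const ε |>.const_add (ρ z / ε ^ 2)
      rw [mul_one] at this
      exact this
    have h2 : HasDerivAt (fun s => cutoff (σ s z)) (deriv cutoff (σ s z) * (4 / ε)) s :=
      HasDerivAt.comp (h₂ := cutoff) (h := fun s => σ s z) s (hasDerivAt_cutoff (σ s z)) h1
    have h3 := hasDerivAt_partialTime hT hvt s hz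
    have h4 := hasDerivAt_partialSpace hT hv s hz
    have h5 := (h3.fun_pow 2).fun_add (hasDerivAt_coPair (b := b) (Q z) h4 h4)
    have h6 := h2.fun_mul h5
    refine h6.congr_deriv ?_
    simp only [hF', he]
    rw [hQs z hz (partialSpace v (s, z)) (partialSpace (partialTime v) (s, z))]
    push_cast
    ring
  set en : ℝ → ℝ := fun s => ∫ z in K, F s z ∂μ with hen
  have hend : ∀ s, HasDerivAt en (∫ z in K, F' s z ∂μ) s := fun s =>
    hasDerivAt_setIntegral_of_isCompact hK hμK isOpen_univ (hFc.mono hsub) (hF'c.mono hsub)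
      (fun s _ z hz => hFd s z (hKT hz)) (Set.mem_univ s)
  have hintK : ∀ {w : V → ℝ}, ContinuousOn w K → IntegrableOn w K μ := fun hw =>
    hw.integrableOn_of_subset_isCompact hK hK.measurableSet subset_rfl hμK.ne
  have hslice : ∀ {w : ℝ → V → ℝ}, ContinuousOn (Function.uncurry w) (Set.univ ×ˢ T) → ∀ s,
      ContinuousOn (w s) K := fun hw s =>
    hw.comp (f := fun z => (s, z)) (by fun_prop) fun z hz => ⟨trivial, hKT hz⟩
  have hnonpos : ∀ s, t₁ < s → ∫ z in K, F' s z ∂μ ≤ 0 := by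
    intro s hs
    -- The multiplier ∂_t v, cut off to the region σ < 1. For s ≥ t₁ its support lies in K, so it is
    -- smooth on the whole space although v is controlled only over T.
    set g : V → ℝ := fun z => cutoff (σ s z) * partialTime v (s, z) with hg
    have hσd : ContDiff ℝ ∞ (fun z => cutoff (σ s z)) :=
      contDiff_cutoff.comp ((hρ.div_const _).add contDiff_const)
    have hσz : ∀ z, σ s z ≤ 1 ↔ ρ z ≤ ε ^ 2 * (1 - 4 * (s - t₁) / ε) := by
      intro z
      simp only [hσ]
      rw [← le_sub_iff_add_le, div_le_iff₀ hε2, mul_comm]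
    have hcl : IsClosed {z | σ s z ≤ 1} := by
      simp only [hσz]
      exact isClosed_le hρ.continuous continuous_const
    have hts : tsupport g ⊆ {z | σ s z ≤ 1} := by
      refine closure_minimal (fun z hz => ?_) hcl
      by_contra h1
      exact hz (by simp only [hg, cutoff_eq_zero (not_le.1 h1).le, zero_mul])
    have htsK : tsupport g ⊆ K := hts.trans fun z hz => hσK s z hs.le hz
    have hgT : ∀ z ∈ T, ContDiffAt ℝ ∞ g z := by
      intro z hz
      refine hσd.contDiffAt.mul ?_
      exact (hvt.contDiffAt ((isOpen_univ_prod hT).mem_nhds ⟨trivial, hz⟩)).comp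
        (f := fun z => (s, z)) z (contDiff_prodMk_right s).contDiffAt
    have hgc : ContDiff ℝ ∞ g := by
      rw [contDiff_iff_contDiffAt]
      intro z
      by_cases hz : z ∈ tsupport g
      · exact hgT z (hKT (htsK hz))
      · exact contDiffAt_const.congr_of_eventuallyEq (notMem_tsupport_iff_eventuallyEq.1 hz)
    have hgs : HasCompactSupport g := hK.of_isClosed_subset (isClosed_tsupport g) htsK
    have hw := hweak s g hgc hgs (htsK.trans hKT)
    have hgd : ∀ z ∈ T, fderiv ℝ g z = cutoff (σ s z) • partialSpace (partialTime v) (s, z) +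
        partialTime v (s, z) • (deriv cutoff (σ s z) • ((ε ^ 2)⁻¹ • fderiv ℝ ρ z)) := by
      intro z hz
      have h1 : HasFDerivAt (fun z => σ s z) ((ε ^ 2)⁻¹ • fderiv ℝ ρ z) z := by
        have h2 := (((hρ.differentiable (by simp)) z).hasFDerivAt.const_mul ((ε ^ 2)⁻¹)).add_const
          (4 * (s - t₁) / ε)
        refine h2.congr_of_eventuallyEq (Filter.Eventually.of_forall fun z => ?_)
        simp only [hσ]
        ring
      have h2 := (hasDerivAt_cutoff (σ s z)).comp_hasFDerivAt z h1
      exact (h2.mul (hasFDerivAt_partialSpace hT hvt s hz)).fderiv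
    have hwK : ∫ z in K, (g z * partialTime (partialTime v) (s, z) +
        coPair b (Q z) (fderiv ℝ g z) (partialSpace v (s, z))) ∂μ = 0 := by
      rw [← hw]
      refine setIntegral_eq_integral_of_forall_compl_eq_zero fun z hz => ?_
      have h1 : g =ᶠ[𝓝 z] fun _ => 0 := notMem_tsupport_iff_eventuallyEq.1 fun h2 => hz (htsK h2)
      rw [h1.fderiv_eq, h1.eq_of_nhds]
      simp [coPair]
    have hc1 : ContinuousOn (fun z => g z * partialTime (partialTime v) (s, z) +
        coPair b (Q z) (fderiv ℝ g z) (partialSpace v (s, z))) K :=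
      (hgc.continuous.continuousOn.mul (continuousOn_slice hvtt.continuousOn hKT s)).add
        (continuousOn_coPair (hQc.mono hKT) (hgc.continuous_fderiv (by simp)).continuousOn
          (continuousOn_slice hdv.continuousOn hKT s))
    -- Subtracting twice the vanishing weak equation cancels all second derivatives of v. What is
    -- left is the derivative of the cut-off, which is nonpositive, times the nonnegative flux.
    have hsum : ∫ z in K, F' s z ∂μ = ∫ z in K, (F' s z - 2 * (g z * partialTime (partialTime v) (s, z) +
        coPair b (Q z) (fderiv ℝ g z) (partialSpace v (s, z)))) ∂μ := by
      rw [integral_sub (hintK (hslice hF'c s)) ((hintK hc1).const_mul 2), integral_const_mul, hwK]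
      ring
    rw [hsum]
    refine integral_nonpos_of_ae ((ae_restrict_iff' hK.measurableSet).2
      (Filter.Eventually.of_forall fun z hz => ?_))
    have hzT := hKT hz
    have hθ : coPair b (Q z) ((ε ^ 2)⁻¹ • fderiv ℝ ρ z) ((ε ^ 2)⁻¹ • fderiv ℝ ρ z) ≤ (4 / ε) ^ 2 := by
      rw [coPair_smul_left, coPair_smul_right]
      have h1 := hρQ z hz
      have h2 : ρ z ≤ ε ^ 2 := hz
      have h3 : (4 / ε) ^ 2 = (ε ^ 2)⁻¹ * ((ε ^ 2)⁻¹ * (16 * ε ^ 2)) := by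
        field_simp
        norm_num
      rw [h3]
      have h4 : 0 ≤ (ε ^ 2)⁻¹ := by positivity
      refine mul_le_mul_of_nonneg_left (mul_le_mul_of_nonneg_left ?_ h4) h4
      linarith
    have hflux := flux_nonneg (hQs z hzT) (hQp z hzT) (show 0 < 4 / ε by positivity) hθ
      (partialTime v (s, z)) (partialSpace v (s, z))
    have heq : F' s z - 2 * (g z * partialTime (partialTime v) (s, z) +
        coPair b (Q z) (fderiv ℝ g z) (partialSpace v (s, z))) =
        deriv cutoff (σ s z) * (4 / ε * (partialTime v (s, z) ^ 2 +
          coPair b (Q z) (partialSpace v (s, z)) (partialSpace v (s, z))) -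
          2 * partialTime v (s, z) *
            coPair b (Q z) ((ε ^ 2)⁻¹ • fderiv ℝ ρ z) (partialSpace v (s, z))) := by
      rw [hgd z hzT, coPair_add_left, coPair_smul_left, coPair_smul_left, coPair_smul_left]
      simp only [hF', he, hg]
      ring
    simp only [Pi.zero_apply]
    rw [heq]
    exact mul_nonpos_of_nonpos_of_nonneg (deriv_cutoff_nonpos _) hflux
  have hF0 : ∀ s, ∀ z ∈ K, 0 ≤ F s z := fun s z hz => mul_nonneg (cutoff_nonneg _) (he0 s z (hKT hz))
  -- The vanishing of v on K kills its spatial differential where ρ < ε²; on ρ = ε² the cut-off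
  -- itself is zero, as σ = 1.
  have hen0 : en t₁ = 0 := by
    refine setIntegral_eq_zero_of_forall_eq_zero fun z hz => ?_
    rcases eq_or_lt_of_le (show ρ z ≤ ε ^ 2 from hz) with h1 | h1
    · have : σ t₁ z = 1 := by simp [hσ, h1, hε2.ne']
      simp only [hF, this, cutoff_eq_zero le_rfl, zero_mul]
    · have h2 : (fun z => v (t₁, z)) =ᶠ[𝓝 z] fun _ => 0 := by
        filter_upwards [(isOpen_lt hρ.continuous continuous_const).mem_nhds h1] with w hw
        exact (h0 w (le_of_lt hw)).1
      have h3 : partialSpace v (t₁, z) = 0 := by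
        have h4 := (hasFDerivAt_partialSpace hT hv t₁ (hKT hz)).fderiv
        rw [h2.fderiv_eq] at h4
        rw [← h4]
        simp
      simp [hF, he, (h0 z hz).2, h3, coPair]
  have hanti : AntitoneOn en (Set.Ici t₁) := by
    refine antitoneOn_of_deriv_nonpos (convex_Ici t₁)
      (fun s _ => (hend s).continuousAt.continuousWithinAt)
      (fun s _ => (hend s).differentiableAt.differentiableWithinAt) fun s hs => ?_
    rw [(hend s).deriv]
    rw [interior_Ici] at hs
    exact hnonpos s hs
  -- The energy is nonnegative, nonincreasing and initially zero. Were ∂_t v nonzero at a point with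
  -- positive cut-off, the density would be positive on an open set, which has positive measure.
  have hvt0 : ∀ s, t₁ ≤ s → ∀ z, σ s z < 1 → partialTime v (s, z) = 0 := by
    intro s hs z hz
    by_contra hne
    have h1 : en s ≤ 0 := hen0 ▸ hanti (Set.mem_Ici.2 le_rfl) (Set.mem_Ici.2 hs) hs
    have h2 : 0 ≤ en s := setIntegral_nonneg hK.measurableSet fun z hz => hF0 s z hz
    have h3 : en s = 0 := le_antisymm h1 h2
    have h4 := (setIntegral_eq_zero_iff_of_nonneg_ae ((ae_restrict_iff' hK.measurableSet).2
      (Filter.Eventually.of_forall fun z hz => hF0 s z hz)) (hintK (hslice hFc s))).1 h3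
    have h5 := (ae_restrict_iff' hK.measurableSet).1 h4
    have hzT : z ∈ T := hKT (hσK s z hs hz.le)
    have hnear : ∀ᶠ w in 𝓝 z, w ∈ T ∧ σ s w < 1 ∧ partialTime v (s, w) ≠ 0 := by
      refine (hT.mem_nhds hzT |> Filter.eventually_mem_set.2).and (Filter.Eventually.and ?_ ?_)
      · have : Continuous (σ s) := hσc.comp (Continuous.prodMk_right s)
        exact this.continuousAt.eventually_lt continuousAt_const hz
      · have : ContinuousAt (fun w => partialTime v (s, w)) z :=
          ContinuousAt.comp (f := fun w => (s, w)) (hvt.continuousOn.continuousAt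
            ((isOpen_univ_prod hT).mem_nhds ⟨trivial, hzT⟩)) (by fun_prop)
        exact this.eventually_ne hne
    obtain ⟨O, hO, hOo, hzO⟩ := eventually_nhds_iff.1 hnear
    have h6 := hμpos O hOo ⟨z, hzO⟩ fun w hw => (hO w hw).1
    refine h6.ne' (measure_mono_null (fun w hw => ?_) h5)
    intro hw'
    have h7 := hO w hw
    have h8 := hw' (hσK s w hs h7.2.1.le)
    have h9 : 0 < F s w := mul_pos (cutoff_pos h7.2.1)
      (add_pos_of_pos_of_nonneg (by have := h7.2.2; positivity) (hQp w h7.1 _))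
    exact h9.ne' h8
  have hyσ : ∀ s ∈ Set.Icc t₁ t, σ s y < 1 := by
    intro s hs
    refine lt_of_le_of_lt ?_ hy
    simp only [hσ]
    have : 4 * (s - t₁) / ε ≤ 4 * (t - t₁) / ε := by
      gcongr
      exact hs.2
    linarith
  have hyK : y ∈ K := hσK t₁ y le_rfl (hyσ t₁ ⟨le_rfl, ht⟩).le
  have hconst := constant_of_has_deriv_right_zero (f := fun s => v (s, y)) (a := t₁) (b := t)
    (fun s _ => (hasDerivAt_partialTime hT hv s (hKT hyK)).continuousAt.continuousWithinAt)
    (fun s hs => by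
      have := (hasDerivAt_partialTime hT hv s (hKT hyK)).hasDerivWithinAt (s := Set.Ici s)
      rwa [hvt0 s hs.1 y (hyσ s ⟨hs.1, hs.2.le⟩)] at this)
  rw [hconst t ⟨ht, le_rfl⟩]
  exact (h0 y hyK).1

end Energy


/-! ### The inverse metric on covectors. -/

section CoPair

variable {V ι : Type*} [NormedAddCommGroup V] [NormedSpace ℝ V] [FiniteDimensional ℝ V] [Fintype ι]
  [DecidableEq ι] {B : LinearMap.BilinForm ℝ V} (hs : ∀ v w, B v w = B w v)
  (hp : ∀ v, v ≠ 0 → 0 < B v v) (b : Module.Basis ι ℝ V)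

include hs hp

omit [FiniteDimensional ℝ V] in
/-- The inverse Gram matrix represents the metric on covectors. -/
theorem exists_dual_vector (a : V →L[ℝ] ℝ) :
    ∃ w : V, (∀ x, B w x = a x) ∧ ∀ c : V →L[ℝ] ℝ, coPair b (gramOf B b)⁻¹ a c = c w := by
  set G := gramOf B b with hG
  have hdet : IsUnit G.det := (posDef_gramOf hs hp b).det_pos.ne'.isUnit
  have hGs : G.transpose = G := by
    ext i j
    simp [hG, gramOf, hs (b j) (b i)]
  have hGi : G⁻¹.transpose = G⁻¹ := by rw [Matrix.transpose_nonsing_inv, hGs]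
  set w : ι → ℝ := G⁻¹.mulVec fun j => a (b j) with hw
  have hGw : G.mulVec w = fun j => a (b j) := by
    rw [hw, Matrix.mulVec_mulVec, Matrix.mul_nonsing_inv _ hdet, Matrix.one_mulVec]
  refine ⟨∑ i, w i • b i, fun x => ?_, fun c => ?_⟩
  · have h1 : B (∑ i, w i • b i) = (a : V →ₗ[ℝ] ℝ) := by
      refine b.ext fun k => ?_
      have h2 := congrFun hGw k
      simp only [Matrix.mulVec, dotProduct, hG, gramOf, Matrix.of_apply] at h2
      simp only [map_sum, LinearMap.sum_apply, map_smul, LinearMap.smul_apply, smul_eq_mul,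
        ContinuousLinearMap.coe_coe]
      rw [← h2]
      exact Finset.sum_congr rfl fun i _ => by rw [hs (b i) (b k), mul_comm]
    rw [h1]
    rfl
  · simp only [coPair, map_sum, map_smul, smul_eq_mul, hw, Matrix.mulVec, dotProduct, Finset.sum_mul]
    rw [Finset.sum_comm]
    refine Finset.sum_congr rfl fun i _ => Finset.sum_congr rfl fun j _ => ?_
    have h3 : G⁻¹ j i = G⁻¹ i j := by
      conv_lhs => rw [← hGi]
      rfl
    rw [h3]
    ring

omit [FiniteDimensional ℝ V] in
theorem coPair_gramOf_symm (a c : V →L[ℝ] ℝ) :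
    coPair b (gramOf B b)⁻¹ a c = coPair b (gramOf B b)⁻¹ c a := by
  obtain ⟨w, hw, hwc⟩ := exists_dual_vector hs hp b a
  obtain ⟨w', hw', hwc'⟩ := exists_dual_vector hs hp b c
  rw [hwc, hwc', ← hw, ← hw', hs]

omit [FiniteDimensional ℝ V] in
theorem coPair_gramOf_nonneg (a : V →L[ℝ] ℝ) : 0 ≤ coPair b (gramOf B b)⁻¹ a a := by
  obtain ⟨w, hw, hwc⟩ := exists_dual_vector hs hp b a
  rw [hwc, ← hw]
  rcases eq_or_ne w 0 with rfl | h
  · simp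
  · exact (hp w h).le

omit [FiniteDimensional ℝ V] in
theorem eq_zero_of_coPair_gramOf_eq_zero {a : V →L[ℝ] ℝ} (h0 : coPair b (gramOf B b)⁻¹ a a = 0) :
    a = 0 := by
  obtain ⟨w, hw, hwc⟩ := exists_dual_vector hs hp b a
  rw [hwc, ← hw] at h0
  have hw0 : w = 0 := by
    by_contra h
    exact (hp w h).ne' h0
  ext x
  rw [← hw, hw0]
  simp

omit [FiniteDimensional ℝ V] in
/-- The gradient of a comparable square norm. -/
theorem coPair_gramOf_le {B₀ : LinearMap.BilinForm ℝ V} (hs₀ : ∀ v w, B₀ v w = B₀ w v)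
    (hp₀ : ∀ v, 0 ≤ B₀ v v) (hle : ∀ v, B₀ v v ≤ 4 * B v v) {a : V →L[ℝ] ℝ} {p : V}
    (ha : ∀ w, a w = 2 * B₀ p w) : coPair b (gramOf B b)⁻¹ a a ≤ 16 * B₀ p p := by
  obtain ⟨w, hw, hwc⟩ := exists_dual_vector hs hp b a
  rw [hwc]
  -- Let w be dual to a and x = B(w, w) = a(w) = 2 B₀(p, w). Positivity at 8p - w together with
  -- B₀(w, w) ≤ 4x gives 64 B₀(p, p) - 8x + 4x ≥ 0; the coefficient 8 is the optimal one.
  have h1 := hp₀ ((8 : ℝ) • p - w)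
  simp only [map_sub, map_smul, LinearMap.sub_apply, LinearMap.smul_apply, smul_eq_mul] at h1
  rw [hs₀ w p] at h1
  have h2 := hle w
  have h3 := hw w
  have h4 := ha w
  linarith

end CoPair

/-! ### The wave equation for A₀ in a chart. -/

section ChartRep

variable {n : ℕ} {S : Type*} [TopologicalSpace S] [ChartedSpace (EuclideanSpace ℝ (Fin n)) S]

/-- A function of time and space in the chart around `z`. -/
noncomputable def chartRep (n : ℕ) {S : Type*} [TopologicalSpace S]
    [ChartedSpace (EuclideanSpace ℝ (Fin n)) S] (u : ℝ → S → ℝ) (z : S) (q : ℝ × Euc n) : ℝ :=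
  u q.1 ((extChartAt (𝓡 n) z).symm q.2)

variable [IsManifold (𝓡 n) ∞ S] (h : SmoothMetric n S)

/-- Smooth solutions of the wave equation, in the weak form. -/
structure IsWeakWave (u : ℝ → S → ℝ) : Prop where
  smooth : ∀ z : S, ContDiffOn ℝ ∞ (chartRep n u z) (Set.univ ×ˢ (extChartAt (𝓡 n) z).target)
  weak : ∀ (z : S) (t : ℝ) (g : Euc n → ℝ), ContDiff ℝ ∞ g → HasCompactSupport g →
    tsupport g ⊆ (extChartAt (𝓡 n) z).target →
    ∫ y, (g y * partialTime (partialTime (chartRep n u z)) (t, y) +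
      coPair (Module.finBasis ℝ (Euc n)) (chartGram (spatialMetric h) z y)⁻¹ (fderiv ℝ g y)
        (partialSpace (chartRep n u z) (t, y))) ∂(coordVolume h z) = 0

theorem ae_mem_target (z : S) : ∀ᵐ y ∂(coordVolume h z), y ∈ (extChartAt (𝓡 n) z).target :=
  (withDensity_absolutelyContinuous _ _).ae_le (ae_restrict_mem (isOpen_chartTarget z).measurableSet)

omit [IsManifold (𝓡 n) ∞ S] in
/-- Test functions in a chart extend to the manifold. -/
theorem exists_extension [T2Space S] [IsManifold (𝓡 n) ∞ S] (z : S) {g : Euc n → ℝ}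
    (hg : ContDiff ℝ ∞ g) (hgc : HasCompactSupport g)
    (hgT : tsupport g ⊆ (extChartAt (𝓡 n) z).target) :
    ∃ f : S → ℂ, ContMDiff (𝓡 n) 𝓘(ℝ, ℂ) ∞ f ∧ HasCompactSupport f ∧
      tsupport f ⊆ (extChartAt (𝓡 n) z).source ∧
      ∀ y ∈ (extChartAt (𝓡 n) z).target, f ((extChartAt (𝓡 n) z).symm y) = g y := by
  classical
  set φ := extChartAt (𝓡 n) z with hφ
  set f : S → ℂ := fun x => if x ∈ φ.source then ((g (φ x) : ℝ) : ℂ) else 0 with hf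
  set K := φ.symm '' tsupport g with hK
  have hKc : IsCompact K := hgc.isCompact.image_of_continuousOn
    ((continuousOn_extChartAt_symm z).mono hgT)
  have hKs : K ⊆ φ.source := by
    rintro _ ⟨y, hy, rfl⟩
    exact φ.map_target (hgT hy)
  have hf0 : ∀ x ∉ K, f x = 0 := by
    intro x hx
    simp only [hf]
    split_ifs with hxs
    · by_cases hg0 : g (φ x) = 0
      · simp [hg0]
      · exact absurd ⟨φ x, subset_closure hg0, φ.left_inv hxs⟩ hx
    · rfl
  -- In a Hausdorff space the compact image is closed, so the extension by zero vanishes in a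
  -- neighbourhood of every point outside the chart domain.
  have hsupp : tsupport f ⊆ K := closure_minimal (fun x hx => by
    by_contra h1
    exact hx (hf0 x h1)) hKc.isClosed
  refine ⟨f, fun x => ?_, hKc.of_isClosed_subset (isClosed_tsupport f) hsupp, hsupp.trans hKs,
    fun y hy => by simp [hf, φ.map_target hy, φ.right_inv hy]⟩
  by_cases hx : x ∈ φ.source
  · have h1 : ContMDiffAt (𝓡 n) 𝓘(ℝ, Euc n) ∞ φ x := contMDiffAt_extChartAt' (by simpa [hφ] using hx)
    have h2 : ContMDiffAt (𝓡 n) 𝓘(ℝ, ℂ) ∞ (fun x => ((g (φ x) : ℝ) : ℂ)) x :=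
      ((Complex.ofRealCLM.contDiff.comp hg).contMDiff.contMDiffAt).comp x h1
    refine h2.congr_of_eventuallyEq ?_
    filter_upwards [(isOpen_extChartAt_source z).mem_nhds hx] with w hw
    have hw' : w ∈ φ.source := hw
    simp only [hf, if_pos hw']
  · have h1 : f =ᶠ[𝓝 x] fun _ => 0 := notMem_tsupport_iff_eventuallyEq.1 fun h2 => hx (hKs (hsupp h2))
    exact contMDiffAt_const.congr_of_eventuallyEq h1

variable {A : DiffForm (𝓘(ℝ, ℝ).prod (𝓡 n)) (ℝ × S) 1} (hA : IsSmoothForm A) (L : ℂ →L[ℝ] ℝ)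

include hA in
theorem contDiffOn_chartRep_timeComponent (z : S) :
    ContDiffOn ℝ ∞ (chartRep n (fun t x => L (timeComponent A (t, x))) z)
      (Set.univ ×ˢ (extChartAt (𝓡 n) z).target) :=
  L.contDiff.comp_contDiffOn (smoothInTime_zeroForm_iff.1 (smoothInTime_timeComponent hA) z)

include hA in
theorem partialTime_partialTime_chartRep {z : S} (t : ℝ) {y : Euc n}
    (hy : y ∈ (extChartAt (𝓡 n) z).target) :
    partialTime (partialTime (chartRep n (fun t x => L (timeComponent A (t, x))) z)) (t, y) =
      L (formVal (timeDeriv (timeDeriv (timeZeroForm A)) t) ((extChartAt (𝓡 n) z).symm y) ![]) := by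
  set x := (extChartAt (𝓡 n) z).symm y
  have hT := isOpen_chartTarget (I := 𝓡 n) z
  have hv := contDiffOn_chartRep_timeComponent hA L z
  have hB := smoothInTime_timeZeroForm hA
  have key : ∀ {C : ℝ → DiffForm (𝓡 n) S 0}, SmoothInTime C → ∀ s,
      HasDerivAt (fun s => L (formVal (C s) x ![])) (L (formVal (timeDeriv C s) x ![])) s := by
    intro C hC s
    exact L.hasFDerivAt.comp_hasDerivAt s ((ContinuousAlternatingMap.apply ℝ (Euc n) ℂ
      (![] : Fin 0 → Euc n)).hasFDerivAt.comp_hasDerivAt s (hC.hasDerivAt s x))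
  have h1 : ∀ s, partialTime (chartRep n (fun t x => L (timeComponent A (t, x))) z) (s, y) =
      L (formVal (timeDeriv (timeZeroForm A) s) x ![]) := fun s =>
    (hasDerivAt_partialTime hT hv s hy).unique (key hB s)
  have h2 := hasDerivAt_partialTime hT (contDiffOn_partialTime hT hv) t hy
  simp only [h1] at h2
  exact h2.unique (key hB.timeDeriv t)

include hA in
theorem formInner_gradForm_gradTime_chart {z : S} (t : ℝ) {y : Euc n}
    (hy : y ∈ (extChartAt (𝓡 n) z).target) {f : S → ℂ} (hf : ContMDiff (𝓡 n) 𝓘(ℝ, ℂ) ∞ f)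
    {g : Euc n → ℝ} (hg : DifferentiableAt ℝ g y)
    (hfg : ∀ y ∈ (extChartAt (𝓡 n) z).target, f ((extChartAt (𝓡 n) z).symm y) = g y) :
    L (formInner (spatialMetric h) (gradForm n f) (gradTime A t) ((extChartAt (𝓡 n) z).symm y)) =
      coPair (Module.finBasis ℝ (Euc n)) (chartGram (spatialMetric h) z y)⁻¹ (fderiv ℝ g y)
        (partialSpace (chartRep n (fun t x => L (timeComponent A (t, x))) z) (t, y)) := by
  have hT := isOpen_chartTarget (I := 𝓡 n) z
  have hu := (smoothInTime_timeComponent hA).contMDiff t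
  rw [formInner_symm_chart _ (fun x => isUnit_det_spatial h x _) _ _ hy,
    show chartForm z (gradForm n f) y = _ from chartForm_extDer_zeroForm hf hy,
    show chartForm z (gradTime A t) y = _ from chartForm_extDer_zeroForm hu hy, tensorInner_one_form]
  have h1 : ∀ v : Euc n, fderiv ℝ (f ∘ (extChartAt (𝓡 n) z).symm) y v = ((fderiv ℝ g y v : ℝ) : ℂ) := by
    intro v
    have h2 : f ∘ (extChartAt (𝓡 n) z).symm =ᶠ[𝓝 y] fun y => ((g y : ℝ) : ℂ) := by
      filter_upwards [hT.mem_nhds hy] with w hw using hfg w hw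
    rw [h2.fderiv_eq]
    have h3 := (Complex.ofRealCLM.hasFDerivAt.comp y hg.hasFDerivAt).fderiv
    exact congrArg (fun L : Euc n →L[ℝ] ℂ => L v) h3
  have h4 : ∀ v : Euc n, L (fderiv ℝ ((fun x => timeComponent A (t, x)) ∘ (extChartAt (𝓡 n) z).symm) y v) =
      partialSpace (chartRep n (fun t x => L (timeComponent A (t, x))) z) (t, y) v := by
    intro v
    have hd : DifferentiableAt ℝ ((fun x => timeComponent A (t, x)) ∘ (extChartAt (𝓡 n) z).symm) y :=
      (hasFDerivAt_slice (F := fun q : ℝ × Euc n => timeComponent A (q.1, (extChartAt (𝓡 n) z).symm q.2))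
        (differentiableAt_of_contDiffOn hT
          (smoothInTime_zeroForm_iff.1 (smoothInTime_timeComponent hA) z) t hy)).differentiableAt
    have h5 := (L.hasFDerivAt.comp y hd.hasFDerivAt).unique
      (hasFDerivAt_partialSpace hT (contDiffOn_chartRep_timeComponent hA L z) t hy)
    exact congrArg (fun L : Euc n →L[ℝ] ℝ => L v) h5
  simp only [map_sum, coPair, ContinuousAlternatingMap.ofSubsingleton_apply_apply]
  refine Finset.sum_congr rfl fun i _ => Finset.sum_congr rfl fun j _ => ?_
  rw [h1, Complex.conj_ofReal, ← h4, ← mul_assoc, ← Complex.ofReal_mul, ← Complex.real_smul, map_smul,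
    smul_eq_mul, mul_assoc, chartGram_eq]

variable [MeasurableSpace S] [BorelSpace S] [T2Space S] [SecondCountableTopology S] [Nonempty S]

include hA in
/-- The time component of a Maxwell field in the Lorenz gauge solves the wave equation. -/
theorem isWeakWave_timeComponent (hPA : IsMaxwellSolution (ultrastaticMetric h) A)
    (hL : LorenzGauge (ultrastaticMetric h) A) :
    IsWeakWave h fun t x => L (timeComponent A (t, x)) := by
  refine ⟨contDiffOn_chartRep_timeComponent hA L, fun z t g hg hgc hgT => ?_⟩
  obtain ⟨f, hf, hfc, hfs, hfg⟩ := exists_extension z hg hgc hgT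
  have hα := isSmoothForm_gradForm hf
  have hα0 : ∀ x ∉ tsupport f, ∀ β, formInner (spatialMetric h) (gradForm n f) β x = 0 :=
    fun x hx β => formInner_gradForm_eq_zero h hf hx β
  have hβ : IsSmoothForm (zeroForm (𝓡 n) f) := isSmoothForm_zeroForm_iff.2 hf
  have hβ0 : ∀ x ∉ tsupport f, ∀ β, formInner (spatialMetric h) (zeroForm (𝓡 n) f) β x = 0 :=
    fun x hx β => formInner_zeroForm_eq_zero h hx β
  have hC1 := (smoothInTime_timeZeroForm hA).timeDeriv.timeDeriv
  have hC2 := smoothInTime_gradTime hA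
  set F1 : S → ℂ := fun x => formInner (spatialMetric h) (zeroForm (𝓡 n) f)
    (timeDeriv (timeDeriv (timeZeroForm A)) t) x with hF1
  set F2 : S → ℂ := fun x => formInner (spatialMetric h) (gradForm n f) (gradTime A t) x with hF2
  have hi1 : Integrable F1 (volumeMeasure (spatialMetric h)) :=
    integrable_formInner h hfc.isCompact hβ hβ0 hC1 t
  have hi2 : Integrable F2 (volumeMeasure (spatialMetric h)) :=
    integrable_formInner h hfc.isCompact hα hα0 hC2 t
  have hc1 : Continuous F1 := Continuous.comp
    (g := fun p : ℝ × S => formInner (spatialMetric h) (zeroForm (𝓡 n) f)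
      (timeDeriv (timeDeriv (timeZeroForm A)) p.1) p.2)
    (f := fun x => (t, x)) (continuous_formInner_const h hβ hC1) (Continuous.prodMk_right t)
  have hc2 : Continuous F2 := Continuous.comp
    (g := fun p : ℝ × S => formInner (spatialMetric h) (gradForm n f) (gradTime A p.1) p.2)
    (f := fun x => (t, x)) (continuous_formInner_const h hα hC2) (Continuous.prodMk_right t)
  have hsum : ∫ x, (F1 x + F2 x) ∂(volumeMeasure (spatialMetric h)) = 0 := by
    rw [integral_add hi1 hi2]
    have := hodgeInner_wave h hA hf hfc hPA hL t
    exact eq_neg_iff_add_eq_zero.1 this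
  -- The test function is real-valued, so a real-linear functional L passes through both pairings
  -- and reduces the complex equation to a real one.
  have hLsum : ∫ x, L (F1 x + F2 x) ∂(volumeMeasure (spatialMetric h)) = 0 := by
    refine (L.integral_comp_comm (hi1.add hi2)).trans ?_
    exact (congrArg L hsum).trans (map_zero L)
  have hc : Continuous fun x => L (F1 x + F2 x) := L.continuous.comp (hc1.add hc2)
  rw [integral_volumeMeasure_eq_coord h z (F := fun x => L (F1 x + F2 x)) hc.stronglyMeasurable
    fun x hx => by
      have hx' : x ∉ tsupport f := fun h1 => hx (hfs h1)
      rw [show F1 x = 0 from hβ0 x hx' _, show F2 x = 0 from hα0 x hx' _, add_zero, map_zero]] at hLsum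
  rw [← hLsum]
  refine integral_congr_ae ?_
  filter_upwards [ae_mem_target h z] with y hy
  rw [map_add, show L (F2 _) = _ from formInner_gradForm_gradTime_chart h hA L t hy hf
    ((hg.differentiable (by simp)) y) hfg, partialTime_partialTime_chartRep hA L t hy]
  congr 1
  simp only [hF1]
  rw [formInner_eq, tensorInner_zero_form, show formVal (zeroForm (𝓡 n) f) _ ![] = f _ from rfl,
    hfg y hy, Complex.conj_ofReal, ← Complex.real_smul, map_smul, smul_eq_mul]

end ChartRep


/-! ### Uniqueness for the Cauchy problem. -/

section WaveUniqueness

theorem exists_coercive {V : Type*} [NormedAddCommGroup V] [NormedSpace ℝ V] [FiniteDimensional ℝ V]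
    {B : LinearMap.BilinForm ℝ V} (hp : ∀ v, v ≠ 0 → 0 < B v v) :
    ∃ c > 0, ∀ v, c * ‖v‖ ^ 2 ≤ B v v := by
  have hcont : Continuous fun v => B v v := by
    have h1 : Continuous fun v => B.toContinuousBilinearMap v v := by fun_prop
    exact h1
  have := FiniteDimensional.proper_real V
  -- The sphere is empty in dimension zero, which is not excluded.
  rcases (Metric.sphere (0 : V) 1).eq_empty_or_nonempty with h0 | hne
  · refine ⟨1, one_pos, fun v => ?_⟩
    have hv : v = 0 := by
      by_contra hv
      have : ‖v‖⁻¹ • v ∈ Metric.sphere (0 : V) 1 := by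
        simp [norm_smul, norm_ne_zero_iff.2 hv]
      rw [h0] at this
      exact this
    simp [hv]
  · obtain ⟨w, hw, hmin⟩ := (isCompact_sphere (0 : V) 1).exists_isMinOn hne hcont.continuousOn
    have hw0 : w ≠ 0 := by
      rintro rfl
      simp at hw
    refine ⟨B w w, hp w hw0, fun v => ?_⟩
    rcases eq_or_ne v 0 with rfl | hv
    · simp
    have hv' : ‖v‖ ≠ 0 := norm_ne_zero_iff.2 hv
    have h1 : B w w ≤ B (‖v‖⁻¹ • v) (‖v‖⁻¹ • v) :=
      hmin (show ‖v‖⁻¹ • v ∈ Metric.sphere (0 : V) 1 by simp [norm_smul, hv'])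
    simp only [map_smul, LinearMap.smul_apply, smul_eq_mul] at h1
    calc B w w * ‖v‖ ^ 2 ≤ (‖v‖⁻¹ * (‖v‖⁻¹ * B v v)) * ‖v‖ ^ 2 :=
          mul_le_mul_of_nonneg_right h1 (sq_nonneg _)
      _ = B v v := by field_simp

variable {n : ℕ} {S : Type*} [TopologicalSpace S] [ChartedSpace (EuclideanSpace ℝ (Fin n)) S]
  [IsManifold (𝓡 n) ∞ S] (h : SmoothMetric n S) [MeasurableSpace S] [BorelSpace S] [T2Space S]
  [SecondCountableTopology S] [ConnectedSpace S] {u : ℝ → S → ℝ}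

omit [MeasurableSpace S] [BorelSpace S] [T2Space S] [SecondCountableTopology S] [ConnectedSpace S] in
theorem IsWeakWave.hasDerivAt (hu : IsWeakWave h u) {z : S} (t : ℝ) {y : Euc n}
    (hy : y ∈ (extChartAt (𝓡 n) z).target) :
    HasDerivAt (fun s => u s ((extChartAt (𝓡 n) z).symm y))
      (partialTime (chartRep n u z) (t, y)) t :=
  hasDerivAt_partialTime (isOpen_chartTarget z) (hu.smooth z) t hy

omit [MeasurableSpace S] [BorelSpace S] [T2Space S] [SecondCountableTopology S] [ConnectedSpace S] in
/-- Uniqueness for a short time in the neighbourhood of a point, with a uniform lower bound for the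
ratio of the time and the radius of the ball on which the data vanish. -/
theorem IsWeakWave.exists_eq_zero_near (hu : IsWeakWave h u) (z : S) :
    ∃ δ > 0, ∀ t₁ : ℝ, (∀ x, riemDist h z x ≤ 16 * δ → u t₁ x = 0 ∧ deriv (fun s => u s x) t₁ = 0) →
      ∃ W ∈ 𝓝 z, ∀ t, t₁ ≤ t → t ≤ t₁ + 9 / 8 * δ → ∀ x ∈ W, u t x = 0 := by
  set φ := extChartAt (𝓡 n) z with hφ
  set y0 := φ z with hy0
  have hy0T : y0 ∈ φ.target := mem_extChartAt_target z
  set B := chartBilin (spatialMetric h) z y0 with hB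
  have hTo : IsOpen φ.target := isOpen_chartTarget z
  obtain ⟨c, hc, hcB⟩ := exists_coercive (B := B) fun v hv => chartBilin_pos h hy0T hv
  have hBnn : ∀ v, 0 ≤ B v v := fun v => le_trans (by positivity) (hcB v)
  have hBs : ∀ v w, B v w = B w v := chartBilin_symm h z y0
  obtain ⟨r, hr, hball⟩ := Metric.eventually_nhds_iff_ball.1
    ((hTo.eventually_mem hy0T).and (eventually_chartBilin_comparable h z))
  set ρ : Euc n → ℝ := fun y => B (y - y0) (y - y0) with hρ
  set Lc := B.toContinuousBilinearMap with hLc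
  have hρC : ContDiff ℝ ∞ ρ := by
    have h1 : ContDiff ℝ ∞ fun y => Lc (y - y0) (y - y0) :=
      (Lc.contDiff.comp (contDiff_id.sub contDiff_const)).clm_apply (contDiff_id.sub contDiff_const)
    exact h1
  have hρd : ∀ y w, fderiv ℝ ρ y w = 2 * B (y - y0) w := by
    intro y w
    have h1 : HasFDerivAt (fun y : Euc n => y - y0) (ContinuousLinearMap.id ℝ (Euc n)) y :=
      (hasFDerivAt_id y).sub_const y0
    have h2 := ((Lc.hasFDerivAt.comp y h1).clm_apply h1).fderiv
    have h3 : fderiv ℝ ρ y w = Lc (y - y0) w + Lc w (y - y0) := by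
      refine (congrArg (fun L : Euc n →L[ℝ] ℝ => L w) h2).trans ?_
      simp
    rw [h3]
    change B (y - y0) w + B w (y - y0) = _
    rw [hBs w]
    ring
  -- With ε = 8δ one has ε² = c r²/4 < c r², so by coercivity the set ρ ≤ ε² lies in the ball of
  -- radius r on which the metrics are comparable.
  set δ := √c * r / 16 with hδ
  have hδ0 : 0 < δ := by positivity
  set ε := 8 * δ with hε
  have hε0 : 0 < ε := by positivity
  have hεc : ε ^ 2 < c * r ^ 2 := by
    have : ε ^ 2 = c * r ^ 2 / 4 := by
      rw [hε, hδ, mul_pow, div_pow, mul_pow, Real.sq_sqrt hc.le]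
      ring
    rw [this]
    have : 0 < c * r ^ 2 := by positivity
    linarith
  have hK : ∀ y, ρ y ≤ ε ^ 2 → y ∈ Metric.ball y0 r := by
    intro y hy
    have h1 := (hcB (y - y0)).trans (hy.trans hεc.le)
    rw [Metric.mem_ball, dist_eq_norm]
    by_contra! hcon
    have h2 : c * r ^ 2 ≤ c * ‖y - y0‖ ^ 2 := by gcongr
    have h3 := (h2.trans (hcB (y - y0))).trans hy
    exact absurd h3 (not_le.2 hεc)
  have hKT : {y | ρ y ≤ ε ^ 2} ⊆ φ.target := fun y hy => (hball y (hK y hy)).1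
  have hKc : IsCompact {y | ρ y ≤ ε ^ 2} :=
    (isCompact_closedBall y0 r).of_isClosed_subset (isClosed_le hρC.continuous continuous_const)
      fun y hy => Metric.ball_subset_closedBall (hK y hy)
  -- The budget for σ < 1: with ε = 8δ an elapsed time 9δ/8 costs 9/16, which leaves 7/16 for ρ/ε².
  -- The time is strictly longer than δ so that a start δ before an instant covers a full
  -- neighbourhood of that instant.
  refine ⟨δ, hδ0, fun t₁ h0 => ⟨φ.source ∩ φ ⁻¹' {y | ρ y < 7 / 16 * ε ^ 2}, ?_, fun t ht1 ht2 x hx => ?_⟩⟩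
  · refine Filter.inter_mem (extChartAt_source_mem_nhds z) ?_
    refine (continuousAt_extChartAt z).preimage_mem_nhds
      ((isOpen_lt hρC.continuous continuous_const).mem_nhds ?_)
    change ρ y0 < _
    have : ρ y0 = 0 := by simp [hρ]
    rw [this]
    positivity
  · have hdata : ∀ y, ρ y ≤ ε ^ 2 → chartRep n u z (t₁, y) = 0 ∧
        partialTime (chartRep n u z) (t₁, y) = 0 := by
      intro y hy
      -- The set ρ ≤ ε² lies in the distance ball of radius 2ε = 16δ, on which the data vanish by
      -- assumption.
      have h1 := riemDist_chart_le h z (r := ε ^ 2)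
        (fun y hy => ⟨hKT hy, fun v => ((hball y (hK y hy)).2 v).1⟩) hy
      have h2 : √(B (y - y0) (y - y0)) ≤ ε := (Real.sqrt_le_sqrt hy).trans (Real.sqrt_sq hε0.le).le
      have h3 := h0 (φ.symm y) (h1.trans (by rw [hε] at h2; linarith))
      exact ⟨h3.1, by rw [← (hu.hasDerivAt h t₁ (hKT hy)).deriv]; exact h3.2⟩
    have key := eq_zero_of_weak_wave (b := Module.finBasis ℝ (Euc n))
      (Q := fun y => (chartGram (spatialMetric h) z y)⁻¹) (v := chartRep n u z)
      (μ := coordVolume h z) hTo (continuousOn_chartGram_inv h z)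
      (fun y hy => coPair_gramOf_symm (chartBilin_symm h z y) (fun v hv => chartBilin_pos h hy hv) _)
      (fun y hy => coPair_gramOf_nonneg (chartBilin_symm h z y) (fun v hv => chartBilin_pos h hy hv) _)
      (hu.smooth z) hρC hε0 hKc hKT
      (fun y hy => coPair_gramOf_le (chartBilin_symm h z y)
        (fun v hv => chartBilin_pos h (hKT hy) hv) _ hBs hBnn (fun v => ((hball y (hK y hy)).2 v).2)
        (hρd y))
      (coordVolume_lt_top h hKc hKT) (fun O hO hne hOt => coordVolume_pos h hO hne hOt)
      (hu.weak z) hdata ht1 (y := φ x) (by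
        have hx2 : ρ (φ x) < 7 / 16 * ε ^ 2 := hx.2
        have h1 : ρ (φ x) / ε ^ 2 < 7 / 16 := by
          rw [div_lt_iff₀ (by positivity)]
          exact hx2
        have h2 : 4 * (t - t₁) / ε ≤ 9 / 16 := by
          rw [div_le_iff₀ hε0, hε]
          linarith
        linarith)
    have h4 : φ.symm (φ x) = x := φ.left_inv hx.1
    rw [← h4]
    exact key

omit [MeasurableSpace S] [BorelSpace S] [SecondCountableTopology S] in
/-- Uniqueness in the future for the Cauchy problem of the wave equation. -/
theorem IsWeakWave.eq_zero_of_nonneg (hgh : IsGloballyHyperbolicUltrastatic h) (hu : IsWeakWave h u)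
    (h0 : ∀ x, u 0 x = 0 ∧ deriv (fun s => u s x) 0 = 0) {t : ℝ} (ht : 0 ≤ t) (x : S) :
    u t x = 0 := by
  by_contra hne
  have ht0 : 0 < t := lt_of_le_of_ne ht fun h1 => hne (h1 ▸ (h0 x).1)
  set Z : Set (ℝ × S) := closure {q | 0 < q.1 ∧ u q.1 q.2 ≠ 0} with hZ
  -- The part of the support in a backward cone from (t, x). The slope 16 is the ratio between the
  -- radius 16δ of the data and the time δ in the local uniqueness statement. The cone is compact
  -- because closed balls are, so C has an earliest point (s, z).
  set C : Set (ℝ × S) := Z ∩ {q | 0 ≤ q.1 ∧ q.1 ≤ t ∧ riemDist h x q.2 ≤ 16 * (t - q.1)} with hC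
  have hd : Continuous fun q : ℝ × S => riemDist h x q.2 := (continuous_riemDist h x).comp continuous_snd
  have hCc : IsCompact C := by
    refine ((isCompact_Icc (a := (0 : ℝ)) (b := t)).prod
      (isCompact_riemDist_le h hgh x (16 * t))).of_isClosed_subset (isClosed_closure.inter ?_) ?_
    · exact (isClosed_le continuous_const continuous_fst).inter
        ((isClosed_le continuous_fst continuous_const).inter (isClosed_le hd (by fun_prop)))
    · rintro q ⟨-, h1, h2, h3⟩
      exact ⟨⟨h1, h2⟩, h3.trans (by linarith)⟩
  have hCne : (t, x) ∈ C := ⟨subset_closure ⟨ht0, hne⟩, ht, le_rfl, by simp [riemDist_self]⟩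
  obtain ⟨⟨s, z⟩, ⟨hsZ, hs0, hst, hsd⟩, hmin⟩ := hCc.exists_isMinOn ⟨_, hCne⟩ continuous_fst.continuousOn
  simp only at hs0 hst hsd
  obtain ⟨δ, hδ, hloc⟩ := hu.exists_eq_zero_near h z
  -- Step back by δ, but not past the initial time. If t₁ = 0 the data vanish by hypothesis;
  -- otherwise the ball of radius 16δ around z at time t₁ is still in the cone and earlier than s,
  -- hence outside the support. Local uniqueness then makes u vanish at the positive times near (s,
  -- z), a contradiction.
  set t₁ := max (s - δ) 0 with ht₁
  have hdata : ∀ w, riemDist h z w ≤ 16 * δ → u t₁ w = 0 ∧ deriv (fun s => u s w) t₁ = 0 := by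
    intro w hw
    rcases le_or_gt (s - δ) 0 with h1 | h1
    · rw [ht₁, max_eq_right h1]
      exact h0 w
    · have h2 : t₁ = s - δ := max_eq_left h1.le
      have h3 : (t₁, w) ∉ Z := by
        intro h3
        have h4 : (t₁, w) ∈ C := by
          refine ⟨h3, ?_, ?_, ?_⟩
          · exact le_max_right _ _
          · simp only [h2]; linarith
          · simp only [h2]
            have := riemDist_triangle h x z w
            linarith
        have h5 : s ≤ t₁ := hmin h4
        linarith
      have h4 : ∀ᶠ q in 𝓝 (t₁, w), q ∉ {q : ℝ × S | 0 < q.1 ∧ u q.1 q.2 ≠ 0} :=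
        Filter.mem_of_superset (isClosed_closure.isOpen_compl.mem_nhds h3) fun q hq hq' =>
          hq (subset_closure hq')
      have h5 : (fun s => u s w) =ᶠ[𝓝 t₁] fun _ => 0 := by
        have h6 : Filter.Tendsto (fun s : ℝ => (s, w)) (𝓝 t₁) (𝓝 (t₁, w)) :=
          (Continuous.prodMk_left w).tendsto t₁
        filter_upwards [h6.eventually h4, lt_mem_nhds (show 0 < t₁ by linarith)] with s' hs' hs''
        by_contra h7
        exact hs' ⟨hs'', h7⟩
      exact ⟨h5.self_of_nhds, by rw [h5.deriv_eq]; simp⟩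
  obtain ⟨W, hW, hWu⟩ := hloc t₁ hdata
  have hst1 : s ≤ t₁ + δ := by linarith [le_max_left (s - δ) 0]
  have hnear : ∀ᶠ q in 𝓝 (s, z), q ∉ {q : ℝ × S | 0 < q.1 ∧ u q.1 q.2 ≠ 0} := by
    have h1 : ∀ᶠ s' in 𝓝 s, s' < t₁ + 9 / 8 * δ := gt_mem_nhds (by linarith)
    have h2 : ∀ᶠ s' in 𝓝 s, s - δ < s' := lt_mem_nhds (by linarith)
    rw [nhds_prod_eq]
    filter_upwards [(h1.and h2).prod_mk hW] with q hq hq'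
    refine hq'.2 (hWu q.1 (max_le hq.1.2.le hq'.1.le) hq.1.1.le q.2 hq.2)
  obtain ⟨q, hq, hq'⟩ := mem_closure_iff_nhds.1 hsZ _ hnear
  exact hq hq'

omit [MeasurableSpace S] [BorelSpace S] [T2Space S] [SecondCountableTopology S] [ConnectedSpace S] in
-- The equation contains only the second time derivative and the metric is static, so time reversal
-- reduces uniqueness in the past to uniqueness in the future.
theorem IsWeakWave.comp_neg (hu : IsWeakWave h u) : IsWeakWave h fun t x => u (-t) x := by
  set R : (ℝ × Euc n) ≃L[ℝ] ℝ × Euc n :=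
    (ContinuousLinearEquiv.neg ℝ).prodCongr (ContinuousLinearEquiv.refl ℝ (Euc n)) with hR
  have hRa : ∀ t (y : Euc n), R (t, y) = (-t, y) := fun _ _ => rfl
  have hrep : ∀ z, chartRep n (fun t x => u (-t) x) z = chartRep n u z ∘ R := fun z => rfl
  have hfd : ∀ v : ℝ × Euc n → ℝ, ∀ q, fderiv ℝ (v ∘ R) q = (fderiv ℝ v (R q)).comp (R : ℝ × Euc n →L[ℝ] ℝ × Euc n) := fun v q =>
    R.comp_right_fderiv
  have hpt : ∀ v : ℝ × Euc n → ℝ, partialTime (v ∘ R) = fun q => -partialTime v (R q) := by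
    intro v
    ext q
    change fderiv ℝ (v ∘ R) q (1, 0) = -fderiv ℝ v (R q) (1, 0)
    rw [hfd, ← map_neg]
    refine congrArg (fderiv ℝ v (R q)) ?_
    change ((-1 : ℝ), (0 : Euc n)) = _
    simp
  have hps : ∀ v : ℝ × Euc n → ℝ, ∀ q, partialSpace (v ∘ R) q = partialSpace v (R q) := by
    intro v q
    ext w
    change fderiv ℝ (v ∘ R) q (0, w) = fderiv ℝ v (R q) (0, w)
    rw [hfd]
    refine congrArg (fderiv ℝ v (R q)) ?_
    change (-(0 : ℝ), w) = _
    simp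
  have hptt : ∀ v : ℝ × Euc n → ℝ, ∀ q,
      partialTime (partialTime (v ∘ R)) q = partialTime (partialTime v) (R q) := by
    intro v q
    have h1 : partialTime (v ∘ R) = (fun q => -partialTime v q) ∘ R := hpt v
    rw [h1, hpt]
    change -(fderiv ℝ (fun q => -partialTime v q) (R q) (1, 0)) = _
    rw [fderiv_fun_neg]
    simp [partialTime]
  refine ⟨fun z => ?_, fun z t g hg hgc hgT => ?_⟩
  · rw [hrep]
    refine (hu.smooth z).comp R.contDiff.contDiffOn ?_
    rintro ⟨t, y⟩ hq
    exact ⟨trivial, hq.2⟩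
  · simp only [hrep, hptt, hps, hRa]
    exact hu.weak z (-t) g hg hgc hgT

omit [MeasurableSpace S] [BorelSpace S] [SecondCountableTopology S] in
/-- Uniqueness for the Cauchy problem of the wave equation. -/
theorem IsWeakWave.eq_zero (hgh : IsGloballyHyperbolicUltrastatic h) (hu : IsWeakWave h u)
    (h0 : ∀ x, u 0 x = 0 ∧ deriv (fun s => u s x) 0 = 0) (t : ℝ) (x : S) : u t x = 0 := by
  rcases le_total 0 t with ht | ht
  · exact hu.eq_zero_of_nonneg h hgh h0 ht x
  · have := (hu.comp_neg h).eq_zero_of_nonneg h hgh (fun x => ⟨by simpa using (h0 x).1, by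
      rw [deriv_comp_neg (fun s => u s x)]
      simp [(h0 x).2]⟩) (neg_nonneg.2 ht) x
    simpa using this

end WaveUniqueness


/-! ### The normal derivative of A₀; Lorenz versus Coulomb gauge when A₀ = 0. -/

section Gauges

variable {n : ℕ} {S : Type*} [TopologicalSpace S] [ChartedSpace (EuclideanSpace ℝ (Fin n)) S]
  [IsManifold (𝓡 n) ∞ S] (h : SmoothMetric n S)
  {A : DiffForm (𝓘(ℝ, ℝ).prod (𝓡 n)) (ℝ × S) 1} (hA : IsSmoothForm A)

theorem smoothInTime_slice {a : ℝ × S → ℂ} (ha : ContMDiff (𝓘(ℝ, ℝ).prod (𝓡 n)) 𝓘(ℝ, ℂ) ∞ a) :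
    SmoothInTime fun t => zeroForm (𝓡 n) fun x => a (t, x) := by
  rw [smoothInTime_zeroForm_iff]
  intro z
  have h0 : ContDiffOn ℝ ∞ (a ∘ (extChartAt (𝓘(ℝ, ℝ).prod (𝓡 n)) ((0 : ℝ), z)).symm)
      (extChartAt (𝓘(ℝ, ℝ).prod (𝓡 n)) ((0 : ℝ), z)).target :=
    (ha.comp_contMDiffOn (contMDiffOn_extChartAt_symm _)).contDiffOn
  rw [prodChart_target] at h0
  refine h0.congr fun q hq => ?_
  rw [Function.comp_apply, prodChart_symm_apply]

/-! ### The normal derivative of the time component -/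

theorem chartMetric_ultrastatic_time (p : ℝ × S) {q : ℝ × Euc n}
    (hq : q.2 ∈ (extChartAt (𝓡 n) p.2).target) (w : ℝ × Euc n) :
    chartMetric (ultrastaticMetric h) p q (1, 0) w = -w.1 := by
  rw [← chartBilin_apply]
  change metricVal (ultrastaticMetric h) _ (chartDeriv (𝓘(ℝ, ℝ).prod (𝓡 n)) p q (1, 0))
    (chartDeriv (𝓘(ℝ, ℝ).prod (𝓡 n)) p q w) = _
  rw [prodChart_chartDeriv p hq]
  refine (ultrastaticMetric_apply h _ 1 w.1 (chartDeriv (𝓡 n) p.2 q.2 0)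
    (chartDeriv (𝓡 n) p.2 q.2 w.2)).trans ?_
  rw [map_zero, one_mul]
  change -w.1 + metricVal (spatialMetric h) _ 0 _ = _
  simp

theorem fderiv_chartMetric_ultrastatic_time (p : ℝ × S) {q : ℝ × Euc n}
    (hq : q.2 ∈ (extChartAt (𝓡 n) p.2).target) (w : ℝ × Euc n) :
    fderiv ℝ (fun z => chartMetric (ultrastaticMetric h) p z (1, 0) w) q = 0 := by
  have h1 : (fun z => chartMetric (ultrastaticMetric h) p z (1, 0) w) =ᶠ[𝓝 q] fun _ => -w.1 := by
    filter_upwards [(isOpen_prodTarget p.2).mem_nhds (show q ∈ _ from ⟨trivial, hq⟩)] with z hz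
    exact chartMetric_ultrastatic_time h p hz.2 w
  rw [h1.fderiv_eq]
  simp

include hA in
/-- The second covariant condition is the vanishing of the time derivative of `A₀`. -/
theorem hasDerivAt_timeComponent (p : ℝ × S) :
    HasDerivAt (fun s => timeComponent A (s, p.2))
      (covDeriv (ultrastaticMetric h) A p (partialT p) (partialT p)) p.1 := by
  set y := extChartAt (𝓡 n) p.2 p.2 with hy
  have hyT : y ∈ (extChartAt (𝓡 n) p.2).target := mem_extChartAt_target p.2
  have hcov : covDeriv (ultrastaticMetric h) A p (partialT p) (partialT p) =
      fderiv ℝ (fun z : ℝ × Euc n => chartForm p A z fun _ => (1, 0)) (p.1, y) (1, 0) := by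
    have hid : ∀ v : ℝ × Euc n, (mfderiv (𝓘(ℝ, ℝ).prod (𝓡 n)) 𝓘(ℝ, ℝ × Euc n)
        (extChartAt (𝓘(ℝ, ℝ).prod (𝓡 n)) p) p : (ℝ × Euc n) →L[ℝ] ℝ × Euc n) v = v := by
      intro v
      rw [mfderiv_extChartAt_self]
      rfl
    have hu : (mfderiv (𝓘(ℝ, ℝ).prod (𝓡 n)) 𝓘(ℝ, ℝ × Euc n)
        (extChartAt (𝓘(ℝ, ℝ).prod (𝓡 n)) p) p (partialT p) : ℝ × Euc n) = (1, 0) := hid (1, 0)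
    -- Every metric component in this symbol has ∂_t in a slot, and in a product chart these
    -- components are constant.
    have hch : ∀ l, christoffel (ultrastaticMetric h) p (p.1, y) (1, 0) (1, 0) l = 0 := by
      intro l
      unfold christoffel
      rw [fderiv_chartMetric_ultrastatic_time h p hyT l,
        fderiv_chartMetric_ultrastatic_time h p hyT (1, 0)]
      simp
    unfold covDeriv
    simp only [hu, prodChart_apply, ← hy, hch, mul_zero, Complex.ofReal_zero, zero_mul,
      Finset.sum_const_zero, sub_zero]
  rw [hcov]
  have hd : DifferentiableAt ℝ (fun z : ℝ × Euc n => chartForm p A z fun _ => (1, 0)) (p.1, y) :=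
    (ContinuousAlternatingMap.apply ℝ (ℝ × Euc n) ℂ
      (fun _ : Fin 1 => ((1 : ℝ), (0 : Euc n)))).differentiableAt.comp _
      (differentiableAt_chartForm hA p)
  refine (hasDerivAt_slice hd).congr_of_eventuallyEq (Filter.Eventually.of_forall fun s => ?_)
  simp only
  rw [← timeComponent_chart A p (q := (s, y)) hyT]
  simp [hy]

/-! ### Temporal, Lorenz and Coulomb gauges -/

omit [IsManifold (𝓡 n) ∞ S] in
theorem timeDeriv_timeZeroForm_eq_zero (hT : TemporalGauge A) (t : ℝ) :
    timeDeriv (timeZeroForm A) t = 0 := by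
  have h1 : timeZeroForm A = fun _ => 0 := by
    funext s x
    ext v
    exact hT (s, x)
  funext x
  rw [h1]
  exact deriv_const t (0 : (Euc n) [⋀^Fin 0]→L[ℝ] ℂ)

variable [MeasurableSpace S] [BorelSpace S] [T2Space S] [SecondCountableTopology S] [Nonempty S]

omit [BorelSpace S] [T2Space S] [SecondCountableTopology S] [Nonempty S] in
theorem CoulombGauge.hodgeInner_eq_zero (hC : CoulombGauge h A) (t : ℝ) {f : S → ℂ}
    (hf : ContMDiff (𝓡 n) 𝓘(ℝ, ℂ) ∞ f) (hfc : HasCompactSupport f) :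
    hodgeInner (spatialMetric h) (gradForm n f) (spatialPart A t) = 0 := by
  refine (hC t (zeroForm (𝓡 n) f) (isSmoothForm_zeroForm_iff.2 hf) ?_).trans
    (hodgeInner_zero_right _ _)
  rw [formSupport_zeroForm]
  exact hfc

include hA in
-- When A₀ = 0 the slice form of the Lorenz gauge loses its time-derivative term and is literally
-- the Coulomb gauge.
theorem coulombGauge_of_radiationGauge (hR : RadiationGauge h A) : CoulombGauge h A := by
  intro t α hα hαc
  rw [hodgeInner_zero_right]
  rw [← zeroForm_apply_self α] at hα hαc ⊢
  rw [formSupport_zeroForm] at hαc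
  have h1 := hodgeInner_timeDeriv_timeZeroForm h hA (isSmoothForm_zeroForm_iff.1 hα) hαc hR.2 t
  rwa [timeDeriv_timeZeroForm_eq_zero hR.1, hodgeInner_zero_right, zero_add] at h1

include hA in
-- When A₀ = 0 the spacetime pairing of da with A is the time integral of its slice pairings, and
-- the slices of a spacetime test function are test functions on Σ.
theorem lorenzGauge_of_coulombGauge (hT : TemporalGauge A) (hC : CoulombGauge h A) :
    LorenzGauge (ultrastaticMetric h) A := by
  intro α hα hαc
  rw [hodgeInner_zero_right]
  rw [← zeroForm_apply_self α] at hα hαc ⊢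
  rw [formSupport_zeroForm] at hαc
  set a : ℝ × S → ℂ := fun p => α p ![]
  have ha : ContMDiff (𝓘(ℝ, ℝ).prod (𝓡 n)) 𝓘(ℝ, ℂ) ∞ a := isSmoothForm_zeroForm_iff.1 hα
  have hac : HasCompactSupport a := hαc
  have hform : ∀ p : ℝ × S, formInner (ultrastaticMetric h) (extDer (zeroForm _ a)) A p =
      formInner (spatialMetric h) (gradForm n fun x => a (p.1, x)) (spatialPart A p.1) p.2 := by
    intro p
    refine (formInner_ultrastatic_one h ha p).trans ?_
    rw [hT p, mul_zero, neg_zero, zero_add]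
    rfl
  have hB : SmoothInTime fun t => gradForm n fun x => a (t, x) :=
    SmoothInTime.extDer (u := fun t x => a (t, x)) (smoothInTime_slice ha)
  generalize hBd : (fun t => gradForm n fun x => a (t, x)) = B at hB
  have hBt : ∀ t, gradForm n (fun x => a (t, x)) = B t := fun t => congrFun hBd t
  have hc : Continuous fun p : ℝ × S => formInner (ultrastaticMetric h) (extDer (zeroForm _ a)) A p := by
    simp only [hform, hBt]
    exact continuous_formInner h hB (smoothInTime_spatialPart hA)
  have hs : HasCompactSupport fun p : ℝ × S =>
      formInner (ultrastaticMetric h) (extDer (zeroForm _ a)) A p := by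
    refine HasCompactSupport.intro hac.isCompact fun p hp => ?_
    rw [hform]
    refine formInner_gradForm_eq_zero h (contMDiff_slice ha p.1) ?_ _
    rw [notMem_tsupport_iff_eventuallyEq] at hp ⊢
    have h1 : Filter.Tendsto (fun x : S => (p.1, x)) (𝓝 p.2) (𝓝 p) :=
      (Continuous.prodMk_right p.1).tendsto p.2
    exact h1.eventually hp
  have hslice : ∀ t, HasCompactSupport fun x => a (t, x) := fun t =>
    HasCompactSupport.intro (hac.isCompact.image continuous_snd) fun x hx =>
      image_eq_zero_of_notMem_tsupport fun h1 => hx ⟨_, h1, rfl⟩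
  rw [hodgeInner_ultrastatic_eq h hc hs]
  simp only [hform]
  have hz : ∀ t, ∫ x, formInner (spatialMetric h) (gradForm n fun x => a (t, x)) (spatialPart A t) x
      ∂(volumeMeasure (spatialMetric h)) = 0 := fun t =>
    hC.hodgeInner_eq_zero h t (contMDiff_slice ha t) (hslice t)
  simp [hz]

end Gauges

/-! ### Cauchy radiation gauge versus radiation gauge. -/

section Cauchy

variable {n : ℕ} {S : Type*} [TopologicalSpace S] [ChartedSpace (EuclideanSpace ℝ (Fin n)) S]
  [IsManifold (𝓡 n) ∞ S] (h : SmoothMetric n S)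
  {A : DiffForm (𝓘(ℝ, ℝ).prod (𝓡 n)) (ℝ × S) 1} (hA : IsSmoothForm A)
  [MeasurableSpace S]

include hA in
theorem cauchyRadiationGauge_of_radiationGauge (hR : RadiationGauge h A) :
    CauchyRadiationGauge h A := by
  refine ⟨hR.2, fun p _ => ⟨hR.1 p, ?_⟩⟩
  have h1 := hasDerivAt_timeComponent h hA p
  simp only [hR.1 _] at h1
  exact h1.unique (hasDerivAt_const _ _)

variable [BorelSpace S] [T2Space S] [SecondCountableTopology S] [ConnectedSpace S]

include hA in
-- The real and imaginary parts of A₀ solve the wave equation; the two conditions on Σ₀ say that A₀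
-- and ∂_t A₀ vanish there.
theorem radiationGauge_of_cauchyRadiationGauge (hgh : IsGloballyHyperbolicUltrastatic h)
    (hPA : IsMaxwellSolution (ultrastaticMetric h) A) (hR : CauchyRadiationGauge h A) :
    RadiationGauge h A := by
  have key : ∀ (L : ℂ →L[ℝ] ℝ) (p : ℝ × S), L (timeComponent A p) = 0 := by
    intro L p
    refine (isWeakWave_timeComponent h hA L hPA hR.1).eq_zero h hgh (fun x => ?_) p.1 p.2
    obtain ⟨h1, h2⟩ := hR.2 (0, x) rfl
    have h3 := L.hasFDerivAt.comp_hasDerivAt (0 : ℝ) (hasDerivAt_timeComponent h hA (0, x))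
    rw [h2, map_zero] at h3
    exact ⟨by rw [h1, map_zero], h3.deriv⟩
  exact ⟨fun p => Complex.ext (key Complex.reCLM p) (key Complex.imCLM p), hR.1⟩

end Cauchy


/-! ### Vanishing Dirichlet energy, and the Coulomb gauge for spacelike compact fields. -/

section DirichletEnergy

variable {n : ℕ} {S : Type*} [TopologicalSpace S] [ChartedSpace (EuclideanSpace ℝ (Fin n)) S]
  [IsManifold (𝓡 n) ∞ S] {f : S → ℂ} (hf : ContMDiff (𝓡 n) 𝓘(ℝ, ℂ) ∞ f)

include hf in
theorem eq_const_of_differential_eq_zero [PreconnectedSpace S]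
    (h0 : ∀ x, differential (𝓡 n) f x = 0) (x y : S) : f x = f y := by
  refine IsLocallyConstant.apply_eq_of_preconnectedSpace ((IsLocallyConstant.iff_eventually_eq f).2
    fun z => ?_) x y
  set φ := extChartAt (𝓡 n) z with hφ
  have hTo : IsOpen φ.target := isOpen_chartTarget z
  obtain ⟨r, hr, hball⟩ := Metric.isOpen_iff.1 hTo (φ z) (mem_extChartAt_target z)
  have hd : ∀ w ∈ φ.target, HasFDerivAt (f ∘ φ.symm) (0 : Euc n →L[ℝ] ℂ) w := by
    intro w hw
    have h1 : MDifferentiableAt 𝓘(ℝ, Euc n) (𝓡 n) φ.symm w :=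
      (mdifferentiableOn_extChartAt_symm (I := 𝓡 n) (x := z) w hw).mdifferentiableAt (hTo.mem_nhds hw)
    have h2 : MDifferentiableAt (𝓡 n) 𝓘(ℝ, ℂ) f (φ.symm w) := hf.mdifferentiableAt (by simp)
    have h3 : (mfderiv 𝓘(ℝ, Euc n) 𝓘(ℝ, ℂ) (f ∘ φ.symm) w : Euc n →L[ℝ] ℂ) =
        (differential (𝓡 n) f (φ.symm w)).comp (chartDeriv (𝓡 n) z w) := mfderiv_comp w h2 h1
    rw [h0, ContinuousLinearMap.zero_comp, mfderiv_eq_fderiv] at h3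
    have h4 := (h2.comp w h1).differentiableAt.hasFDerivAt
    rwa [h3] at h4
  filter_upwards [extChartAt_source_mem_nhds (I := 𝓡 n) z,
    (continuousAt_extChartAt (I := 𝓡 n) z).preimage_mem_nhds (Metric.ball_mem_nhds _ hr)] with w hw hwr
  have h1 := Metric.isOpen_ball.is_const_of_fderiv_eq_zero (convex_ball (φ z) r).isPreconnected
    (fun y hy => (hd y (hball hy)).differentiableAt.differentiableWithinAt)
    (fun y hy => (hd y (hball hy)).fderiv) hwr (Metric.mem_ball_self hr)
  simp only [Function.comp_apply] at h1
  rwa [φ.left_inv hw, φ.left_inv (mem_extChartAt_source z)] at h1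

variable (h : SmoothMetric n S)

include hf in
theorem re_formInner_gradForm_self (x : S) :
    (formInner (spatialMetric h) (gradForm n f) (gradForm n f) x).re =
      coPair (Module.finBasis ℝ (Euc n))
        (gramOf (metricVal (spatialMetric h) x) (Module.finBasis ℝ (Euc n)))⁻¹
        (Complex.reCLM.comp (differential (𝓡 n) f x)) (Complex.reCLM.comp (differential (𝓡 n) f x)) +
      coPair (Module.finBasis ℝ (Euc n))
        (gramOf (metricVal (spatialMetric h) x) (Module.finBasis ℝ (Euc n)))⁻¹
        (Complex.imCLM.comp (differential (𝓡 n) f x)) (Complex.imCLM.comp (differential (𝓡 n) f x)) := by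
  have h1 : ∀ v, formVal (gradForm n f) x (fun _ => v) = differential (𝓡 n) f x v :=
    extDer_zeroForm_apply hf x
  rw [formInner_eq, tensorInner_one_form]
  simp only [h1, coPair, Complex.re_sum, ← Finset.sum_add_distrib, Complex.mul_re,
    Complex.ofReal_re, Complex.ofReal_im, zero_mul, sub_zero, Complex.conj_re, Complex.conj_im, ContinuousLinearMap.comp_apply,
    Complex.reCLM_apply, Complex.imCLM_apply]
  exact Finset.sum_congr rfl fun i _ => Finset.sum_congr rfl fun j _ => by ring

include hf in
theorem re_formInner_gradForm_self_nonneg (x : S) :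
    0 ≤ (formInner (spatialMetric h) (gradForm n f) (gradForm n f) x).re := by
  rw [re_formInner_gradForm_self hf]
  exact add_nonneg (coPair_gramOf_nonneg (spatialMetric_symm h x) (spatialMetric_pos h x) _ _)
    (coPair_gramOf_nonneg (spatialMetric_symm h x) (spatialMetric_pos h x) _ _)

include hf in
theorem differential_eq_zero_of_formInner_eq_zero {x : S}
    (h0 : (formInner (spatialMetric h) (gradForm n f) (gradForm n f) x).re = 0) :
    differential (𝓡 n) f x = 0 := by
  rw [re_formInner_gradForm_self hf, add_eq_zero_iff_of_nonneg
    (coPair_gramOf_nonneg (spatialMetric_symm h x) (spatialMetric_pos h x) _ _)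
    (coPair_gramOf_nonneg (spatialMetric_symm h x) (spatialMetric_pos h x) _ _)] at h0
  have h1 := eq_zero_of_coPair_gramOf_eq_zero (spatialMetric_symm h x) (spatialMetric_pos h x) _ h0.1
  have h2 := eq_zero_of_coPair_gramOf_eq_zero (spatialMetric_symm h x) (spatialMetric_pos h x) _ h0.2
  ext v
  exact Complex.ext (congrArg (fun L : Euc n →L[ℝ] ℝ => L v) h1)
    (congrArg (fun L : Euc n →L[ℝ] ℝ => L v) h2)

variable [MeasurableSpace S] [BorelSpace S] [T2Space S] [SecondCountableTopology S] [ConnectedSpace S]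

include hf in
/-- A compactly supported function of zero Dirichlet energy vanishes on a non-compact manifold. -/
theorem eq_zero_of_hodgeInner_gradForm_self [NoncompactSpace S] (hfc : HasCompactSupport f)
    (h0 : hodgeInner (spatialMetric h) (gradForm n f) (gradForm n f) = 0) (x : S) : f x = 0 := by
  have hC : SmoothInTime fun _ => gradForm n f := smoothInTime_const (isSmoothForm_gradForm hf)
  generalize hCd : (fun _ : ℝ => gradForm n f) = C at hC
  have hC0 : C 0 = gradForm n f := (congrFun hCd 0).symm
  have hα0 : ∀ x ∉ tsupport f, ∀ β, formInner (spatialMetric h) (gradForm n f) β x = 0 :=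
    fun x hx β => formInner_gradForm_eq_zero h hf hx β
  have hint := integrable_formInner h hfc.isCompact (isSmoothForm_gradForm hf) hα0 hC 0
  have hc : Continuous fun x => formInner (spatialMetric h) (gradForm n f) (C 0) x :=
    Continuous.comp (g := fun p : ℝ × S => formInner (spatialMetric h) (gradForm n f) (C p.1) p.2)
      (f := fun x => ((0 : ℝ), x)) (continuous_formInner_const h (isSmoothForm_gradForm hf) hC)
      (Continuous.prodMk_right 0)
  rw [hC0] at hint hc
  have h1 : ∫ x, (formInner (spatialMetric h) (gradForm n f) (gradForm n f) x).re
      ∂(volumeMeasure (spatialMetric h)) = 0 :=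
    (Complex.reCLM.integral_comp_comm hint).trans ((congrArg Complex.re h0).trans Complex.zero_re)
  rw [integral_eq_zero_iff_of_nonneg (re_formInner_gradForm_self_nonneg hf h) hint.re] at h1
  have h2 := (Continuous.ae_eq_iff_eq _ (Complex.continuous_re.comp hc) continuous_const).1 h1
  have hconst := eq_const_of_differential_eq_zero hf fun x =>
    differential_eq_zero_of_formInner_eq_zero hf h (congrFun h2 x)
  by_contra hne
  -- A nonzero constant has the whole manifold as its support, which would then be compact.
  refine noncompact_univ S (hfc.isCompact.of_isClosed_subset isClosed_univ fun y _ =>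
    subset_closure ?_)
  rw [Function.mem_support, hconst y x]
  exact hne

/-- For spacelike compact Maxwell fields on a non-compact slice, the Coulomb gauge is temporal. -/
theorem temporalGauge_of_coulombGauge [NoncompactSpace S] (hgh : IsGloballyHyperbolicUltrastatic h)
    {A : DiffForm (𝓘(ℝ, ℝ).prod (𝓡 n)) (ℝ × S) 1} (hA : IsSmoothForm A)
    (hPA : IsMaxwellSolution (ultrastaticMetric h) A)
    (hsc : IsSpacelikeCompact (ultrastaticMetric h) A) (hC : CoulombGauge h A) : TemporalGauge A := by
  rintro ⟨t, x⟩
  have hf := (smoothInTime_timeComponent hA).contMDiff t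
  have hfc : HasCompactSupport fun x => timeComponent A (t, x) := by
    refine isCompact_tsupport_of_isSpacelikeCompact h hgh hsc t fun x hx hAx => hx ?_
    change formVal A (t, x) _ = 0
    rw [show formVal A (t, x) = 0 from hAx]
    rfl
  refine eq_zero_of_hodgeInner_gradForm_self hf h hfc ?_ x
  -- The test function is A₀ frozen at the time t while A_Σ varies in time. Differentiating the
  -- Coulomb identity and inserting Gauss's law leaves the Dirichlet energy of A₀(t, ·).
  have h1 := hasDerivAt_hodgeInner h hfc.isCompact (isSmoothForm_gradForm hf)
    (fun x hx β => formInner_gradForm_eq_zero h hf hx β) (smoothInTime_spatialPart hA) t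
  simp only [hC.hodgeInner_eq_zero h _ hf hfc] at h1
  have h2 := h1.unique (hasDerivAt_const t (0 : ℂ))
  rwa [hodgeInner_timeDeriv_spatialPart h hA hf hfc hPA] at h2

end DirichletEnergy

end MaxwellGauge

/-! ### The equivalences. -/

theorem proposition2p2 (n : ℕ) (S : Type*) [TopologicalSpace S]
    [ChartedSpace (EuclideanSpace ℝ (Fin n)) S] [IsManifold (𝓡 n) ∞ S]
    [T2Space S] [SecondCountableTopology S] [ConnectedSpace S]
    [MeasurableSpace S] [BorelSpace S]
    (h : MaxwellGauge.SmoothMetric n S)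
    (hgh : MaxwellGauge.IsGloballyHyperbolicUltrastatic h)
    (A : MaxwellGauge.DiffForm (𝓘(ℝ, ℝ).prod (𝓡 n)) (ℝ × S) 1)
    (hA : MaxwellGauge.IsSmoothForm A)
    (hPA : MaxwellGauge.IsMaxwellSolution (MaxwellGauge.ultrastaticMetric h) A) :
    [MaxwellGauge.CauchyRadiationGauge h A,
      MaxwellGauge.TemporalGauge A ∧ MaxwellGauge.CoulombGauge h A,
      MaxwellGauge.RadiationGauge h A].TFAE ∧
    (NoncompactSpace S → MaxwellGauge.IsSpacelikeCompact (MaxwellGauge.ultrastaticMetric h) A →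
      [MaxwellGauge.CauchyRadiationGauge h A,
        MaxwellGauge.TemporalGauge A ∧ MaxwellGauge.CoulombGauge h A,
        MaxwellGauge.RadiationGauge h A,
        MaxwellGauge.CoulombGauge h A].TFAE) := by
  have h13 : MaxwellGauge.CauchyRadiationGauge h A → MaxwellGauge.RadiationGauge h A :=
    MaxwellGauge.radiationGauge_of_cauchyRadiationGauge h hA hgh hPA
  have h31 : MaxwellGauge.RadiationGauge h A → MaxwellGauge.CauchyRadiationGauge h A :=
    MaxwellGauge.cauchyRadiationGauge_of_radiationGauge h hA
  have h32 : MaxwellGauge.RadiationGauge h A →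
      MaxwellGauge.TemporalGauge A ∧ MaxwellGauge.CoulombGauge h A := fun hR =>
    ⟨hR.1, MaxwellGauge.coulombGauge_of_radiationGauge h hA hR⟩
  have h23 : MaxwellGauge.TemporalGauge A ∧ MaxwellGauge.CoulombGauge h A →
      MaxwellGauge.RadiationGauge h A := fun hTC =>
    ⟨hTC.1, MaxwellGauge.lorenzGauge_of_coulombGauge h hA hTC.1 hTC.2⟩
  refine ⟨?_, fun hnc hsc => ?_⟩
  · tfae_have 1 → 3 := h13
    tfae_have 3 → 1 := h31
    tfae_have 3 → 2 := h32
    tfae_have 2 → 3 := h23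
    tfae_finish
  · tfae_have 1 → 3 := h13
    tfae_have 3 → 1 := h31
    tfae_have 3 → 2 := h32
    tfae_have 2 → 3 := h23
    tfae_have 2 → 4 := And.right
    tfae_have 4 → 2 := fun hC =>
      ⟨MaxwellGauge.temporalGauge_of_coulombGauge h hgh hA hPA hsc hC, hC⟩
    tfae_finish
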